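/- Let $\sigma \in \mathbb{R} \setminus \{0\}$ and $N \geq 1$. For an integer $k \geq 1$, set $$H_{\sin}^k(\mathbb{R}^N) := \big\{ v \in L^1_{\rm loc}(\mathbb{R}^N) : \nabla v \in H^{k-1}(\mathbb{R}^N) \text{ and } \sin(v) \in L^2(\mathbb{R}^N) \big\},$$ where functions are real-valued and considered up to almost everywhere equality, and, for $v_1, v_2 \in H_{\sin}^1(\mathbb{R}^N)$, $$d_{\sin}^1(v_1, v_2) := \Big( \|\sin(v_1 - v_2)\|_{L^2}^2 + \|\nabla v_1 - \nabla v_2\|_{L^2}^2 \Big)^{1/2}.$$ Given $(\phi^0, \phi^1) \in H_{\sin}^1(\mathbb{R}^N) \times L^2(\mathbb{R}^N)$, there exists a unique solution $\phi \in \mathcal{C}^0(\mathbb{R}, \phi^0 + H^1(\mathbb{R}^N))$, with $\partial_t \phi \in \mathcal{C}^0(\mathbb{R}, L^2(\mathbb{R}^N))$, to the Sine-Gordon equation $$\partial_{tt} \phi - \Delta \phi + \frac{\sigma}{2} \sin(2 \phi) = 0$$ (in the sense of distributions on $\mathbb{R} \times \mathbb{R}^N$) with initial conditions $\phi(\cdot,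 0) = \phi^0$ and $\partial_t \phi(\cdot, 0) = \phi^1$. Moreover, this solution satisfies the following statements. (i) For any $T > 0$, there exists a positive number $A$, depending only on $\sigma$ and $T$ (and in particular not on $N$), such that, if $\tilde{\phi}$ is the solution with initial conditions $(\tilde{\phi}^0, \tilde{\phi}^1) \in H_{\sin}^1(\mathbb{R}^N) \times L^2(\mathbb{R}^N)$, then $$d_{\sin}^1 \big( \phi(\cdot, t), \tilde{\phi}(\cdot, t) \big) + \big\| \partial_t \phi(\cdot, t) - \partial_t \tilde{\phi}(\cdot, t) \big\|_{L^2} \leq A \Big( d_{\sin}^1 \big( \phi^0, \tilde{\phi}^0 \big) + \big\| \phi^1 - \tilde{\phi}^1 \big\|_{L^2} \Big)$$ for any $t \in [-T, T]$. (ii) When $\phi^0 \in H_{\sin}^2(\mathbb{R}^N)$ and $\phi^1 \in H^1(\mathbb{R}^N)$, the solution $\phi$ belongs to $\mathcal{C}^0(\mathbb{R}, \phi^0 + H^2(\mathbb{R}^N))$, with $\partial_t \phi \in \mathcal{C}^0(\mathbb{R}, H^1(\mathbb{R}^N))$ and $\partial_{tt} \phi \in \mathcal{C}^0(\mathbb{R},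 L^2(\mathbb{R}^N))$. (iii) The Sine-Gordon energy $$E_{\rm SG}(\phi) := \frac{1}{2} \int_{\mathbb{R}^N} \big( (\partial_t \phi)^2 + |\nabla \phi|^2 + \sigma \sin(\phi)^2 \big)$$ is finite and conserved along the flow: for every $t \in \mathbb{R}$ its value at time $t$ equals its value at time $0$. -/

import Mathlib

open MeasureTheory
open scoped ENNReal ContDiff

noncomputable section

namespace SineGordon

/-- The space `ℝ^N` with its Euclidean norm. -/
abbrev Space (N : ℕ) : Type := EuclideanSpace ℝ (Fin N)

/-- Real functions on `ℝ^N` up to almost everywhere equality. -/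
abbrev Fun (N : ℕ) : Type := Space N →ₘ[(volume : Measure (Space N))] ℝ

/-- The real Lebesgue space `L²(ℝ^N)`, an additive subgroup of `Fun N`. -/
abbrev L2 (N : ℕ) : Type := Lp ℝ 2 (volume : Measure (Space N))

/-- `g` is the weak derivative of `v` in the direction of the `i`-th coordinate, both being
locally integrable. -/
structure HasWeakPartial {N : ℕ} (i : Fin N) (v g : Fun N) : Prop where
  locallyIntegrable : LocallyIntegrable (v : Space N → ℝ) volume
  locallyIntegrable_deriv : LocallyIntegrable (g : Space N → ℝ) volume
  integral_eq : ∀ ψ : Space N → ℝ, ContDiff ℝ ∞ ψ → HasCompactSupport ψ →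
    ∫ x, v x * fderiv ℝ ψ x (EuclideanSpace.single i 1) = -∫ x, g x * ψ x

open scoped Classical in
/-- The weak derivative `∂ᵢ v` (it is unique when it exists; the value is `0` otherwise). -/
def weakPartial {N : ℕ} (i : Fin N) (v : Fun N) : Fun N :=
  if h : ∃ g : Fun N, HasWeakPartial i v g then h.choose else 0

/-- Membership of a function of `L²(ℝ^N)` in the Sobolev space `H^k(ℝ^N)`: all the weak derivatives
of order at most `k` are in `L²(ℝ^N)`. -/
def MemH {N : ℕ} : ℕ → L2 N → Prop
  | 0, _ => True
  | k + 1, v => ∀ i : Fin N, ∃ g : L2 N, HasWeakPartial i (v : Fun N) (g : Fun N) ∧ MemH k g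

/-- The set `H_sin^k(ℝ^N)`, for `k ≥ 1`: the functions `v` in `L¹_loc(ℝ^N)` with `∇v` in
`H^{k-1}(ℝ^N)` and `sin(v)` in `L²(ℝ^N)`. -/
structure MemHsin {N : ℕ} (k : ℕ) (v : Fun N) : Prop where
  locallyIntegrable : LocallyIntegrable (v : Space N → ℝ) volume
  grad_mem : ∀ i : Fin N, ∃ g : L2 N, HasWeakPartial i v (g : Fun N) ∧ MemH (k - 1) g
  sin_mem : MemLp (fun x => Real.sin (v x)) 2 volume

/-- The pseudometric distance `d_sin^1` on `H_sin^1(ℝ^N)`. -/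
def dsin {N : ℕ} (v₁ v₂ : Fun N) : ℝ :=
  Real.sqrt ((eLpNorm (fun x => Real.sin (v₁ x - v₂ x)) 2 volume).toReal ^ 2 +
    ∑ i : Fin N, (eLpNorm (fun x => weakPartial i v₁ x - weakPartial i v₂ x) 2 volume).toReal ^ 2)

/-- A curve `w : ℝ → L²(ℝ^N)` belongs to `C⁰(ℝ, H^k(ℝ^N))`: `w` and all its weak space derivatives
of order at most `k` are continuous curves in `L²(ℝ^N)`. -/
def ContinuousInH {N : ℕ} : ℕ → (ℝ → L2 N) → Prop
  | 0, w => Continuous w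
  | k + 1, w => Continuous w ∧ ∀ i : Fin N, ∃ g : ℝ → L2 N,
      (∀ t, HasWeakPartial i (w t : Fun N) (g t : Fun N)) ∧ ContinuousInH k g

/-- The curve `φ` belongs to `C⁰(ℝ, φ⁰ + H^k(ℝ^N))`. -/
def ContinuousInAffineH {N : ℕ} (k : ℕ) (φ₀ : Fun N) (φ : ℝ → Fun N) : Prop :=
  ∃ w : ℝ → L2 N, (∀ t, φ t = φ₀ + (w t : Fun N)) ∧ ContinuousInH k w

/-- `v = ∂ₜφ`, as a curve in `L²(ℝ^N)`: the increments of `φ` lie in `L²(ℝ^N)`, and are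
differentiable in this space, with derivative `v t` at time `t`. -/
def HasTimeDeriv {N : ℕ} (φ : ℝ → Fun N) (v : ℝ → L2 N) : Prop :=
  ∃ w : ℝ → L2 N, (∀ t, φ t = φ 0 + (w t : Fun N)) ∧ ∀ t, HasDerivAt w (v t) t

/-- The Sine-Gordon equation `∂ₜₜφ - Δφ + (σ/2) sin(2φ) = 0` in the sense of distributions on
`ℝ × ℝ^N`. -/
def SolvesSineGordon {N : ℕ} (σ : ℝ) (φ : ℝ → Fun N) : Prop :=
  ∀ Ψ : ℝ × Space N → ℝ, ContDiff ℝ ∞ Ψ → HasCompactSupport Ψ →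
    ∫ t, ∫ x, (φ t x * (iteratedDeriv 2 (fun s => Ψ (s, x)) t
        - Laplacian.laplacian (fun y => Ψ (t, y)) x)
      + σ / 2 * Real.sin (2 * φ t x) * Ψ (t, x)) = 0

/-- `φ` is a solution in `C⁰(ℝ, φ⁰ + H¹(ℝ^N))`, with `v = ∂ₜφ` in `C⁰(ℝ, L²(ℝ^N))`, to the
Sine-Gordon equation with initial conditions `(φ⁰, φ¹)`. -/
structure IsSolution {N : ℕ} (σ : ℝ) (φ₀ : Fun N) (φ₁ : L2 N)
    (φ : ℝ → Fun N) (v : ℝ → L2 N) : Prop where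
  continuous : ContinuousInAffineH 1 φ₀ φ
  hasTimeDeriv : HasTimeDeriv φ v
  continuous_deriv : Continuous v
  solves : SolvesSineGordon σ φ
  init : φ 0 = φ₀
  init_deriv : v 0 = φ₁

/-- The density `v² + |∇φ|² + σ sin(φ)²` of (twice) the Sine-Gordon energy, where `v = ∂ₜφ`. -/
def energyDensity {N : ℕ} (σ : ℝ) (φ : Fun N) (v : L2 N) (x : Space N) : ℝ :=
  v x ^ 2 + ∑ i : Fin N, weakPartial i φ x ^ 2 + σ * Real.sin (φ x) ^ 2

/-- The Sine-Gordon energy. -/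
def energy {N : ℕ} (σ : ℝ) (φ : Fun N) (v : L2 N) : ℝ :=
  1 / 2 * ∫ x, energyDensity σ φ v x

end SineGordon

end

open SineGordon

namespace SineGordon

open Filter Topology
open scoped InnerProductSpace

/-! ### Globally Lipschitz differential equations -/

section GlobalODE

variable {E : Type*} [NormedAddCommGroup E] [NormedSpace ℝ E]

/-! Write `φ = φ₀ + u` and `U = (∂ₜφ, ∇φ)`. The equation becomes `U' = A U + F u`, `u' = U none`,
where `A (v, p) = (div p, ∇v)` is skew-adjoint on a sum of copies of `L²` and `F` is Lipschitz on
`L²` because the sine is. The unbounded `A` never appears: with even mollifiers `ρ_n`, `M n` is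
convolution with `ρ_n`, `A n` is `A` with each `∂ᵢ` replaced by convolution with `∂ᵢρ_n`, and an
evolution equation is stated for every `M n U` (`SkewRegularization.Solves`).

Existence: the isometries `exp (t A n)` converge strongly to a group. Conjugating by this group
turns the system into a differential equation with a globally Lipschitz field, solved by a Picard
iteration in a weighted norm (`exists_solves_semilinear`). `IsSolution.exists_isPhaseSolution` and
`IsPhaseSolution.isSolution` pass between the distributional equation and the first order system.

Estimates: `⟪M n x, A n x⟫ = 0`, so the energy identity `(‖U‖²)' = 2 ⟪U, g⟫` holds for merely
continuous `U` (`Solves.hasDerivAt_norm_sq`). With `g` the sine force it gives conservation of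
energy. For two solutions it is added to the derivative of `‖sin (φ - φ')‖²`; since `|sin 2φ - sin
2φ'| ≤ 2 |sin (φ - φ')|`, Grönwall's lemma applies at the dimension-free rate `|σ| + 1`
(`norm_sub_sq_le`). This gives (i), and uniqueness follows.

Regularity: the system formally differentiated along `x_j` is linear with source `-σ cos (2φ) ∂_jφ`,
continuous in `L²`. Let `V` solve it. Convolving `U` with `∂_jρ_n` and `V` with `ρ_n` gives
solutions of the same problem, so `V = ∂_j U` (`exists_hasWeakPartial`). -/

theorem abs_sinh_le_cosh (x : ℝ) : |Real.sinh x| ≤ Real.cosh x := by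
  rw [Real.abs_sinh, ← Real.cosh_abs]
  exact (Real.sinh_lt_cosh _).le

/-- `cosh (l t)` is a smooth substitute for the weight `exp (l |t|)`: its primitive is `sinh (l t) /
l`, so integration gains the factor `1 / l` that makes the Picard map contract. -/
theorem norm_integral_le_of_norm_le_cosh {g : ℝ → E} {B l : ℝ} (hB : 0 ≤ B) (hl : 0 < l)
    (hg : ∀ s, ‖g s‖ ≤ B * Real.cosh (l * s)) (t : ℝ) :
    ‖∫ s in (0 : ℝ)..t, g s‖ ≤ B / l * Real.cosh (l * t) := by
  have hd : ∀ s ∈ Set.uIcc 0 t, HasDerivAt (fun s => B / l * Real.sinh (l * s))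
      (B * Real.cosh (l * s)) s := by
    intro s _
    have h1 : HasDerivAt (fun s : ℝ => l * s) l s := by
      simpa using (hasDerivAt_id s).const_mul l
    have h2 := (h1.sinh).const_mul (B / l)
    rwa [show B / l * (Real.cosh (l * s) * l) = B * Real.cosh (l * s) by field_simp] at h2
  have hc : Continuous fun s => B * Real.cosh (l * s) := by fun_prop
  have h1 := intervalIntegral.norm_integral_le_abs_of_norm_le (μ := volume) (a := 0) (b := t)
    (f := g) (g := fun s => B * Real.cosh (l * s)) (ae_of_all _ hg)
    (hc.intervalIntegrable _ _)
  rw [intervalIntegral.integral_eq_sub_of_hasDerivAt hd (hc.intervalIntegrable _ _)] at h1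
  refine h1.trans ?_
  simp only [mul_zero, Real.sinh_zero, sub_zero]
  rw [abs_mul, abs_of_nonneg (by positivity : 0 ≤ B / l)]
  exact mul_le_mul_of_nonneg_left (abs_sinh_le_cosh _) (by positivity)

/-- Global solvability of a differential equation whose vector field is globally Lipschitz in space
and bounded at the origin. -/
theorem exists_hasDerivAt_of_lipschitz [CompleteSpace E] {f : ℝ → E → E} {K C : ℝ}
    (hf : Continuous (Function.uncurry f)) (hK : 0 ≤ K)
    (hlip : ∀ t x y, ‖f t x - f t y‖ ≤ K * ‖x - y‖) (hC : ∀ t, ‖f t 0‖ ≤ C) (x₀ : E) :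
    ∃ u : ℝ → E, u 0 = x₀ ∧ ∀ t, HasDerivAt u (f t (u t)) t := by
  -- The unknown is `z = u / cosh (l t)`, a bounded function on the whole line. This rate gives `K /
  -- l ≤ 1 / 2`, and the `+ 1` keeps it positive when `K = 0`.
  set l : ℝ := 2 * K + 1 with hl
  have hl0 : 0 < l := by positivity
  have hC0 : 0 ≤ C := (norm_nonneg _).trans (hC 0)
  have hcpos : ∀ t, 0 < Real.cosh (l * t) := fun t => Real.cosh_pos _
  have hc1 : ∀ t, 1 ≤ Real.cosh (l * t) := fun t => Real.one_le_cosh _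
  have hcc : Continuous fun t => Real.cosh (l * t) := by fun_prop
  set G : BoundedContinuousFunction ℝ E → ℝ → E := fun z s => f s (Real.cosh (l * s) • z s) with hG
  have hGc : ∀ z, Continuous (G z) := fun z =>
    hf.comp (continuous_id.prodMk (hcc.smul z.continuous))
  have hGb : ∀ z s, ‖G z s‖ ≤ (C + K * ‖z‖) * Real.cosh (l * s) := by
    intro z s
    have h1 := hlip s (Real.cosh (l * s) • z s) 0
    have h2 : ‖Real.cosh (l * s) • z s‖ ≤ Real.cosh (l * s) * ‖z‖ := by
      rw [norm_smul, Real.norm_of_nonneg (hcpos s).le]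
      exact mul_le_mul_of_nonneg_left (z.norm_coe_le_norm s) (hcpos s).le
    have h3 : ‖G z s‖ ≤ ‖f s (Real.cosh (l * s) • z s) - f s 0‖ + ‖f s 0‖ := by
      simpa [hG] using norm_add_le (f s (Real.cosh (l * s) • z s) - f s 0) (f s 0)
    rw [sub_zero] at h1
    nlinarith [hC s, mul_le_mul_of_nonneg_left h2 hK, hc1 s, mul_le_mul_of_nonneg_left (hc1 s) hC0]
  have hcont : ∀ z, Continuous fun t =>
      (Real.cosh (l * t))⁻¹ • (x₀ + ∫ s in (0 : ℝ)..t, G z s) := by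
    intro z
    have h1 : Continuous fun t => ∫ s in (0 : ℝ)..t, G z s :=
      intervalIntegral.continuous_primitive (fun a b => (hGc z).intervalIntegrable _ _) 0
    exact (hcc.inv₀ fun t => (hcpos t).ne').smul (continuous_const.add h1)
  have hbound : ∀ z t, ‖(Real.cosh (l * t))⁻¹ • (x₀ + ∫ s in (0 : ℝ)..t, G z s)‖
      ≤ ‖x₀‖ + (C + K * ‖z‖) / l := by
    intro z t
    rw [norm_smul, norm_inv, Real.norm_of_nonneg (hcpos t).le, inv_mul_le_iff₀ (hcpos t)]
    have h1 := norm_integral_le_of_norm_le_cosh (by positivity) hl0 (hGb z) t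
    have h2 := norm_add_le x₀ (∫ s in (0 : ℝ)..t, G z s)
    nlinarith [mul_le_mul_of_nonneg_right (hc1 t) (norm_nonneg x₀)]
  set Φ : BoundedContinuousFunction ℝ E → BoundedContinuousFunction ℝ E := fun z =>
    BoundedContinuousFunction.ofNormedAddCommGroup _ (hcont z) _ (hbound z) with hΦ
  have hΦa : ∀ z t, Φ z t = (Real.cosh (l * t))⁻¹ • (x₀ + ∫ s in (0 : ℝ)..t, G z s) :=
    fun z t => rfl
  have hcontr : ContractingWith (1 / 2) Φ := by
    refine ⟨by rw [← NNReal.coe_lt_coe]; norm_num, LipschitzWith.of_dist_le_mul fun z w => ?_⟩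
    rw [BoundedContinuousFunction.dist_le (by positivity)]
    intro t
    rw [dist_eq_norm, hΦa, hΦa, ← smul_sub, add_sub_add_left_eq_sub,
      ← intervalIntegral.integral_sub ((hGc z).intervalIntegrable _ _)
        ((hGc w).intervalIntegrable _ _),
      norm_smul, norm_inv, Real.norm_of_nonneg (hcpos t).le, inv_mul_le_iff₀ (hcpos t)]
    have hd : ∀ s, ‖G z s - G w s‖ ≤ (K * dist z w) * Real.cosh (l * s) := by
      intro s
      refine (hlip s _ _).trans ?_
      rw [← smul_sub, norm_smul, Real.norm_of_nonneg (hcpos s).le, ← dist_eq_norm]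
      have := BoundedContinuousFunction.dist_coe_le_dist (f := z) (g := w) s
      have h2 := mul_le_mul_of_nonneg_left this (mul_nonneg hK (hcpos s).le)
      nlinarith
    have h1 := norm_integral_le_of_norm_le_cosh (by positivity) hl0 hd t
    refine h1.trans ?_
    rw [mul_comm]
    refine mul_le_mul_of_nonneg_left ?_ (hcpos t).le
    have : K / l ≤ 1 / 2 := by rw [div_le_div_iff₀ hl0 two_pos]; linarith
    have h3 := mul_le_mul_of_nonneg_right this (dist_nonneg (x := z) (y := w))
    push_cast
    calc K * dist z w / l = K / l * dist z w := by ring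
      _ ≤ _ := h3
  have : Nonempty (BoundedContinuousFunction ℝ E) := ⟨0⟩
  set z := hcontr.fixedPoint Φ with hz
  have hfix : Φ z = z := hcontr.fixedPoint_isFixedPt
  have hu : ∀ t, Real.cosh (l * t) • z t = x₀ + ∫ s in (0 : ℝ)..t, G z s := by
    intro t
    conv_lhs => rw [← hfix, hΦa]
    rw [smul_smul, mul_inv_cancel₀ (hcpos t).ne', one_smul]
  refine ⟨fun t => Real.cosh (l * t) • z t, by simpa using hu 0, fun t => ?_⟩
  simp_rw [hu]
  rw [← hu t]
  exact (intervalIntegral.integral_hasDerivAt_right ((hGc z).intervalIntegrable _ _)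
    ((hGc z).stronglyMeasurableAtFilter _ _) (hGc z).continuousAt).const_add x₀

end GlobalODE

/-! ### Skew-adjoint evolution equations in regularized form -/

/-- Bounded operators `M n` approximating the identity, together with the bounded operators
`A n = A ∘ M n` that regularize an unbounded skew-adjoint operator `A`. -/
structure SkewRegularization (X : Type*) [NormedAddCommGroup X] [InnerProductSpace ℝ X] where
  M : ℕ → X →L[ℝ] X
  A : ℕ → X →L[ℝ] X
  M_symm : ∀ n x y, ⟪M n x, y⟫_ℝ = ⟪x, M n y⟫_ℝ
  A_skew : ∀ n x y, ⟪A n x, y⟫_ℝ = -⟪x, A n y⟫_ℝ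
  A_M : ∀ m n x, A m (M n x) = A n (M m x)
  M_A : ∀ m n x, M m (A n x) = A n (M m x)
  A_A : ∀ m n x, A m (A n x) = A n (A m x)
  tendsto_M : ∀ x, Tendsto (fun n => M n x) atTop (𝓝 x)
  norm_M_le : ∀ n x, ‖M n x‖ ≤ ‖x‖

namespace SkewRegularization

variable {X : Type*} [NormedAddCommGroup X] [InnerProductSpace ℝ X] (R : SkewRegularization X)

/-- `U` solves `U' = A U + g`, in regularized form. -/
def Solves (U g : ℝ → X) : Prop :=
  ∀ n t, HasDerivAt (fun s => R.M n (U s)) (R.A n (U t) + R.M n (g t)) t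

variable {R}

theorem Solves.sub {U V g h : ℝ → X} (hU : R.Solves U g) (hV : R.Solves V h) :
    R.Solves (fun t => U t - V t) (fun t => g t - h t) := by
  intro n t
  have := (hU n t).sub (hV n t)
  refine (this.congr_deriv ?_).congr_of_eventuallyEq (Eventually.of_forall fun s => ?_)
  · simp only [map_sub]
    abel
  · simp

theorem Solves.map {U g : ℝ → X} (hU : R.Solves U g) (B : X →L[ℝ] X)
    (hM : ∀ n x, B (R.M n x) = R.M n (B x)) (hA : ∀ n x, B (R.A n x) = R.A n (B x)) :
    R.Solves (fun t => B (U t)) (fun t => B (g t)) := by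
  intro n t
  have := B.hasFDerivAt.comp_hasDerivAt t (hU n t)
  simpa only [Function.comp_def, map_add, hM, hA] using this

/-- By symmetry of `M n` and commutation the product is `⟪x, A n (M n x)⟫`, and by skewness it is
the opposite of this. Hence the generator drops out of the energy. -/
theorem inner_M_A_self (n : ℕ) (x : X) : ⟪R.M n x, R.A n x⟫_ℝ = 0 := by
  have h1 : ⟪R.M n x, R.A n x⟫_ℝ = ⟪x, R.A n (R.M n x)⟫_ℝ := by rw [R.M_symm, R.M_A]
  have h2 : ⟪x, R.A n (R.M n x)⟫_ℝ = -⟪R.M n x, R.A n x⟫_ℝ := by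
    rw [real_inner_comm (R.A n x), R.A_skew n x, neg_neg]
  linarith

/-- For `M n U` this is an exact computation, by `inner_M_A_self`. The integrated form survives `n →
∞` by dominated convergence, since the `M n` are contractions. -/
theorem Solves.norm_sq_eq {U g : ℝ → X} (hU : R.Solves U g) (hUc : Continuous U)
    (hg : Continuous g) (t : ℝ) :
    ‖U t‖ ^ 2 = ‖U 0‖ ^ 2 + ∫ s in (0 : ℝ)..t, 2 * ⟪U s, g s⟫_ℝ := by
  have hreg : ∀ n, ‖R.M n (U t)‖ ^ 2 = ‖R.M n (U 0)‖ ^ 2 +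
      ∫ s in (0 : ℝ)..t, 2 * ⟪R.M n (U s), R.M n (g s)⟫_ℝ := by
    intro n
    have hd : ∀ s ∈ Set.uIcc 0 t, HasDerivAt (fun s => ‖R.M n (U s)‖ ^ 2)
        (2 * ⟪R.M n (U s), R.M n (g s)⟫_ℝ) s := by
      intro s _
      have := (hU n s).norm_sq
      rwa [inner_add_right, inner_M_A_self, zero_add] at this
    rw [intervalIntegral.integral_eq_sub_of_hasDerivAt hd
      (Continuous.intervalIntegrable (by fun_prop) _ _)]
    ring
  have hlim := intervalIntegral.tendsto_integral_filter_of_dominated_convergence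
    (μ := volume) (a := 0) (b := t) (l := atTop)
    (F := fun n s => 2 * ⟪R.M n (U s), R.M n (g s)⟫_ℝ) (f := fun s => 2 * ⟪U s, g s⟫_ℝ)
    (fun s => 2 * (‖U s‖ * ‖g s‖))
    (Eventually.of_forall fun n => Continuous.aestronglyMeasurable (by fun_prop))
    (Eventually.of_forall fun n => ae_of_all _ fun s _ => by
      rw [norm_mul, Real.norm_of_nonneg zero_le_two]
      refine mul_le_mul_of_nonneg_left ((norm_inner_le_norm _ _).trans ?_) zero_le_two
      exact mul_le_mul (R.norm_M_le _ _) (R.norm_M_le _ _) (norm_nonneg _) (norm_nonneg _))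
    (Continuous.intervalIntegrable (by fun_prop) _ _)
    (ae_of_all _ fun s _ => ((R.tendsto_M _).inner (R.tendsto_M _)).const_mul 2)
  refine tendsto_nhds_unique ((R.tendsto_M (U t)).norm.pow 2) ?_
  simp_rw [hreg]
  exact ((R.tendsto_M (U 0)).norm.pow 2).add hlim

/-- The energy identity. -/
theorem Solves.hasDerivAt_norm_sq {U g : ℝ → X} (hU : R.Solves U g) (hUc : Continuous U)
    (hg : Continuous g) (t : ℝ) :
    HasDerivAt (fun s => ‖U s‖ ^ 2) (2 * ⟪U t, g t⟫_ℝ) t := by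
  rw [funext (hU.norm_sq_eq hUc hg)]
  have hc : Continuous fun s => 2 * ⟪U s, g s⟫_ℝ := by fun_prop
  exact (intervalIntegral.integral_hasDerivAt_right (hc.intervalIntegrable _ _)
    (hc.stronglyMeasurableAtFilter _ _) hc.continuousAt).const_add _

theorem Solves.unique {U V g : ℝ → X} (hU : R.Solves U g) (hV : R.Solves V g)
    (hUc : Continuous U) (hVc : Continuous V) (h0 : U 0 = V 0) : U = V := by
  funext t
  have h1 : R.Solves (fun t => U t - V t) (fun _ => 0) := by
    simpa using hU.sub hV
  have := h1.norm_sq_eq (hUc.sub hVc) continuous_const t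
  simpa [h0, sub_eq_zero] using this

/-! ### The isometric group and variation of constants -/

section Group

variable (R)

theorem inner_A_self (n : ℕ) (x : X) : ⟪R.A n x, x⟫_ℝ = 0 := by
  have := R.A_skew n x x
  rw [real_inner_comm x] at this
  linarith [real_inner_comm x (R.A n x)]

theorem commute_A (m n : ℕ) : Commute (R.A m) (R.A n) := by
  ext x
  exact R.A_A m n x

/-- On the range of `M k` the `A n` converge strongly: `A_M` exchanges the indices, leaving `n` only
in the approximate identity. -/
theorem tendsto_A_M (k : ℕ) (x : X) :
    Tendsto (fun n => R.A n (R.M k x)) atTop (𝓝 (R.A k x)) := by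
  simp_rw [fun n => R.A_M n k x]
  exact ((R.A k).continuous.tendsto x).comp (R.tendsto_M x)

variable [CompleteSpace X]

theorem hasDerivAt_exp_smul_apply (B : X →L[ℝ] X) (x : X) (t : ℝ) :
    HasDerivAt (fun s : ℝ => NormedSpace.exp (s • B) x) (B (NormedSpace.exp (t • B) x)) t := by
  have h := hasDerivAt_exp_smul_const' (𝕂 := ℝ) B t
  exact (ContinuousLinearMap.apply ℝ X x).hasFDerivAt.comp_hasDerivAt t h

theorem exp_add_of_commute {B C : X →L[ℝ] X} (h : Commute B C) :
    NormedSpace.exp (B + C) = NormedSpace.exp B * NormedSpace.exp C := by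
  let : NormedAlgebra ℚ (X →L[ℝ] X) := NormedAlgebra.restrictScalars ℚ ℝ _
  exact NormedSpace.exp_add_of_commute h

theorem norm_exp_smul_apply {B : X →L[ℝ] X} (hB : ∀ x, ⟪B x, x⟫_ℝ = 0) (t : ℝ) (x : X) :
    ‖NormedSpace.exp (t • B) x‖ = ‖x‖ := by
  have hd : ∀ s, HasDerivAt (fun s : ℝ => ‖NormedSpace.exp (s • B) x‖ ^ 2) 0 s := by
    intro s
    have := (hasDerivAt_exp_smul_apply B x s).norm_sq
    rwa [real_inner_comm, hB, mul_zero] at this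
  have h := is_const_of_deriv_eq_zero (fun s => (hd s).differentiableAt)
    (fun s => (hd s).deriv) t 0
  have h2 : ‖NormedSpace.exp (t • B) x‖ ^ 2 = ‖x‖ ^ 2 := by simpa using h
  exact (sq_eq_sq₀ (norm_nonneg _) (norm_nonneg _)).1 h2

/-- `B` commutes with its exponential, so the velocity of the orbit has constant norm `‖B x‖`. The
operator norm of `B`, which could blow up along `A n`, does not enter. -/
theorem norm_exp_smul_apply_sub_le {B : X →L[ℝ] X} (hB : ∀ x, ⟪B x, x⟫_ℝ = 0) (t : ℝ) (x : X) :
    ‖NormedSpace.exp (t • B) x - x‖ ≤ ‖B x‖ * |t| := by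
  have hcomm : ∀ s : ℝ, B (NormedSpace.exp (s • B) x) = NormedSpace.exp (s • B) (B x) := by
    intro s
    have h : Commute B (NormedSpace.exp (s • B)) :=
      ((Commute.refl B).smul_right s).exp_right
    exact congrArg (fun T : X →L[ℝ] X => T x) h.eq
  have := Convex.norm_image_sub_le_of_norm_hasDerivWithin_le (s := Set.univ) (C := ‖B x‖)
    (fun s _ => (hasDerivAt_exp_smul_apply B x s).hasDerivWithinAt)
    (fun s _ => by rw [hcomm, norm_exp_smul_apply hB]) convex_univ
    (Set.mem_univ 0) (Set.mem_univ t)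
  simpa using this

/-- The group generated by the bounded operator `A n`. -/
noncomputable def expA (n : ℕ) (t : ℝ) : X →L[ℝ] X := NormedSpace.exp (t • R.A n)

theorem norm_expA (n : ℕ) (t : ℝ) (x : X) : ‖R.expA n t x‖ = ‖x‖ :=
  norm_exp_smul_apply (R.inner_A_self n) t x

/-- As `A m` and `A n` commute, `exp (t A m) = exp (t A n) exp (t (A m - A n))`, and the difference
`A m - A n` is again skew. -/
theorem norm_expA_sub_le (m n : ℕ) (t : ℝ) (x : X) :
    ‖R.expA m t x - R.expA n t x‖ ≤ ‖R.A m x - R.A n x‖ * |t| := by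
  have h1 : R.expA m t = R.expA n t * NormedSpace.exp (t • (R.A m - R.A n)) := by
    have hc : Commute (t • R.A n) (t • (R.A m - R.A n)) :=
      (((R.commute_A n m).sub_right (Commute.refl _)).smul_left t).smul_right t
    rw [expA, expA, ← exp_add_of_commute hc]
    congr 1
    rw [← smul_add, add_sub_cancel]
  have h2 : R.expA m t x - R.expA n t x =
      R.expA n t (NormedSpace.exp (t • (R.A m - R.A n)) x - x) := by
    rw [h1, map_sub]; rfl
  rw [h2, norm_expA]
  refine norm_exp_smul_apply_sub_le (fun y => ?_) t x
  rw [sub_apply, inner_sub_left, inner_A_self, inner_A_self, sub_zero]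

/-- On `M k x` the sequence is Cauchy by `norm_expA_sub_le` and `tendsto_A_M`; since all the
exponentials are isometries, replacing `x` by `M k x` costs an error uniform in `n`. -/
theorem cauchySeq_expA (t : ℝ) (x : X) : CauchySeq fun n => R.expA n t x := by
  rw [Metric.cauchySeq_iff]
  intro ε hε
  obtain ⟨k, hk⟩ := ((Metric.tendsto_atTop.1 (R.tendsto_M x)) (ε / 4) (by positivity))
  have hk := hk k le_rfl
  have hc := (R.tendsto_A_M k x).cauchySeq
  rw [Metric.cauchySeq_iff] at hc
  -- After multiplication by `|t|` this contributes at most `ε / 2`; the two replacements of `x` by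
  -- `M k x` contribute less than `ε / 4` each.
  obtain ⟨n₀, hn₀⟩ := hc (ε / (2 * (|t| + 1))) (by positivity)
  refine ⟨n₀, fun m hm n hn => ?_⟩
  have h1 := hn₀ m hm n hn
  rw [dist_eq_norm] at h1 hk ⊢
  rw [norm_sub_rev] at hk
  have h2 := R.norm_expA_sub_le m n t (R.M k x)
  have h3 : R.expA m t x - R.expA n t x = R.expA m t (x - R.M k x) - R.expA n t (x - R.M k x) +
      (R.expA m t (R.M k x) - R.expA n t (R.M k x)) := by
    simp only [map_sub]; abel
  have h4 : ‖R.A m (R.M k x) - R.A n (R.M k x)‖ * |t| ≤ ε / 2 := by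
    have h5 := mul_le_mul_of_nonneg_right h1.le (abs_nonneg t)
    refine h5.trans ?_
    rw [div_mul_eq_mul_div, div_le_div_iff₀ (by positivity) two_pos]
    nlinarith [abs_nonneg t]
  rw [h3]
  refine (norm_add_le _ _).trans_lt ?_
  have h5 := norm_sub_le (R.expA m t (x - R.M k x)) (R.expA n t (x - R.M k x))
  rw [norm_expA, norm_expA] at h5
  linarith

/-- The isometric group generated by the skew-adjoint operator. -/
noncomputable def group (t : ℝ) (x : X) : X := limUnder atTop fun n => R.expA n t x

theorem tendsto_expA (t : ℝ) (x : X) :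
    Tendsto (fun n => R.expA n t x) atTop (𝓝 (R.group t x)) :=
  tendsto_nhds_limUnder (cauchySeq_tendsto_of_complete (R.cauchySeq_expA t x))

attribute [irreducible] group

theorem group_sub (t : ℝ) (x y : X) : R.group t (x - y) = R.group t x - R.group t y :=
  tendsto_nhds_unique (R.tendsto_expA t (x - y)) <| by
    simpa only [map_sub] using (R.tendsto_expA t x).sub (R.tendsto_expA t y)

theorem group_smul (t c : ℝ) (x : X) : R.group t (c • x) = c • R.group t x :=
  tendsto_nhds_unique (R.tendsto_expA t (c • x)) <| by
    simpa only [map_smul] using (R.tendsto_expA t x).const_smul c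

theorem norm_group (t : ℝ) (x : X) : ‖R.group t x‖ = ‖x‖ :=
  tendsto_nhds_unique (R.tendsto_expA t x).norm <| by
    simp only [norm_expA]; exact tendsto_const_nhds

theorem group_zero (x : X) : R.group 0 x = x :=
  tendsto_nhds_unique (R.tendsto_expA 0 x) <| by
    simp only [expA, zero_smul, NormedSpace.exp_zero]; exact tendsto_const_nhds

theorem tendsto_expA_of_tendsto {t : ℝ} {y : ℕ → X} {x : X} (hy : Tendsto y atTop (𝓝 x)) :
    Tendsto (fun n => R.expA n t (y n)) atTop (𝓝 (R.group t x)) := by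
  have h : Tendsto (fun n => R.expA n t (y n - x)) atTop (𝓝 0) := by
    rw [tendsto_zero_iff_norm_tendsto_zero]
    simp only [norm_expA]
    exact tendsto_iff_norm_sub_tendsto_zero.1 hy
  simpa [map_sub] using h.add (R.tendsto_expA t x)

/-- This is the only case of the group law that variation of constants needs. The argument varies
with `n` in the limit, which `tendsto_expA_of_tendsto` allows because the exponentials are
isometric. -/
theorem group_group_neg (t : ℝ) (x : X) : R.group t (R.group (-t) x) = x := by
  refine tendsto_nhds_unique (R.tendsto_expA_of_tendsto (R.tendsto_expA (-t) x)) ?_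
  have : ∀ n, R.expA n t (R.expA n (-t) x) = x := by
    intro n
    have hc : Commute (t • R.A n) ((-t) • R.A n) :=
      ((Commute.refl _).smul_left t).smul_right (-t)
    have h1 : R.expA n t * R.expA n (-t) = 1 := by
      rw [expA, expA, ← exp_add_of_commute hc, ← add_smul, add_neg_cancel, zero_smul,
        NormedSpace.exp_zero]
    exact congrArg (fun T : X →L[ℝ] X => T x) h1
  simp only [this]
  exact tendsto_const_nhds

theorem norm_group_M_sub_le (k : ℕ) (x : X) (s t : ℝ) :
    ‖R.group t (R.M k x) - R.group s (R.M k x)‖ ≤ ‖R.A k x‖ * |t - s| := by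
  refine le_of_tendsto_of_tendsto
    (((R.tendsto_expA t (R.M k x)).sub (R.tendsto_expA s (R.M k x))).norm)
    ((R.tendsto_A_M k x).norm.mul_const |t - s|) (Eventually.of_forall fun n => ?_)
  have h1 : R.expA n t = R.expA n s * R.expA n (t - s) := by
    have hc : Commute (s • R.A n) ((t - s) • R.A n) :=
      ((Commute.refl _).smul_left s).smul_right (t - s)
    rw [expA, expA, expA, ← exp_add_of_commute hc, ← add_smul, add_sub_cancel]
  have h2 : R.expA n t (R.M k x) - R.expA n s (R.M k x) =
      R.expA n s (R.expA n (t - s) (R.M k x) - R.M k x) := by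
    rw [h1, map_sub]; rfl
  simp only [h2, norm_expA]
  exact norm_exp_smul_apply_sub_le (R.inner_A_self n) (t - s) (R.M k x)

/-- The orbit of `M k x` is Lipschitz with constant `‖A k x‖`, and the orbit of `x` is a uniform
limit of these by isometry. -/
theorem continuous_group_apply (x : X) : Continuous fun t => R.group t x := by
  have hk : ∀ k, Continuous fun t => R.group t (R.M k x) := by
    intro k
    refine (LipschitzWith.of_dist_le_mul (K := ⟨‖R.A k x‖, norm_nonneg _⟩) fun t s => ?_).continuous
    rw [dist_eq_norm, Real.dist_eq]
    exact R.norm_group_M_sub_le k x s t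
  refine continuous_of_uniform_approx_of_continuous fun u hu => ?_
  obtain ⟨ε, hε, hεu⟩ := Metric.mem_uniformity_dist.1 hu
  obtain ⟨k, hk'⟩ := (Metric.tendsto_atTop.1 (R.tendsto_M x)) ε hε
  refine ⟨_, hk k, fun t => hεu ?_⟩
  rw [dist_eq_norm, ← group_sub, norm_group, ← dist_eq_norm, dist_comm]
  exact hk' k le_rfl

theorem continuous_group : Continuous fun p : ℝ × X => R.group p.1 p.2 := by
  refine continuous_iff_continuousAt.2 fun ⟨t, x⟩ => ?_
  have h1 : Tendsto (fun p : ℝ × X => R.group p.1 (p.2 - x)) (𝓝 (t, x)) (𝓝 0) := by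
    rw [tendsto_zero_iff_norm_tendsto_zero]
    simp only [norm_group]
    have : Continuous fun p : ℝ × X => ‖p.2 - x‖ := by fun_prop
    simpa using this.tendsto (t, x)
  have h2 : Tendsto (fun p : ℝ × X => R.group p.1 x) (𝓝 (t, x)) (𝓝 (R.group t x)) :=
    ((R.continuous_group_apply x).comp continuous_fst).tendsto (t, x)
  simpa [group_sub, ContinuousAt] using h1.add h2

theorem continuous_group_comp {S : Type*} [TopologicalSpace S] {a : S → ℝ} {b : S → X}
    (ha : Continuous a) (hb : Continuous b) : Continuous fun s => R.group (a s) (b s) :=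
  R.continuous_group.comp (ha.prodMk hb)

/-- Along `exp (s A n)` the derivative is `M k A n = A n M k = A k M n`, which puts the bounded
operator `A k`, independent of `n`, in front. The integrated identity then passes to the limit by
dominated convergence. -/
theorem hasDerivAt_M_group (k : ℕ) (x : X) (t : ℝ) :
    HasDerivAt (fun s => R.M k (R.group s x)) (R.A k (R.group t x)) t := by
  have hG := R.continuous_group_apply x
  have hc : Continuous fun s => R.A k (R.group s x) := by fun_prop
  have hcn : ∀ n, Continuous fun s => R.expA n s x := fun n =>
    continuous_iff_continuousAt.2 fun s => (hasDerivAt_exp_smul_apply (R.A n) x s).continuousAt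
  have hInt : ∀ t, R.M k (R.group t x) = R.M k x + ∫ s in (0 : ℝ)..t, R.A k (R.group s x) := by
    intro t
    have hn : ∀ n, R.M k (R.expA n t x) =
        R.M k x + ∫ s in (0 : ℝ)..t, R.A k (R.M n (R.expA n s x)) := by
      intro n
      have hd : ∀ s ∈ Set.uIcc 0 t, HasDerivAt (fun s => R.M k (R.expA n s x))
          (R.A k (R.M n (R.expA n s x))) s := by
        intro s _
        have := (R.M k).hasFDerivAt.comp_hasDerivAt s (hasDerivAt_exp_smul_apply (R.A n) x s)
        rw [R.M_A, R.A_M] at this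
        exact this
      rw [intervalIntegral.integral_eq_sub_of_hasDerivAt hd
        (Continuous.intervalIntegrable (by have := hcn n; fun_prop) _ _)]
      simp [expA]
    have hlim := intervalIntegral.tendsto_integral_filter_of_dominated_convergence
      (μ := volume) (a := 0) (b := t) (l := atTop)
      (F := fun n s => R.A k (R.M n (R.expA n s x))) (f := fun s => R.A k (R.group s x))
      (fun s => ‖R.A k‖ * ‖x‖)
      (Eventually.of_forall fun n =>
        Continuous.aestronglyMeasurable (by have := hcn n; fun_prop))
      (Eventually.of_forall fun n => ae_of_all _ fun s _ => by
        refine (R.A k).le_opNorm_of_le ((R.norm_M_le _ _).trans ?_)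
        rw [norm_expA])
      (Continuous.intervalIntegrable continuous_const _ _)
      (ae_of_all _ fun s _ => by
        refine ((R.A k).continuous.tendsto _).comp ?_
        have h0 : Tendsto (fun n => R.M n (R.expA n s x - R.group s x)) atTop (𝓝 0) :=
          squeeze_zero_norm (fun n => R.norm_M_le n _)
            (tendsto_iff_norm_sub_tendsto_zero.1 (R.tendsto_expA s x))
        simpa [map_sub] using h0.add (R.tendsto_M (R.group s x)))
    refine tendsto_nhds_unique (((R.M k).continuous.tendsto _).comp (R.tendsto_expA t x)) ?_
    simp only [Function.comp_def, hn]
    exact hlim.const_add _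
  rw [funext hInt]
  exact (intervalIntegral.integral_hasDerivAt_right (hc.intervalIntegrable _ _)
    (hc.stronglyMeasurableAtFilter _ _) hc.continuousAt).const_add _

/-- Variation of constants. -/
theorem solves_group {W g : ℝ → X} (hW : ∀ t, HasDerivAt W (R.group (-t) (g t)) t) :
    R.Solves (fun t => R.group t (W t)) g := by
  intro n t
  -- Product rule without differentiating the group on a general vector: `group s (W s)` splits as
  -- `group s (W t)`, covered by `hasDerivAt_M_group`, plus this term, where joint continuity of the
  -- group is applied to the slopes of `W`.
  have h1 : HasDerivAt (fun s => R.M n (R.group s (W s - W t))) (R.M n (g t)) t := by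
    rw [hasDerivAt_iff_tendsto_slope]
    have h2 : Tendsto (fun s => R.M n (R.group s (slope W t s))) (𝓝[≠] t)
        (𝓝 (R.M n (R.group t (R.group (-t) (g t))))) := by
      refine ((R.M n).continuous.tendsto _).comp ?_
      have h4 : Tendsto (fun s => (s, slope W t s)) (𝓝[≠] t) (𝓝 (t, R.group (-t) (g t))) :=
        (tendsto_id.mono_left nhdsWithin_le_nhds).prodMk_nhds
          (hasDerivAt_iff_tendsto_slope.1 (hW t))
      exact (R.continuous_group.tendsto _).comp h4
    rw [group_group_neg] at h2
    refine h2.congr fun s => ?_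
    have h0 : R.group t (W t - W t) = 0 := by rw [group_sub, sub_self]
    rw [slope_def_module, slope_def_module, h0, map_zero, sub_zero, group_smul, map_smul]
  have h3 := (R.hasDerivAt_M_group n (W t) t).add h1
  refine h3.congr_of_eventuallyEq (Eventually.of_forall fun s => ?_)
  simp only [Pi.add_apply, group_sub, map_sub]
  abel

theorem exists_solves {g : ℝ → X} (hg : Continuous g) (x : X) :
    ∃ U : ℝ → X, Continuous U ∧ U 0 = x ∧ R.Solves U g := by
  have hc : Continuous fun s => R.group (-s) (g s) :=
    R.continuous_group_comp continuous_neg hg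
  have hW : ∀ t, HasDerivAt (fun t => x + ∫ s in (0 : ℝ)..t, R.group (-s) (g s))
      (R.group (-t) (g t)) t := fun t =>
    (intervalIntegral.integral_hasDerivAt_right (hc.intervalIntegrable _ _)
      (hc.stronglyMeasurableAtFilter _ _) hc.continuousAt).const_add _
  refine ⟨_, ?_, ?_, R.solves_group hW⟩
  · exact R.continuous_group_comp continuous_id
      (continuous_iff_continuousAt.2 fun t => (hW t).continuousAt)
  · simp [group_zero]

/-- Solvability of the semilinear system `U' = A U + F u`, `u' = P U`. -/
theorem exists_solves_semilinear {Y : Type*} [NormedAddCommGroup Y] [NormedSpace ℝ Y]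
    [CompleteSpace Y] (P : X →L[ℝ] Y) {F : Y → X} {K : ℝ} (hK : 0 ≤ K)
    (hF : ∀ u w, ‖F u - F w‖ ≤ K * ‖u - w‖) (x : X) :
    ∃ (U : ℝ → X) (u : ℝ → Y), Continuous U ∧ U 0 = x ∧ u 0 = 0 ∧
      (∀ t, HasDerivAt u (P (U t)) t) ∧ R.Solves U (fun t => F (u t)) := by
  have hFc : Continuous F :=
    (LipschitzWith.of_dist_le_mul (K := ⟨K, hK⟩) fun u w => by
      rw [dist_eq_norm, dist_eq_norm]; exact hF u w).continuous
  -- The unknown is the pair `(group (-t) (U t), u t)`. In these variables the unbounded generator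
  -- is gone and the field is Lipschitz because the group is isometric.
  obtain ⟨z, hz0, hz⟩ := exists_hasDerivAt_of_lipschitz (E := X × Y)
    (f := fun t z => (R.group (-t) (F z.2), P (R.group t z.1))) (K := max K ‖P‖) (C := ‖F 0‖)
    (by
      refine Continuous.prodMk ?_ (P.continuous.comp ?_)
      · exact R.continuous_group_comp (by fun_prop) (by fun_prop)
      · exact R.continuous_group_comp (by fun_prop) (by fun_prop))
    (le_max_of_le_left hK)
    (fun t a b => by
      rw [Prod.mk_sub_mk, ← group_sub, ← map_sub, ← group_sub, Prod.norm_mk, norm_group]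
      refine max_le ?_ ?_
      · refine (hF _ _).trans (mul_le_mul (le_max_left _ _) (norm_snd_le (a - b)) (norm_nonneg _)
          (le_max_of_le_left hK))
      · refine (P.le_opNorm _).trans ?_
        rw [norm_group]
        exact mul_le_mul (le_max_right _ _) (norm_fst_le (a - b)) (norm_nonneg _)
          (le_max_of_le_left hK))
    (fun t => by
      have h0 : R.group t (0 : X) = 0 := by
        rw [← norm_eq_zero, norm_group, norm_zero]
      simp [norm_group, h0]) (x, 0)
  have h1 : ∀ t, HasDerivAt (fun t => (z t).1) (R.group (-t) (F (z t).2)) t := fun t =>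
    (hasFDerivAt_fst (𝕜 := ℝ) (p := z t)).comp_hasDerivAt t (hz t)
  have h2 : ∀ t, HasDerivAt (fun t => (z t).2) (P (R.group t (z t).1)) t := fun t =>
    (hasFDerivAt_snd (𝕜 := ℝ) (p := z t)).comp_hasDerivAt t (hz t)
  have hzc : Continuous z := continuous_iff_continuousAt.2 fun t => (hz t).continuousAt
  refine ⟨fun t => R.group t (z t).1, fun t => (z t).2, ?_, ?_, ?_, h2, R.solves_group h1⟩
  · exact R.continuous_group_comp continuous_id (by fun_prop)
  · simp [hz0, group_zero]
  · simp [hz0]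

end Group

end SkewRegularization

/-! ### Test functions, translations and mollification in `L²` -/

/-- Smooth compactly supported functions on `ℝ^N`. -/
structure TestFun (N : ℕ) where
  toFun : Space N → ℝ
  contDiff : ContDiff ℝ ∞ toFun
  hasCompactSupport : HasCompactSupport toFun

namespace TestFun

variable {N : ℕ}

instance : CoeFun (TestFun N) fun _ => Space N → ℝ := ⟨toFun⟩

theorem continuous (ψ : TestFun N) : Continuous ψ := ψ.contDiff.continuous

theorem memLp (ψ : TestFun N) : MemLp ψ 2 volume :=
  ψ.continuous.memLp_of_hasCompactSupport ψ.hasCompactSupport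

/-- The partial derivative of a test function. -/
noncomputable def pderiv (i : Fin N) (ψ : TestFun N) : TestFun N where
  toFun x := fderiv ℝ ψ x (EuclideanSpace.single i 1)
  contDiff := (ψ.contDiff.fderiv_right (m := ∞) (by norm_num)).clm_apply contDiff_const
  hasCompactSupport := ψ.hasCompactSupport.fderiv_apply ℝ _

/-- The reflection of a test function. -/
noncomputable def reflect (ψ : TestFun N) : TestFun N where
  toFun x := ψ (-x)
  contDiff := ψ.contDiff.comp contDiff_neg
  hasCompactSupport := ψ.hasCompactSupport.comp_homeomorph (Homeomorph.neg _)

/-- The translate `x ↦ ψ (x - y)` of a test function. -/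
noncomputable def translate (y : Space N) (ψ : TestFun N) : TestFun N where
  toFun x := ψ (x - y)
  contDiff := ψ.contDiff.comp (contDiff_id.sub contDiff_const)
  hasCompactSupport := ψ.hasCompactSupport.comp_homeomorph (Homeomorph.subRight y)

/-- The class of a test function in `L²`. -/
noncomputable def toL2 (ψ : TestFun N) : L2 N := ψ.memLp.toLp ψ

theorem coe_toL2 (ψ : TestFun N) : ψ.toL2 =ᵐ[volume] ψ := MemLp.coeFn_toLp _

theorem pderiv_reflect (i : Fin N) (ψ : TestFun N) (x : Space N) :
    ψ.reflect.pderiv i x = -ψ.pderiv i (-x) := by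
  have h : HasFDerivAt (fun y => ψ (-y)) ((fderiv ℝ ψ (-x)).comp
      (-ContinuousLinearMap.id ℝ (Space N))) x :=
    ((ψ.contDiff.differentiable (by simp)) (-x)).hasFDerivAt.comp x (hasFDerivAt_id x).neg
  simp [pderiv, reflect, h.fderiv]

theorem pderiv_translate (i : Fin N) (y : Space N) (ψ : TestFun N) (x : Space N) :
    (ψ.translate y).pderiv i x = ψ.pderiv i (x - y) := by
  simp [pderiv, translate, fderiv_comp_sub]

end TestFun

variable {N : ℕ}

/-- The integral is a convolution with the reflected test function, evaluated at `s • e`. Vector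
values allow its use both for locally integrable scalars and for `y ↦ translateL2 y f`. -/
theorem hasDerivAt_integral_translate {E : Type*} [NormedAddCommGroup E] [NormedSpace ℝ E]
    {f : Space N → E} (hf : LocallyIntegrable f volume) (i : Fin N)
    (ψ : TestFun N) (s₀ : ℝ) :
    HasDerivAt (fun s : ℝ => ∫ x, ψ (x - s • EuclideanSpace.single i 1) • f x)
      (-∫ x, ψ.pderiv i (x - s₀ • EuclideanSpace.single i 1) • f x) s₀ := by
  set e : Space N := EuclideanSpace.single i 1 with he
  set L : E →L[ℝ] ℝ →L[ℝ] E := (ContinuousLinearMap.lsmul ℝ ℝ).flip with hL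
  have h1 := ψ.reflect.hasCompactSupport.hasFDerivAt_convolution_right L hf
    (ψ.reflect.contDiff.of_le (by simp)) (s₀ • e)
  have h2 : HasDerivAt (fun s : ℝ => s • e) e s₀ := by
    simpa using (hasDerivAt_id s₀).smul_const e
  have h3 := h1.comp_hasDerivAt s₀ h2
  rw [convolution_precompR_apply L hf (ψ.reflect.hasCompactSupport.fderiv ℝ)
    (ψ.reflect.contDiff.continuous_fderiv (by simp))] at h3
  refine (h3.congr_deriv ?_).congr_of_eventuallyEq (Eventually.of_forall fun s => ?_)
  · rw [convolution_def, ← integral_neg]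
    refine integral_congr_ae (ae_of_all _ fun x => ?_)
    have := ψ.pderiv_reflect i (s₀ • e - x)
    simp only [TestFun.pderiv, ← he] at this
    simp only [hL, ContinuousLinearMap.flip_apply, ContinuousLinearMap.lsmul_apply, this, neg_smul,
      neg_sub]
    simp [TestFun.pderiv, ← he]
  · simp only [Function.comp_def, convolution_def]
    refine integral_congr_ae (ae_of_all _ fun x => ?_)
    simp [hL, TestFun.reflect]

/-- Translation of `L²` functions: `translateL2 y f x = f (x - y)`. -/
noncomputable def translateL2 (y : Space N) : L2 N →ₗᵢ[ℝ] L2 N :=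
  Lp.compMeasurePreservingₗᵢ ℝ (fun x => x - y) (measurePreserving_sub_right volume y)

theorem coe_translateL2 (y : Space N) (f : L2 N) :
    translateL2 y f =ᵐ[volume] fun x => f (x - y) :=
  Lp.coeFn_compMeasurePreserving f (measurePreserving_sub_right volume y)

theorem ae_eq_comp_sub {α : Type*} {f g : Space N → α} (h : f =ᵐ[volume] g) (y : Space N) :
    (fun x => f (x - y)) =ᵐ[volume] fun x => g (x - y) :=
  (measurePreserving_sub_right volume y).quasiMeasurePreserving.ae_eq_comp h

theorem translateL2_add (y z : Space N) (f : L2 N) :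
    translateL2 (y + z) f = translateL2 y (translateL2 z f) := by
  refine Lp.ext ?_
  filter_upwards [coe_translateL2 (y + z) f, coe_translateL2 y (translateL2 z f),
    ae_eq_comp_sub (coe_translateL2 z f) y] with x h1 h2 h3
  rw [h1, h2, h3, sub_sub]

theorem translateL2_zero (f : L2 N) : translateL2 0 f = f := by
  refine Lp.ext ?_
  filter_upwards [coe_translateL2 0 f] with x h1
  rw [h1, sub_zero]

theorem translateL2_comm (y z : Space N) (f : L2 N) :
    translateL2 y (translateL2 z f) = translateL2 z (translateL2 y f) := by
  rw [← translateL2_add, add_comm, translateL2_add]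

theorem inner_translateL2 (y : Space N) (f g : L2 N) :
    ⟪translateL2 y f, g⟫_ℝ = ⟪f, translateL2 (-y) g⟫_ℝ := by
  rw [← (translateL2 y).inner_map_map f, ← translateL2_add, add_neg_cancel, translateL2_zero]

theorem translateL2_toL2 (y : Space N) (ψ : TestFun N) :
    translateL2 y ψ.toL2 = (ψ.translate y).toL2 := by
  refine Lp.ext ?_
  filter_upwards [coe_translateL2 y ψ.toL2, ae_eq_comp_sub ψ.coe_toL2 y,
    (ψ.translate y).coe_toL2] with x h1 h2 h3
  rw [h1, h2, h3]; rfl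

theorem continuous_translateL2 (f : L2 N) : Continuous fun y => translateL2 y f := by
  have hg : Continuous fun p : Space N × Space N => p.2 - p.1 := by fun_prop
  exact Continuous.compMeasurePreservingLp (f := fun _ : Space N => f)
    (g := (ContinuousMap.mk _ hg).curry) continuous_const (ContinuousMap.continuous _)
    (fun y => measurePreserving_sub_right volume y) (by simp)

theorem integrable_smul_translateL2 (ρ : TestFun N) (f : L2 N) :
    Integrable (fun y => ρ y • translateL2 y f) volume :=
  (ρ.continuous.smul (continuous_translateL2 f)).integrable_of_hasCompactSupport
    ρ.hasCompactSupport.smul_right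

/-- Convolution of an `L²` function with a test function. -/
noncomputable def smear (ρ : TestFun N) : L2 N →L[ℝ] L2 N :=
  LinearMap.mkContinuous
    { toFun := fun f => ∫ y, ρ y • translateL2 y f
      map_add' := fun f g => by
        simp only [map_add, smul_add]
        exact integral_add (integrable_smul_translateL2 ρ f) (integrable_smul_translateL2 ρ g)
      map_smul' := fun c f => by
        simp only [map_smul, RingHom.id_apply]
        rw [← integral_smul]
        simp only [smul_comm c] }
    (∫ y, ‖ρ y‖) fun f => by
      refine (norm_integral_le_integral_norm _).trans (le_of_eq ?_)
      simp only [norm_smul, LinearIsometry.norm_map, integral_mul_const]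

theorem smear_apply (ρ : TestFun N) (f : L2 N) : smear ρ f = ∫ y, ρ y • translateL2 y f := rfl

theorem norm_smear_le (ρ : TestFun N) (f : L2 N) : ‖smear ρ f‖ ≤ (∫ y, ‖ρ y‖) * ‖f‖ := by
  refine (norm_integral_le_integral_norm _).trans (le_of_eq ?_)
  simp only [norm_smul, LinearIsometry.norm_map, integral_mul_const]

theorem map_smear {E : Type*} [NormedAddCommGroup E] [NormedSpace ℝ E] [CompleteSpace E]
    (B : L2 N →L[ℝ] E) (ρ : TestFun N) (f : L2 N) :
    B (smear ρ f) = ∫ y, ρ y • B (translateL2 y f) := by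
  rw [smear_apply, ← B.integral_comp_comm (integrable_smul_translateL2 ρ f)]
  simp only [map_smul]

theorem translateL2_smear (z : Space N) (ρ : TestFun N) (f : L2 N) :
    translateL2 z (smear ρ f) = smear ρ (translateL2 z f) := by
  have := map_smear (translateL2 z).toContinuousLinearMap ρ f
  simp only [LinearIsometry.coe_toContinuousLinearMap] at this
  rw [this, smear_apply]
  simp only [translateL2_comm z]

theorem smear_comm (ρ η : TestFun N) (f : L2 N) :
    smear ρ (smear η f) = smear η (smear ρ f) := by
  rw [map_smear, smear_apply η]
  simp only [translateL2_smear]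

theorem inner_smear_left (ρ : TestFun N) (f g : L2 N) :
    ⟪smear ρ f, g⟫_ℝ = ∫ y, ρ y * ⟪translateL2 y f, g⟫_ℝ := by
  have := map_smear (innerSL ℝ g) ρ f
  simp only [innerSL_apply_apply, smul_eq_mul] at this
  rw [real_inner_comm, this]
  simp only [real_inner_comm g]

theorem inner_smear_right (ρ : TestFun N) (f g : L2 N) :
    ⟪f, smear ρ g⟫_ℝ = ∫ y, ρ y * ⟪f, translateL2 y g⟫_ℝ := by
  have := map_smear (innerSL ℝ f) ρ g
  simpa only [innerSL_apply_apply, smul_eq_mul] using this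

theorem inner_smear_eq_inner_smear_reflect (ρ : TestFun N) (f g : L2 N) :
    ⟪smear ρ f, g⟫_ℝ = ⟪f, smear ρ.reflect g⟫_ℝ := by
  rw [inner_smear_left, inner_smear_right, ← integral_neg_eq_self]
  simp only [TestFun.reflect, inner_translateL2, neg_neg]

/-- Translating a convolution amounts to translating its kernel, so the derivative falls on `ρ`. -/
theorem hasDerivAt_translateL2_smear (i : Fin N) (ρ : TestFun N) (f : L2 N) :
    HasDerivAt (fun s : ℝ => translateL2 (s • EuclideanSpace.single i 1) (smear ρ f))
      (-smear (ρ.pderiv i) f) 0 := by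
  have h := hasDerivAt_integral_translate
    ((continuous_translateL2 f).locallyIntegrable (μ := volume)) i ρ 0
  refine (h.congr_deriv ?_).congr_of_eventuallyEq (Eventually.of_forall fun s => ?_)
  · simp [smear_apply]
  · simp only [translateL2_smear]
    rw [smear_apply, ← integral_sub_right_eq_self _ (s • EuclideanSpace.single i (1 : ℝ))]
    simp only [← translateL2_add, sub_add_cancel]

/-- Both sides are `∂ᵢ(ρ * η * f)`: up to sign they are derivatives of the same curve of translates,
because convolutions commute. -/
theorem smear_pderiv_smear (i : Fin N) (ρ η : TestFun N) (f : L2 N) :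
    smear (ρ.pderiv i) (smear η f) = smear (η.pderiv i) (smear ρ f) := by
  have h1 := hasDerivAt_translateL2_smear i ρ (smear η f)
  have h2 := hasDerivAt_translateL2_smear i η (smear ρ f)
  rw [smear_comm] at h1
  exact neg_injective (h1.unique h2)

theorem smear_pderiv_smear_pderiv (i j : Fin N) (ρ η : TestFun N) (f : L2 N) :
    smear (ρ.pderiv i) (smear (η.pderiv j) f) = smear (η.pderiv i) (smear (ρ.pderiv j) f) := by
  have h1 := hasDerivAt_translateL2_smear i ρ (smear (η.pderiv j) f)
  have h2 := hasDerivAt_translateL2_smear i η (smear (ρ.pderiv j) f)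
  rw [smear_comm, smear_pderiv_smear, smear_comm] at h1
  exact neg_injective (h1.unique h2)

theorem L2.inner_def (f g : L2 N) : ⟪f, g⟫_ℝ = ∫ x, g x * f x := by
  rw [MeasureTheory.L2.inner_def]
  simp

theorem L2.inner_toL2 (f : L2 N) (ψ : TestFun N) : ⟪f, ψ.toL2⟫_ℝ = ∫ x, f x * ψ x := by
  rw [real_inner_comm, L2.inner_def]
  refine integral_congr_ae ?_
  filter_upwards [ψ.coe_toL2] with x hx
  rw [hx]

theorem L2.locallyIntegrable (f : L2 N) : LocallyIntegrable f volume :=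
  (Lp.memLp f).locallyIntegrable (by norm_num)

theorem L2.ext_inner {f g : L2 N} (h : ∀ ψ : TestFun N, ⟪f, ψ.toL2⟫_ℝ = ⟪g, ψ.toL2⟫_ℝ) :
    f = g := by
  rw [← sub_eq_zero]
  refine Lp.ext ?_
  have h0 : ∀ᵐ x ∂(volume : Measure (Space N)), (f - g) x = 0 :=
    ae_eq_zero_of_integral_contDiff_smul_eq_zero (L2.locallyIntegrable (f - g))
      fun ψ hψ hc => ?_
  · filter_upwards [h0, Lp.coeFn_zero ℝ 2 (volume : Measure (Space N))] with x h1 h2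
    rw [h1, h2]; rfl
  have h1 := h ⟨ψ, hψ, hc⟩
  rw [← sub_eq_zero, ← inner_sub_left, L2.inner_toL2] at h1
  simpa only [smul_eq_mul, mul_comm (ψ _)] using h1

theorem hasDerivAt_inner_translateL2 (i : Fin N) (f : L2 N) (ψ : TestFun N) :
    HasDerivAt (fun s : ℝ => ⟪f, translateL2 (s • EuclideanSpace.single i 1) ψ.toL2⟫_ℝ)
      (-⟪f, (ψ.pderiv i).toL2⟫_ℝ) 0 := by
  have h := hasDerivAt_integral_translate (L2.locallyIntegrable f) i ψ 0
  simp only [translateL2_toL2, L2.inner_toL2]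
  simpa [TestFun.translate, mul_comm] using h

/-- Integration by parts, by differentiating one pairing in two ways: with the translation acting on
`ψ`, and with the opposite translation acting on the convolution. -/
theorem inner_smear_pderiv (i : Fin N) (ρ : TestFun N) (f : L2 N) (ψ : TestFun N) :
    ⟪smear ρ f, (ψ.pderiv i).toL2⟫_ℝ = -⟪smear (ρ.pderiv i) f, ψ.toL2⟫_ℝ := by
  have h1 : HasDerivAt (fun s : ℝ => ⟪smear ρ f,
      translateL2 ((-s) • EuclideanSpace.single i 1) ψ.toL2⟫_ℝ)
      (⟪smear ρ f, (ψ.pderiv i).toL2⟫_ℝ) 0 := by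
    have := (hasDerivAt_inner_translateL2 i (smear ρ f) ψ).scomp_of_eq (0 : ℝ)
      (hasDerivAt_neg (0 : ℝ)) (by simp)
    simpa [Function.comp_def] using this
  have h2 := (hasDerivAt_translateL2_smear i ρ f).inner ℝ (hasDerivAt_const (0 : ℝ) ψ.toL2)
  simp only [inner_translateL2, inner_zero_right, zero_add, inner_neg_left, neg_smul] at h1 h2
  exact h1.unique h2

/-- A sequence of radial bump functions concentrating at the origin. -/
noncomputable def bump (N n : ℕ) : ContDiffBump (0 : Space N) where
  rIn := 1 / (2 * (n + 1))
  rOut := 1 / (n + 1)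
  rIn_pos := by positivity
  rIn_lt_rOut := by
    apply one_div_lt_one_div_of_lt <;> linarith [Nat.cast_nonneg (α := ℝ) n]

/-- A sequence of mollifiers. -/
noncomputable def mollifier (N n : ℕ) : TestFun N where
  toFun := (bump N n).normed volume
  contDiff := (bump N n).contDiff_normed
  hasCompactSupport := (bump N n).hasCompactSupport_normed

theorem mollifier_reflect (n : ℕ) : (mollifier N n).reflect = mollifier N n := by
  simp [TestFun.reflect, mollifier, ContDiffBump.normed_neg]

theorem inner_smear_mollifier (n : ℕ) (f g : L2 N) :
    ⟪smear (mollifier N n) f, g⟫_ℝ = ⟪f, smear (mollifier N n) g⟫_ℝ := by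
  rw [inner_smear_eq_inner_smear_reflect, mollifier_reflect]

/-- The mollifier is even, so its partial derivatives are odd. This is the source of the skewness of
the regularized wave operator. -/
theorem inner_smear_mollifier_pderiv (i : Fin N) (n : ℕ) (f g : L2 N) :
    ⟪smear ((mollifier N n).pderiv i) f, g⟫_ℝ = -⟪f, smear ((mollifier N n).pderiv i) g⟫_ℝ := by
  rw [inner_smear_eq_inner_smear_reflect, inner_smear_right, inner_smear_right, ← integral_neg]
  refine integral_congr_ae (ae_of_all _ fun y => ?_)
  have := (mollifier N n).pderiv_reflect i (-y)
  rw [mollifier_reflect, neg_neg] at this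
  simp only [TestFun.reflect, this, neg_mul]

theorem norm_smear_mollifier_le (n : ℕ) (f : L2 N) : ‖smear (mollifier N n) f‖ ≤ ‖f‖ := by
  refine (norm_smear_le _ _).trans (le_of_eq ?_)
  have h : ∀ y, ‖mollifier N n y‖ = (bump N n).normed volume y := fun y =>
    Real.norm_of_nonneg ((bump N n).nonneg_normed y)
  simp only [h, (bump N n).integral_normed, one_mul]

/-- The left side is the value at `0` of the `L²`-valued convolution of the bump with the continuous
map `y ↦ translateL2 (-y) f`. -/
theorem tendsto_smear_mollifier (f : L2 N) :
    Tendsto (fun n => smear (mollifier N n) f) atTop (𝓝 f) := by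
  have hr : Tendsto (fun n => (bump N n).rOut) atTop (𝓝 0) :=
    tendsto_one_div_add_atTop_nhds_zero_nat
  have h := ContDiffBump.convolution_tendsto_right_of_continuous (μ := volume) hr
    ((continuous_translateL2 f).comp continuous_neg) (0 : Space N)
  simpa [convolution_def, smear_apply, translateL2_zero, mollifier] using h

/-! ### Weak derivatives characterized by mollification -/

section Divergence

variable {r : L2 N} {p : Fin N → L2 N}

/-- If `r` is the weak divergence of `p`, then convolution commutes with the divergence. -/
theorem smear_eq_sum_of_inner_eq
    (h : ∀ ψ : TestFun N, ⟪r, ψ.toL2⟫_ℝ = -∑ i, ⟪p i, (ψ.pderiv i).toL2⟫_ℝ) (ρ : TestFun N) :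
    smear ρ r = ∑ i, smear (ρ.pderiv i) (p i) := by
  refine L2.ext_inner fun ψ => ?_
  have hInt : ∀ (f : L2 N) (η : TestFun N),
      Integrable fun y => ρ y * ⟪translateL2 y f, η.toL2⟫_ℝ := by
    intro f η
    have := ((innerSL ℝ η.toL2).integrable_comp (integrable_smul_translateL2 ρ f))
    simpa [inner_smul_right, real_inner_comm] using this
  have h1 : ∀ y, ⟪translateL2 y r, ψ.toL2⟫_ℝ =
      -∑ i, ⟪translateL2 y (p i), (ψ.pderiv i).toL2⟫_ℝ := by
    intro y
    rw [inner_translateL2, translateL2_toL2, h]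
    congr 1
    refine Finset.sum_congr rfl fun i _ => ?_
    rw [inner_translateL2, translateL2_toL2]
    congr 2
    simp only [TestFun.pderiv, TestFun.translate, TestFun.mk.injEq]
    funext x
    exact TestFun.pderiv_translate i (-y) ψ x
  rw [sum_inner, inner_smear_left]
  simp only [h1, mul_neg, Finset.mul_sum]
  rw [integral_neg, integral_finsetSum _ fun i _ => hInt (p i) (ψ.pderiv i),
    ← Finset.sum_neg_distrib]
  refine Finset.sum_congr rfl fun i _ => ?_
  rw [← inner_smear_left, inner_smear_pderiv, neg_neg]

/-- Converse of `smear_eq_sum_of_inner_eq`: the mollifiers alone suffice, since the derivative can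
be moved to `ψ` before letting `n → ∞`. -/
theorem inner_eq_of_smear_eq_sum
    (h : ∀ n, smear (mollifier N n) r = ∑ i, smear ((mollifier N n).pderiv i) (p i))
    (ψ : TestFun N) : ⟪r, ψ.toL2⟫_ℝ = -∑ i, ⟪p i, (ψ.pderiv i).toL2⟫_ℝ := by
  have h1 : ∀ n, ⟪smear (mollifier N n) r, ψ.toL2⟫_ℝ =
      -∑ i, ⟪smear (mollifier N n) (p i), (ψ.pderiv i).toL2⟫_ℝ := by
    intro n
    rw [h, sum_inner, ← Finset.sum_neg_distrib]
    refine Finset.sum_congr rfl fun i _ => ?_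
    rw [inner_smear_pderiv, neg_neg]
  refine tendsto_nhds_unique ((tendsto_smear_mollifier r).inner tendsto_const_nhds) ?_
  simp only [h1]
  exact (tendsto_finsetSum _ fun i _ =>
    (tendsto_smear_mollifier (p i)).inner tendsto_const_nhds).neg

end Divergence

/-- Weak differentiability of locally integrable functions, tested against `TestFun`. -/
theorem HasWeakPartial.integral_pderiv {i : Fin N} {v g : Fun N} (h : HasWeakPartial i v g)
    (ψ : TestFun N) : ∫ x, v x * ψ.pderiv i x = -∫ x, g x * ψ x :=
  h.integral_eq ψ ψ.contDiff ψ.hasCompactSupport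

theorem hasWeakPartial_iff_inner {i : Fin N} {v g : L2 N} :
    HasWeakPartial i (v : Fun N) (g : Fun N) ↔
      ∀ ψ : TestFun N, ⟪v, (ψ.pderiv i).toL2⟫_ℝ = -⟪g, ψ.toL2⟫_ℝ := by
  simp only [L2.inner_toL2]
  exact ⟨fun h ψ => h.integral_pderiv ψ, fun h => ⟨L2.locallyIntegrable v, L2.locallyIntegrable g,
    fun ψ hψ hc => h ⟨ψ, hψ, hc⟩⟩⟩

theorem HasWeakPartial.smear_eq {i : Fin N} {v g : L2 N}
    (h : HasWeakPartial i (v : Fun N) (g : Fun N)) (ρ : TestFun N) :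
    smear ρ g = smear (ρ.pderiv i) v := by
  rw [hasWeakPartial_iff_inner] at h
  -- A single partial derivative is the divergence of a field with only one nonzero component.
  have := smear_eq_sum_of_inner_eq (r := g) (p := fun j => if j = i then v else 0) (fun ψ => by
    rw [Finset.sum_eq_single i (fun j _ hj => by simp [hj]) (by simp)]
    simp [h ψ]) ρ
  rw [this, Finset.sum_eq_single i (fun j _ hj => by simp [hj]) (by simp)]
  simp

theorem hasWeakPartial_of_smear_eq {i : Fin N} {v g : L2 N}
    (h : ∀ n, smear (mollifier N n) g = smear ((mollifier N n).pderiv i) v) :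
    HasWeakPartial i (v : Fun N) (g : Fun N) := by
  rw [hasWeakPartial_iff_inner]
  intro ψ
  have := inner_eq_of_smear_eq_sum (r := g) (p := fun j => if j = i then v else 0) (fun n => by
    rw [Finset.sum_eq_single i (fun j _ hj => by simp [hj]) (by simp)]
    simp [h n]) ψ
  rw [this, Finset.sum_eq_single i (fun j _ hj => by simp [hj]) (by simp)]
  simp

theorem Fun.ext_integral {v w : Fun N} (hv : LocallyIntegrable v volume)
    (hw : LocallyIntegrable w volume) (h : ∀ ψ : TestFun N, ∫ x, v x * ψ x = ∫ x, w x * ψ x) :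
    v = w := by
  refine AEEqFun.ext ?_
  have h0 := ae_eq_of_integral_contDiff_smul_eq hv hw fun ψ hψ hc => by
    simpa only [smul_eq_mul, mul_comm] using h ⟨ψ, hψ, hc⟩
  exact h0

theorem HasWeakPartial.unique {i : Fin N} {v g h : Fun N} (hg : HasWeakPartial i v g)
    (hh : HasWeakPartial i v h) : g = h :=
  Fun.ext_integral hg.locallyIntegrable_deriv hh.locallyIntegrable_deriv fun ψ => by
    rw [← neg_inj, ← hg.integral_pderiv, hh.integral_pderiv]

theorem HasWeakPartial.weakPartial_eq {i : Fin N} {v g : Fun N} (hg : HasWeakPartial i v g) :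
    weakPartial i v = g := by
  have h : ∃ g : Fun N, HasWeakPartial i v g := ⟨g, hg⟩
  rw [weakPartial, dif_pos h]
  exact h.choose_spec.unique hg

theorem HasWeakPartial.add {i : Fin N} {v g w h : Fun N} (hv : HasWeakPartial i v g)
    (hw : HasWeakPartial i w h) : HasWeakPartial i (v + w) (g + h) := by
  have key : ∀ {a b : Fun N} {ψ : Space N → ℝ}, LocallyIntegrable a volume →
      LocallyIntegrable b volume → Continuous ψ → HasCompactSupport ψ →
      ∫ x, (a + b) x * ψ x = (∫ x, a x * ψ x) + ∫ x, b x * ψ x := by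
    intro a b ψ ha hb hψ hc
    rw [← integral_add]
    · refine integral_congr_ae ?_
      filter_upwards [AEEqFun.coeFn_add a b] with x hx
      rw [hx, Pi.add_apply, add_mul]
    · simpa only [smul_eq_mul, mul_comm] using ha.integrable_smul_left_of_hasCompactSupport hψ hc
    · simpa only [smul_eq_mul, mul_comm] using hb.integrable_smul_left_of_hasCompactSupport hψ hc
  have hl : ∀ {a b : Fun N}, LocallyIntegrable a volume →
      LocallyIntegrable b volume → LocallyIntegrable (a + b : Fun N) volume := by
    intro a b ha hb
    exact (ha.add hb).congr (AEEqFun.coeFn_add a b).symm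
  refine ⟨hl hv.locallyIntegrable hw.locallyIntegrable,
    hl hv.locallyIntegrable_deriv hw.locallyIntegrable_deriv, fun ψ hψ hc => ?_⟩
  have hd := key hv.locallyIntegrable hw.locallyIntegrable
    ((TestFun.mk ψ hψ hc).pderiv i).continuous ((TestFun.mk ψ hψ hc).pderiv i).hasCompactSupport
  simp only [TestFun.pderiv] at hd
  rw [key hv.locallyIntegrable_deriv hw.locallyIntegrable_deriv hψ.continuous hc, hd,
    hv.integral_eq ψ hψ hc, hw.integral_eq ψ hψ hc, neg_add]

/-! ### The phase space and the wave operator -/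

/-- The phase space of pairs `(∂ₜφ, ∇φ)`. -/
abbrev Phase (N : ℕ) : Type := PiLp 2 fun _ : Option (Fin N) => L2 N

/-- A continuous linear map into the phase space from its components. -/
noncomputable def Phase.lift {E : Type*} [NormedAddCommGroup E] [NormedSpace ℝ E]
    (B : Option (Fin N) → E →L[ℝ] L2 N) : E →L[ℝ] Phase N :=
  ((PiLp.continuousLinearEquiv 2 ℝ fun _ : Option (Fin N) => L2 N).symm :
    (Option (Fin N) → L2 N) →L[ℝ] Phase N).comp (ContinuousLinearMap.pi B)

theorem Phase.lift_apply {E : Type*} [NormedAddCommGroup E] [NormedSpace ℝ E]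
    (B : Option (Fin N) → E →L[ℝ] L2 N) (x : E) (o : Option (Fin N)) :
    Phase.lift B x o = B o x := rfl

/-- The components of an element of the phase space. -/
noncomputable def Phase.proj (o : Option (Fin N)) : Phase N →L[ℝ] L2 N :=
  PiLp.proj 2 (fun _ : Option (Fin N) => L2 N) o

theorem Phase.proj_apply (o : Option (Fin N)) (U : Phase N) : Phase.proj o U = U o := rfl

/-- A componentwise operator on the phase space. -/
noncomputable def Phase.diag (B : L2 N →L[ℝ] L2 N) : Phase N →L[ℝ] Phase N :=
  Phase.lift fun o => B.comp (Phase.proj o)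

theorem Phase.diag_apply (B : L2 N →L[ℝ] L2 N) (U : Phase N) (o : Option (Fin N)) :
    Phase.diag B U o = B (U o) := rfl

/-- The wave operator `(v, p) ↦ (div p, ∇v)`, with `∂ᵢ` replaced by `D i`. -/
noncomputable def Phase.wave (D : Fin N → L2 N →L[ℝ] L2 N) : Phase N →L[ℝ] Phase N :=
  Phase.lift fun o => match o with
    | none => ∑ i, (D i).comp (Phase.proj (some i))
    | some i => (D i).comp (Phase.proj none)

theorem Phase.wave_none (D : Fin N → L2 N →L[ℝ] L2 N) (U : Phase N) :
    Phase.wave D U none = ∑ i, D i (U (some i)) := by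
  simp [Phase.wave, Phase.lift_apply, Phase.proj_apply]

theorem Phase.wave_some (D : Fin N → L2 N →L[ℝ] L2 N) (U : Phase N) (i : Fin N) :
    Phase.wave D U (some i) = D i (U none) := rfl

theorem Phase.ext {U V : Phase N} (h0 : U none = V none) (h1 : ∀ i, U (some i) = V (some i)) :
    U = V := by
  refine PiLp.ext fun o => ?_
  cases o with
  | none => exact h0
  | some i => exact h1 i

theorem Phase.tendsto {α : Type*} {l : Filter α} {f : α → Phase N} {U : Phase N}
    (h : ∀ o, Tendsto (fun a => f a o) l (𝓝 (U o))) : Tendsto f l (𝓝 U) :=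
  ((PiLp.continuousLinearEquiv 2 ℝ fun _ : Option (Fin N) => L2 N).symm.continuous.tendsto
    fun o => U o).comp (tendsto_pi_nhds.2 h)

theorem Phase.inner_eq (U V : Phase N) :
    ⟪U, V⟫_ℝ = ⟪U none, V none⟫_ℝ + ∑ i, ⟪U (some i), V (some i)⟫_ℝ := by
  rw [PiLp.inner_apply, Fintype.sum_option]

theorem Phase.norm_sq_eq (U : Phase N) :
    ‖U‖ ^ 2 = ‖U none‖ ^ 2 + ∑ i, ‖U (some i)‖ ^ 2 := by
  rw [PiLp.norm_sq_eq_of_L2, Fintype.sum_option]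

/-- The regularized wave operator. -/
noncomputable def waveRegularization (N : ℕ) : SkewRegularization (Phase N) where
  M n := Phase.diag (smear (mollifier N n))
  A n := Phase.wave fun i => smear ((mollifier N n).pderiv i)
  M_symm n U V := by
    simp only [PiLp.inner_apply, Phase.diag_apply, inner_smear_mollifier]
  -- Moving each derivative across costs a sign and exchanges the divergence terms with the gradient
  -- terms.
  A_skew n U V := by
    simp only [Phase.inner_eq, Phase.wave_none, Phase.wave_some, sum_inner, inner_sum,
      inner_smear_mollifier_pderiv, Finset.sum_neg_distrib]
    ring
  A_M m n U := by
    refine Phase.ext ?_ fun i => ?_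
    · simp only [Phase.wave_none, Phase.diag_apply]
      exact Finset.sum_congr rfl fun i _ => smear_pderiv_smear i _ _ _
    · simp only [Phase.wave_some, Phase.diag_apply]
      exact smear_pderiv_smear i _ _ _
  M_A m n U := by
    refine Phase.ext ?_ fun i => ?_
    · simp only [Phase.wave_none, Phase.diag_apply, map_sum]
      exact Finset.sum_congr rfl fun i _ => smear_comm _ _ _
    · simp only [Phase.wave_some, Phase.diag_apply]
      exact smear_comm _ _ _
  A_A m n U := by
    have key : ∀ i j (f : L2 N), smear ((mollifier N m).pderiv i)
        (smear ((mollifier N n).pderiv j) f) =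
        smear ((mollifier N n).pderiv i) (smear ((mollifier N m).pderiv j) f) :=
      fun i j f => smear_pderiv_smear_pderiv i j _ _ f
    refine Phase.ext ?_ fun i => ?_
    · simp only [Phase.wave_none, Phase.wave_some]
      exact Finset.sum_congr rfl fun i _ => key i i _
    · simp only [Phase.wave_none, Phase.wave_some, map_sum]
      exact Finset.sum_congr rfl fun j _ => key i j _
  tendsto_M U := Phase.tendsto fun o => tendsto_smear_mollifier (U o)
  norm_M_le n U := by
    refine le_of_sq_le_sq ?_ (norm_nonneg _)
    simp only [Phase.norm_sq_eq, Phase.diag_apply]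
    gcongr <;> exact norm_smear_mollifier_le _ _

theorem waveRegularization_M (n : ℕ) (U : Phase N) (o : Option (Fin N)) :
    (waveRegularization N).M n U o = smear (mollifier N n) (U o) := rfl

theorem waveRegularization_A_none (n : ℕ) (U : Phase N) :
    (waveRegularization N).A n U none = ∑ i, smear ((mollifier N n).pderiv i) (U (some i)) :=
  Phase.wave_none _ _

theorem waveRegularization_A_some (n : ℕ) (U : Phase N) (i : Fin N) :
    (waveRegularization N).A n U (some i) = smear ((mollifier N n).pderiv i) (U none) := rfl

attribute [irreducible] waveRegularization

/-! ### The sine nonlinearity on `L²` -/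

/-- Mean value inequality for `s ↦ f s - f' a * s` on the ball of radius `|b|` about `a`, where its
derivative is at most `K |b|`. The sharper constant `K / 2` is not needed. -/
theorem abs_taylor_le {f f' : ℝ → ℝ} {K : ℝ} (hf : ∀ x, HasDerivAt f (f' x) x)
    (hf' : ∀ x y, |f' x - f' y| ≤ K * |x - y|) (a b : ℝ) :
    |f (a + b) - f a - f' a * b| ≤ K * b ^ 2 := by
  have hK : 0 ≤ K := by simpa using (abs_nonneg _).trans (hf' 1 0)
  have hd : ∀ s ∈ Metric.closedBall a |b|, HasDerivWithinAt (fun s => f s - f' a * s)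
      (f' s - f' a * 1) (Metric.closedBall a |b|) s := fun s _ =>
    ((hf s).sub ((hasDerivAt_id s).const_mul (f' a))).hasDerivWithinAt
  have hb : ∀ s ∈ Metric.closedBall a |b|, ‖f' s - f' a * 1‖ ≤ K * |b| := by
    intro s hs
    rw [mul_one, Real.norm_eq_abs]
    exact (hf' s a).trans (mul_le_mul_of_nonneg_left (by simpa [Real.dist_eq] using hs) hK)
  have := Convex.norm_image_sub_le_of_norm_hasDerivWithin_le hd hb (convex_closedBall a |b|)
    (x := a) (y := a + b) (by simp) (by simp)
  rw [add_sub_cancel_left, Real.norm_eq_abs, Real.norm_eq_abs, mul_assoc, abs_mul_abs_self,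
    ← sq] at this
  convert this using 2
  ring

theorem abs_sin_sub_sin_le (x y : ℝ) : |Real.sin x - Real.sin y| ≤ |x - y| := by
  have := Real.lipschitzWith_sin.dist_le_mul x y
  simpa [Real.dist_eq] using this

theorem abs_cos_sub_cos_le (x y : ℝ) : |Real.cos x - Real.cos y| ≤ |x - y| := by
  have := Real.lipschitzWith_cos.dist_le_mul x y
  simpa [Real.dist_eq] using this

theorem abs_sin_sq_taylor_le (a b : ℝ) :
    |Real.sin (a + b) ^ 2 - Real.sin a ^ 2 - Real.sin (2 * a) * b| ≤ 2 * b ^ 2 := by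
  refine abs_taylor_le (f := fun x => Real.sin x ^ 2) (f' := fun x => Real.sin (2 * x))
    (fun x => ?_) (fun x y => ?_) a b
  · have := (Real.hasDerivAt_sin x).pow 2
    refine this.congr_deriv ?_
    rw [Real.sin_two_mul]; simp
  · refine (abs_sin_sub_sin_le _ _).trans (le_of_eq ?_)
    rw [← mul_sub, abs_mul, abs_two]

theorem abs_sin_two_mul_taylor_le (a b : ℝ) :
    |Real.sin (2 * (a + b)) - Real.sin (2 * a) - 2 * Real.cos (2 * a) * b| ≤ 4 * b ^ 2 := by
  refine abs_taylor_le (f := fun x => Real.sin (2 * x)) (f' := fun x => 2 * Real.cos (2 * x))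
    (fun x => ?_) (fun x y => ?_) a b
  · have := ((hasDerivAt_id x).const_mul 2).sin
    refine this.congr_deriv ?_
    simp [mul_comm]
  · rw [← mul_sub, abs_mul, abs_two]
    have h := abs_cos_sub_cos_le (2 * x) (2 * y)
    rw [← mul_sub, abs_mul, abs_two] at h
    linarith

theorem coe_add_L2 (φ : Fun N) (u : L2 N) :
    ((φ + (u : Fun N) : Fun N) : Space N → ℝ) =ᵐ[volume] fun x => φ x + u x :=
  AEEqFun.coeFn_add φ (u : Fun N)

theorem coe_sub_L2 (u w : L2 N) : (u - w : L2 N) =ᵐ[volume] fun x => u x - w x :=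
  Lp.coeFn_sub u w

theorem aestronglyMeasurable_sin_comp (φ : Fun N) (k : ℝ) :
    AEStronglyMeasurable (fun x => Real.sin (k * φ x)) volume :=
  (by fun_prop : Continuous fun y => Real.sin (k * y)).comp_aestronglyMeasurable
    φ.aestronglyMeasurable

theorem aestronglyMeasurable_cos_comp (φ : Fun N) (k : ℝ) :
    AEStronglyMeasurable (fun x => Real.cos (k * φ x)) volume :=
  (by fun_prop : Continuous fun y => Real.cos (k * y)).comp_aestronglyMeasurable
    φ.aestronglyMeasurable

/-- The condition `sin φ ∈ L²`. -/
def SinMem (φ : Fun N) : Prop := MemLp (fun x => Real.sin (φ x)) 2 volume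

theorem SinMem.add {φ : Fun N} (h : SinMem φ) (u : L2 N) : SinMem (φ + (u : Fun N)) := by
  have hm := aestronglyMeasurable_sin_comp (φ + (u : Fun N)) 1
  simp only [one_mul] at hm
  have h0 : MemLp (fun x => ‖Real.sin (φ x)‖ + ‖u x‖) 2 volume :=
    MemLp.add (MemLp.norm h) (Lp.memLp u).norm
  refine MemLp.of_le h0 hm ?_
  filter_upwards [coe_add_L2 φ u] with x hx
  rw [hx, Real.norm_eq_abs, Real.norm_of_nonneg (by positivity)]
  have h1 := abs_sin_sub_sin_le (φ x + u x) (φ x)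
  rw [add_sub_cancel_left] at h1
  have h2 := abs_add_le (Real.sin (φ x + u x) - Real.sin (φ x)) (Real.sin (φ x))
  rw [sub_add_cancel] at h2
  simp only [Real.norm_eq_abs]
  linarith

theorem SinMem.sub {φ χ : Fun N} (h : SinMem φ) (h' : SinMem χ) : SinMem (φ - χ) := by
  have hm := aestronglyMeasurable_sin_comp (φ - χ) 1
  simp only [one_mul] at hm
  have h0 : MemLp (fun x => ‖Real.sin (φ x)‖ + ‖Real.sin (χ x)‖) 2 volume :=
    MemLp.add (MemLp.norm h) (MemLp.norm h')
  refine MemLp.of_le h0 hm ?_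
  filter_upwards [AEEqFun.coeFn_sub φ χ] with x hx
  rw [hx, Real.norm_eq_abs, Pi.sub_apply, Real.norm_of_nonneg (by positivity),
    Real.sin_sub]
  refine (abs_sub _ _).trans ?_
  rw [abs_mul, abs_mul]
  simp only [Real.norm_eq_abs]
  have h1 := Real.abs_cos_le_one (φ x)
  have h2 := Real.abs_cos_le_one (χ x)
  nlinarith [abs_nonneg (Real.sin (φ x)), abs_nonneg (Real.sin (χ x))]

theorem SinMem.memLp_two_mul {φ : Fun N} (h : SinMem φ) :
    MemLp (fun x => Real.sin (2 * φ x)) 2 volume := by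
  refine MemLp.of_le_mul (c := 2) h (aestronglyMeasurable_sin_comp φ 2) (ae_of_all _ fun x => ?_)
  rw [Real.sin_two_mul, norm_mul, norm_mul, Real.norm_of_nonneg zero_le_two]
  exact mul_le_of_le_one_right (by positivity) (Real.abs_cos_le_one _)

open scoped Classical in
/-- The class of `sin φ` in `L²`. -/
noncomputable def sinL2 (φ : Fun N) : L2 N := if h : SinMem φ then h.toLp _ else 0

open scoped Classical in
/-- The class of `sin (2 φ)` in `L²`. -/
noncomputable def sinTwoL2 (φ : Fun N) : L2 N := if h : SinMem φ then h.memLp_two_mul.toLp _ else 0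

theorem SinMem.coe_sinL2 {φ : Fun N} (h : SinMem φ) :
    sinL2 φ =ᵐ[volume] fun x => Real.sin (φ x) := by
  rw [sinL2, dif_pos h]; exact MemLp.coeFn_toLp _

theorem SinMem.coe_sinTwoL2 {φ : Fun N} (h : SinMem φ) :
    sinTwoL2 φ =ᵐ[volume] fun x => Real.sin (2 * φ x) := by
  rw [sinTwoL2, dif_pos h]; exact MemLp.coeFn_toLp _

theorem norm_sinTwoL2_le {φ : Fun N} (h : SinMem φ) : ‖sinTwoL2 φ‖ ≤ 2 * ‖sinL2 φ‖ := by
  refine Lp.norm_le_mul_norm_of_ae_le_mul ?_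
  filter_upwards [h.coe_sinL2, h.coe_sinTwoL2] with x h1 h2
  rw [h1, h2, Real.sin_two_mul, norm_mul, norm_mul, Real.norm_of_nonneg zero_le_two]
  exact mul_le_of_le_one_right (by positivity) (Real.abs_cos_le_one _)

/-- `sin 2φ - sin 2χ = 2 sin (φ - χ) cos (φ + χ)`. The forces are thus compared through `sin (φ -
χ)` alone, even when `φ - χ` is not in `L²`. -/
theorem norm_sinTwoL2_sub_le {φ χ : Fun N} (h : SinMem φ) (h' : SinMem χ) :
    ‖sinTwoL2 φ - sinTwoL2 χ‖ ≤ 2 * ‖sinL2 (φ - χ)‖ := by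
  refine Lp.norm_le_mul_norm_of_ae_le_mul ?_
  filter_upwards [coe_sub_L2 (sinTwoL2 φ) (sinTwoL2 χ), h.coe_sinTwoL2, h'.coe_sinTwoL2,
    (h.sub h').coe_sinL2, AEEqFun.coeFn_sub φ χ] with x h1 h2 h3 h4 h5
  rw [h1, h2, h3, h4, h5, Real.sin_sub_sin, norm_mul, norm_mul, Real.norm_of_nonneg zero_le_two,
    Pi.sub_apply, show (2 * φ x - 2 * χ x) / 2 = φ x - χ x by ring]
  exact mul_le_of_le_one_right (by positivity) (Real.abs_cos_le_one _)

theorem norm_sinTwoL2_add_sub_le {φ : Fun N} (h : SinMem φ) (u w : L2 N) :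
    ‖sinTwoL2 (φ + (u : Fun N)) - sinTwoL2 (φ + (w : Fun N))‖ ≤ 2 * ‖u - w‖ := by
  refine Lp.norm_le_mul_norm_of_ae_le_mul ?_
  filter_upwards [coe_sub_L2 (sinTwoL2 (φ + (u : Fun N))) (sinTwoL2 (φ + (w : Fun N))),
    (h.add u).coe_sinTwoL2, (h.add w).coe_sinTwoL2, coe_add_L2 φ u, coe_add_L2 φ w,
    coe_sub_L2 u w] with x h1 h2 h3 h4 h5 h6
  rw [h1, h2, h3, h4, h5, h6]
  refine (abs_sin_sub_sin_le _ _).trans (le_of_eq ?_)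
  rw [← mul_sub, add_sub_add_left_eq_sub, abs_mul, abs_two, Real.norm_eq_abs]

theorem continuous_sinTwoL2 {φ : Fun N} (h : SinMem φ) :
    Continuous fun u : L2 N => sinTwoL2 (φ + (u : Fun N)) :=
  (LipschitzWith.of_dist_le_mul (K := 2) fun u w => by
    rw [dist_eq_norm, dist_eq_norm]; exact norm_sinTwoL2_add_sub_le h u w).continuous

theorem L2.integrable_mul (f g : L2 N) : Integrable (fun x => f x * g x) volume := by
  simpa [mul_comm] using MeasureTheory.L2.integrable_inner (𝕜 := ℝ) f g

theorem L2.integrable_mul_sub_mul (f g h k : L2 N) :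
    Integrable (fun x => f x * g x - h x * k x) volume :=
  (L2.integrable_mul f g).sub (L2.integrable_mul h k)

theorem hasFDerivAt_of_abs_sub_le {E : Type*} [NormedAddCommGroup E] [NormedSpace ℝ E]
    {Q : E → ℝ} {L : E →L[ℝ] ℝ} {C : ℝ} {u : E}
    (h : ∀ w, |Q w - Q u - L (w - u)| ≤ C * ‖w - u‖ ^ 2) : HasFDerivAt Q L u := by
  have h1 : HasFDerivAt (fun w => Q w - Q u - L (w - u)) (0 : E →L[ℝ] ℝ) u := by
    refine Asymptotics.IsBigO.hasFDerivAt (n := 2) ?_ one_lt_two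
    refine Asymptotics.IsBigO.of_bound C (Eventually.of_forall fun w => ?_)
    simpa using h w
  have h2 : HasFDerivAt (fun w => Q u + L (w - u)) L u := by
    simpa using (L.hasFDerivAt.comp u ((hasFDerivAt_id u).sub_const u)).const_add (Q u)
  have h3 := h1.add h2
  rw [zero_add] at h3
  refine h3.congr_of_eventuallyEq (Eventually.of_forall fun w => ?_)
  simp

/-- The potential energy is differentiable. -/
theorem hasFDerivAt_norm_sinL2_sq {φ : Fun N} (h : SinMem φ) (u : L2 N) :
    HasFDerivAt (fun w : L2 N => ‖sinL2 (φ + (w : Fun N))‖ ^ 2)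
      (innerSL ℝ (sinTwoL2 (φ + (u : Fun N)))) u := by
  refine hasFDerivAt_of_abs_sub_le (C := 2) fun w => ?_
  simp only [innerSL_apply_apply, ← real_inner_self_eq_norm_sq, L2.inner_def]
  rw [← integral_sub (L2.integrable_mul _ _) (L2.integrable_mul _ _),
    ← integral_sub (L2.integrable_mul_sub_mul _ _ _ _) (L2.integrable_mul _ _),
    ← integral_const_mul, ← Real.norm_eq_abs]
  refine norm_integral_le_of_norm_le ((L2.integrable_mul _ _).const_mul 2) ?_
  filter_upwards [(h.add w).coe_sinL2, (h.add u).coe_sinL2, (h.add u).coe_sinTwoL2,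
    coe_add_L2 φ u, coe_add_L2 φ w, coe_sub_L2 w u] with x h1 h2 h3 h4 h5 h6
  rw [h1, h2, h3, h4, h5, h6, Real.norm_eq_abs]
  have := abs_sin_sq_taylor_le (φ x + u x) (w x - u x)
  rw [show φ x + u x + (w x - u x) = φ x + w x by ring] at this
  convert this using 1
  · congr 1; ring
  · ring

theorem memLp_cos_mul (φ : Fun N) (p : L2 N) :
    MemLp (fun x => Real.cos (2 * φ x) * p x) 2 volume :=
  MemLp.of_le (Lp.memLp p) ((aestronglyMeasurable_cos_comp φ 2).mul (Lp.aestronglyMeasurable p))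
    (ae_of_all _ fun x => by
      rw [norm_mul]
      exact mul_le_of_le_one_left (norm_nonneg _) (Real.abs_cos_le_one _))

/-- Multiplication by `cos (2 φ)` on `L²`. -/
noncomputable def cosMul (φ : Fun N) : L2 N →L[ℝ] L2 N :=
  have hmem := memLp_cos_mul φ
  LinearMap.mkContinuous
    { toFun := fun p => (hmem p).toLp _
      map_add' := fun p q => by
        refine Lp.ext ?_
        filter_upwards [(hmem (p + q)).coeFn_toLp, (hmem p).coeFn_toLp, (hmem q).coeFn_toLp,
          Lp.coeFn_add p q, Lp.coeFn_add ((hmem p).toLp _) ((hmem q).toLp _)] with x h1 h2 h3 h4 h5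
        rw [h1, h5, Pi.add_apply, h2, h3, h4, Pi.add_apply, mul_add]
      map_smul' := fun c p => by
        refine Lp.ext ?_
        filter_upwards [(hmem (c • p)).coeFn_toLp, (hmem p).coeFn_toLp, Lp.coeFn_smul c p,
          Lp.coeFn_smul c ((hmem p).toLp _)] with x h1 h2 h3 h4
        rw [h1, RingHom.id_apply, h4, Pi.smul_apply, h2, h3, Pi.smul_apply, smul_eq_mul,
          smul_eq_mul]
        ring }
    1 fun p => by
      refine Lp.norm_le_mul_norm_of_ae_le_mul ?_
      filter_upwards [(hmem p).coeFn_toLp] with x h1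
      rw [LinearMap.coe_mk, AddHom.coe_mk, h1, norm_mul]
      exact mul_le_mul_of_nonneg_right (Real.abs_cos_le_one _) (norm_nonneg _)

theorem coe_cosMul (φ : Fun N) (p : L2 N) :
    cosMul φ p =ᵐ[volume] fun x => Real.cos (2 * φ x) * p x :=
  (memLp_cos_mul φ p).coeFn_toLp

theorem norm_cosMul_le (φ : Fun N) (p : L2 N) : ‖cosMul φ p‖ ≤ ‖p‖ := by
  refine Lp.norm_le_norm_of_ae_le ?_
  filter_upwards [coe_cosMul φ p] with x h1
  rw [h1, norm_mul]
  exact mul_le_of_le_one_left (norm_nonneg _) (Real.abs_cos_le_one _)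

theorem TestFun.exists_bound (ψ : TestFun N) : ∃ C, ∀ x, ‖ψ x‖ ≤ C :=
  ψ.continuous.bounded_above_of_compact_support ψ.hasCompactSupport

/-- For a bounded `p` the map is Lipschitz, as the cosine is. Smooth compactly supported functions
are dense, and the bound `‖cosMul φ p‖ ≤ ‖p‖` makes the approximation uniform in `u`. -/
theorem continuous_cosMul_apply (φ : Fun N) (p : L2 N) :
    Continuous fun u : L2 N => cosMul (φ + (u : Fun N)) p := by
  refine continuous_of_uniform_approx_of_continuous fun V hV => ?_
  obtain ⟨ε, hε, hεV⟩ := Metric.mem_uniformity_dist.1 hV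
  obtain ⟨q, ⟨ψ, hqψ, hc, hs⟩, hq⟩ := Metric.mem_closure_iff.1
    (Lp.dense_hasCompactSupport_contDiff (E := Space N) (F := ℝ) (μ := volume) (p := 2)
      (by simp) p) ε hε
  refine ⟨fun u => cosMul (φ + (u : Fun N)) q, ?_, fun u => hεV ?_⟩
  · obtain ⟨C, hC⟩ := TestFun.exists_bound ⟨ψ, hs, hc⟩
    have hC0 : 0 ≤ C := (norm_nonneg _).trans (hC 0)
    refine (LipschitzWith.of_dist_le_mul (K := ⟨2 * C, by positivity⟩) fun u w => ?_).continuous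
    rw [dist_eq_norm, dist_eq_norm]
    refine Lp.norm_le_mul_norm_of_ae_le_mul ?_
    filter_upwards [coe_sub_L2 (cosMul (φ + (u : Fun N)) q) (cosMul (φ + (w : Fun N)) q),
      coe_cosMul (φ + (u : Fun N)) q, coe_cosMul (φ + (w : Fun N)) q, coe_add_L2 φ u,
      coe_add_L2 φ w, coe_sub_L2 u w, hqψ] with x h1 h2 h3 h4 h5 h6 h7
    rw [h1, h2, h3, h4, h5, h6, h7, ← sub_mul, norm_mul]
    have h8 := abs_cos_sub_cos_le (2 * (φ x + u x)) (2 * (φ x + w x))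
    rw [← mul_sub, add_sub_add_left_eq_sub, abs_mul, abs_two] at h8
    have := mul_le_mul h8 (hC x) (norm_nonneg _) (by positivity)
    change _ ≤ 2 * C * _
    simp only [Real.norm_eq_abs] at this ⊢
    linarith
  · rw [dist_eq_norm, ← map_sub]
    exact (norm_cosMul_le _ _).trans_lt (by rwa [← dist_eq_norm])

theorem continuous_cosMul (φ : Fun N) :
    Continuous fun z : L2 N × L2 N => cosMul (φ + (z.1 : Fun N)) z.2 := by
  refine continuous_iff_continuousAt.2 fun ⟨u, p⟩ => ?_
  have h1 : Tendsto (fun z : L2 N × L2 N => cosMul (φ + (z.1 : Fun N)) (z.2 - p)) (𝓝 (u, p))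
      (𝓝 0) := by
    refine squeeze_zero_norm (fun z => norm_cosMul_le _ _) ?_
    have : Continuous fun z : L2 N × L2 N => ‖z.2 - p‖ := by fun_prop
    simpa using this.tendsto (u, p)
  have h2 : Tendsto (fun z : L2 N × L2 N => cosMul (φ + (z.1 : Fun N)) p) (𝓝 (u, p))
      (𝓝 (cosMul (φ + (u : Fun N)) p)) :=
    ((continuous_cosMul_apply φ p).comp continuous_fst).tendsto (u, p)
  simpa [map_sub, ContinuousAt] using h1.add h2

/-- Against a test function, `sin (2 φ)` is differentiable. -/
theorem hasFDerivAt_inner_sinTwoL2 {φ : Fun N} (h : SinMem φ) (ψ : TestFun N) :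
    HasFDerivAt (fun w : L2 N => ⟪ψ.toL2, sinTwoL2 (φ + (w : Fun N))⟫_ℝ)
      ((innerSL ℝ ψ.toL2).comp ((2 : ℝ) • cosMul φ)) 0 := by
  obtain ⟨C, hC⟩ := ψ.exists_bound
  have hC0 : 0 ≤ C := (norm_nonneg _).trans (hC 0)
  -- The pointwise Taylor remainder is at most `4 w²`, which is only known to be integrable; pairing
  -- it with a bounded `ψ` is what gives a quadratic error.
  refine hasFDerivAt_of_abs_sub_le (C := C * 4) fun w => ?_
  simp only [ContinuousLinearMap.comp_apply, innerSL_apply_apply, sub_zero,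
    ← real_inner_self_eq_norm_sq, smul_apply, inner_smul_right]
  simp only [L2.inner_def]
  rw [← integral_sub (L2.integrable_mul _ _) (L2.integrable_mul _ _), ← integral_const_mul,
    ← integral_sub (L2.integrable_mul_sub_mul _ _ _ _)
      ((L2.integrable_mul _ _).const_mul _),
    ← integral_const_mul, ← Real.norm_eq_abs]
  refine norm_integral_le_of_norm_le ((L2.integrable_mul _ _).const_mul _) ?_
  filter_upwards [(h.add w).coe_sinTwoL2, (h.add 0).coe_sinTwoL2, coe_cosMul φ w,
    coe_add_L2 φ w, coe_add_L2 φ 0, Lp.coeFn_zero ℝ 2 (volume : Measure (Space N)),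
    ψ.coe_toL2] with x h1 h2 h3 h4 h5 h6 h7
  rw [h1, h2, h3, h4, h5, h6, h7, Pi.zero_apply, add_zero, Real.norm_eq_abs]
  have := abs_sin_two_mul_taylor_le (φ x) (w x)
  have h8 := mul_le_mul (hC x) this (abs_nonneg _) hC0
  rw [Real.norm_eq_abs, ← abs_mul] at h8
  refine le_trans (le_of_eq ?_) (h8.trans (le_of_eq ?_))
  · congr 1; ring
  · ring

/-! ### The chain rule through translations -/

/-- The increments of a function with a square integrable weak derivative. -/
theorem HasWeakPartial.translate_ae_eq {i : Fin N} {φ : Fun N} {g : L2 N}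
    (h : HasWeakPartial i φ (g : Fun N)) (s : ℝ) :
    (fun x => φ (x - s • EuclideanSpace.single i 1)) =ᵐ[volume]
      (φ + ((-∫ r in (0 : ℝ)..s, translateL2 (r • EuclideanSpace.single i 1) g : L2 N) : Fun N) :
        Fun N) := by
  set e : Space N := EuclideanSpace.single i 1 with he
  have hτ : Continuous fun r : ℝ => translateL2 (r • e) g :=
    (continuous_translateL2 g).comp (by fun_prop)
  have hloc : LocallyIntegrable (fun x => φ (x - s • e)) volume := by
    have := h.locallyIntegrable
    rw [locallyIntegrable_iff] at this ⊢
    intro K hK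
    have hK' : IsCompact ((fun x => x - s • e) '' K) := hK.image (by fun_prop)
    have h1 := this _ hK'
    have h2 := (measurePreserving_sub_right (volume : Measure (Space N)) (s • e))
    exact (h2.integrableOn_image (Homeomorph.subRight (s • e)).measurableEmbedding).1 h1
  have hloc' : LocallyIntegrable
      (φ + ((-∫ r in (0 : ℝ)..s, translateL2 (r • e) g : L2 N) : Fun N) : Fun N) volume :=
    (h.locallyIntegrable.add (L2.locallyIntegrable _)).congr (coe_add_L2 φ _).symm
  refine ae_eq_of_integral_contDiff_smul_eq hloc hloc' fun ψ' hψ hc => ?_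
  set ψ : TestFun N := ⟨ψ', hψ, hc⟩
  -- With the translation moved onto `ψ`, the pairing with `φ` is a differentiable function of `r`
  -- whose derivative is a pairing with `g`. The fundamental theorem of calculus on `[0, s]` then
  -- yields the increment.
  have hΓ : ∀ r : ℝ, HasDerivAt (fun r : ℝ => ∫ x, ψ (x - r • e) • φ x)
      ⟪translateL2 ((-r) • e) g, ψ.toL2⟫_ℝ r := by
    intro r
    refine (hasDerivAt_integral_translate h.locallyIntegrable i ψ r).congr_deriv ?_
    have h1 := h.integral_pderiv (ψ.translate (r • e))
    rw [neg_smul, inner_translateL2, neg_neg, translateL2_toL2, L2.inner_toL2, ← neg_neg (∫ x, g x * _), ← h1]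
    congr 1
    refine integral_congr_ae (ae_of_all _ fun x => ?_)
    simp only [TestFun.pderiv_translate, smul_eq_mul, mul_comm]
    rfl
  have hΓ' : ∀ r : ℝ, HasDerivAt (fun r : ℝ => ∫ x, ψ (x - (-r) • e) • φ x)
      (-⟪translateL2 (r • e) g, ψ.toL2⟫_ℝ) r := by
    intro r
    have := (hΓ (-r)).scomp r (hasDerivAt_neg r)
    simpa [Function.comp_def] using this
  have hInt := intervalIntegral.integral_eq_sub_of_hasDerivAt (a := 0) (b := s)
    (fun r _ => hΓ' r) (Continuous.intervalIntegrable (by fun_prop) _ _)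
  have h3 : ∫ x, ψ x • φ (x - s • e) = ∫ x, ψ (x - (-s) • e) • φ x := by
    rw [← integral_sub_right_eq_self (fun x => ψ (x - (-s) • e) • φ x) (s • e)]
    simp
  have h4 : ∫ r in (0 : ℝ)..s, -⟪translateL2 (r • e) g, ψ.toL2⟫_ℝ =
      ⟪-∫ r in (0 : ℝ)..s, translateL2 (r • e) g, ψ.toL2⟫_ℝ := by
    have := (innerSL ℝ ψ.toL2).intervalIntegral_comp_comm (hτ.intervalIntegrable (μ := volume) 0 s)
    simp only [innerSL_apply_apply] at this
    rw [inner_neg_left, real_inner_comm, ← this, intervalIntegral.integral_neg]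
    simp only [real_inner_comm]
  have h5 : ∫ x, ψ' x • φ (x - s • e) = ∫ x, ψ x • φ (x - s • e) := rfl
  rw [h5, h3, ← sub_add_cancel (∫ x, ψ (x - (-s) • e) • φ x)
    (∫ x, ψ (x - (-0 : ℝ) • e) • φ x), ← hInt, h4, L2.inner_toL2, add_comm]
  simp only [neg_zero, zero_smul, sub_zero]
  rw [← integral_add]
  · refine integral_congr_ae ?_
    filter_upwards [coe_add_L2 φ (-∫ r in (0 : ℝ)..s, translateL2 (r • e) g)] with x hx
    rw [hx, smul_eq_mul, smul_eq_mul]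
    ring
  · exact h.locallyIntegrable.integrable_smul_left_of_hasCompactSupport hψ.continuous hc
  · simpa only [smul_eq_mul, mul_comm] using
      (L2.locallyIntegrable _).integrable_smul_left_of_hasCompactSupport hψ.continuous hc

/-- The chain rule for `sin (2 φ)`. -/
theorem HasWeakPartial.sinTwoL2 {i : Fin N} {φ : Fun N} {g : L2 N} (hs : SinMem φ)
    (h : HasWeakPartial i φ (g : Fun N)) :
    HasWeakPartial i (sinTwoL2 φ : Fun N) ((2 : ℝ) • cosMul φ g : L2 N) := by
  rw [hasWeakPartial_iff_inner]
  intro ψ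
  set e : Space N := EuclideanSpace.single i 1 with he
  have hτ : Continuous fun r : ℝ => translateL2 (r • e) g :=
    (continuous_translateL2 g).comp (by fun_prop)
  -- The pairing of `ψ` with the translate of `sin 2φ` is differentiated at `0` in two ways: by
  -- translating `ψ`, which produces `∂ᵢψ`, and along this `L²` curve of increments of `φ`, with
  -- velocity `-g`.
  have h1 : HasDerivAt (fun s : ℝ => -∫ r in (0 : ℝ)..s, translateL2 (r • e) g) (-g) 0 := by
    have := (intervalIntegral.integral_hasDerivAt_right (hτ.intervalIntegrable 0 0)
      (hτ.stronglyMeasurableAtFilter _ _) hτ.continuousAt).neg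
    exact this.congr_deriv (by simp [translateL2_zero])
  have h2 := (hasFDerivAt_inner_sinTwoL2 hs ψ).comp_hasDerivAt_of_eq (0 : ℝ) h1 (by simp)
  have h3 : HasDerivAt (fun s : ℝ => ⟪SineGordon.sinTwoL2 φ,
      translateL2 ((-s) • e) ψ.toL2⟫_ℝ) (⟪SineGordon.sinTwoL2 φ, (ψ.pderiv i).toL2⟫_ℝ) 0 := by
    have := (hasDerivAt_inner_translateL2 i (SineGordon.sinTwoL2 φ) ψ).scomp_of_eq (0 : ℝ)
      (hasDerivAt_neg (0 : ℝ)) (by simp)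
    simpa [Function.comp_def] using this
  have h4 : ∀ s : ℝ, translateL2 (s • e) (SineGordon.sinTwoL2 φ) = SineGordon.sinTwoL2
      (φ + ((-∫ r in (0 : ℝ)..s, translateL2 (r • e) g : L2 N) : Fun N)) := by
    intro s
    refine Lp.ext ?_
    filter_upwards [coe_translateL2 (s • e) (SineGordon.sinTwoL2 φ),
      ae_eq_comp_sub hs.coe_sinTwoL2 (s • e), (hs.add _).coe_sinTwoL2,
      h.translate_ae_eq s] with x h5 h6 h7 h8
    rw [h5, h6, h7, ← h8]
  have h5 : (fun s : ℝ => ⟪SineGordon.sinTwoL2 φ, translateL2 ((-s) • e) ψ.toL2⟫_ℝ) =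
      (fun w : L2 N => ⟪ψ.toL2, SineGordon.sinTwoL2 (φ + (w : Fun N))⟫_ℝ) ∘
        fun s : ℝ => -∫ r in (0 : ℝ)..s, translateL2 (r • e) g := by
    funext s
    simp only [Function.comp_apply]
    rw [← h4, real_inner_comm _ ψ.toL2, inner_translateL2, neg_smul]
  rw [h5] at h3
  rw [h3.unique h2, real_inner_comm]
  simp only [ContinuousLinearMap.comp_apply, innerSL_apply_apply, smul_apply, map_neg]

/-! ### Distributions in time and space-time test functions -/

/-- A continuous function on `ℝ` whose distributional derivative vanishes is constant. -/
theorem eq_of_integral_deriv_mul_eq_zero {B : ℝ → ℝ} (hB : Continuous B)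
    (h : ∀ θ : ℝ → ℝ, ContDiff ℝ ∞ θ → HasCompactSupport θ → ∫ t, deriv θ t * B t = 0)
    (s t : ℝ) : B s = B t := by
  let b : ℕ → ContDiffBump (0 : ℝ) := fun n =>
    { rIn := 1 / (2 * (n + 1))
      rOut := 1 / (n + 1)
      rIn_pos := by positivity
      rIn_lt_rOut := by
        apply one_div_lt_one_div_of_lt <;> linarith [Nat.cast_nonneg (α := ℝ) n] }
  have hr : Tendsto (fun n => (b n).rOut) atTop (𝓝 0) := tendsto_one_div_add_atTop_nhds_zero_nat
  -- The derivative at `x` of a mollification of `B` is a pairing with the derivative of the test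
  -- function `t ↦ ρ (x - t)`, up to sign, hence zero; letting `n → ∞` returns to `B`.
  have hconst : ∀ n, convolution ((b n).normed volume) B (ContinuousLinearMap.lsmul ℝ ℝ) volume s =
      convolution ((b n).normed volume) B (ContinuousLinearMap.lsmul ℝ ℝ) volume t := by
    intro n
    have hd : ∀ x, HasDerivAt
        (convolution ((b n).normed volume) B (ContinuousLinearMap.lsmul ℝ ℝ) volume) 0 x := by
      intro x
      refine ((b n).hasCompactSupport_normed.hasDerivAt_convolution_left
        (ContinuousLinearMap.lsmul ℝ ℝ) (b n).contDiff_normed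
        (hB.locallyIntegrable (μ := volume)) x).congr_deriv ?_
      have hθ := h (fun t => (b n).normed volume (x - t))
        ((b n).contDiff_normed.comp (contDiff_const.sub contDiff_id))
        ((b n).hasCompactSupport_normed.comp_homeomorph (Homeomorph.subLeft x))
      rw [convolution_def, ← integral_sub_left_eq_self _ volume x, ← neg_eq_zero, ← integral_neg]
      refine Eq.trans (integral_congr_ae (ae_of_all _ fun y => ?_)) hθ
      simp only [deriv_comp_const_sub, ContinuousLinearMap.lsmul_apply, smul_eq_mul, sub_sub_cancel,
        neg_mul]
    exact is_const_of_deriv_eq_zero (fun x => (hd x).differentiableAt) (fun x => (hd x).deriv) s t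
  refine tendsto_nhds_unique
    (ContDiffBump.convolution_tendsto_right_of_continuous (μ := volume) hr hB s) ?_
  simp only [hconst]
  exact ContDiffBump.convolution_tendsto_right_of_continuous (μ := volume) hr hB t

theorem integral_deriv_mul_eq_neg {θ a b : ℝ → ℝ} (hθ : ContDiff ℝ ∞ θ)
    (hc : HasCompactSupport θ) (ha : ∀ t, HasDerivAt a (b t) t) (hb : Continuous b) :
    ∫ t, deriv θ t * a t = -∫ t, θ t * b t := by
  have hac : Continuous a := continuous_iff_continuousAt.2 fun t => (ha t).continuousAt
  have hθd : ∀ t, HasDerivAt θ (deriv θ t) t := fun t =>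
    ((hθ.differentiable (by simp)) t).hasDerivAt
  have hθ'c : Continuous (deriv θ) := hθ.continuous_deriv (by simp)
  have h1 : Integrable (θ * b) :=
    (hθ.continuous.mul hb).integrable_of_hasCompactSupport hc.mul_right
  have h2 : Integrable (deriv θ * a) :=
    (hθ'c.mul hac).integrable_of_hasCompactSupport hc.deriv.mul_right
  have h3 : Integrable (θ * a) :=
    (hθ.continuous.mul hac).integrable_of_hasCompactSupport hc.mul_right
  rw [integral_mul_deriv_eq_deriv_mul_of_integrable (fun t _ => hθd t) (fun t _ => ha t) h1 h2 h3,
    neg_neg]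

/-- A weak solution of `a'' + c = 0` which is of class `C¹` is a classical solution. -/
theorem hasDerivAt_of_integral_deriv_deriv {a b c : ℝ → ℝ} (ha : ∀ t, HasDerivAt a (b t) t)
    (hb : Continuous b) (hc : Continuous c)
    (h : ∀ θ : ℝ → ℝ, ContDiff ℝ ∞ θ → HasCompactSupport θ →
      ∫ t, (deriv (deriv θ) t * a t + θ t * c t) = 0) (t : ℝ) :
    HasDerivAt b (-c t) t := by
  have hac : Continuous a := continuous_iff_continuousAt.2 fun t => (ha t).continuousAt
  have hC : ∀ t, HasDerivAt (fun t => ∫ s in (0 : ℝ)..t, c s) (c t) t := fun t =>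
    intervalIntegral.integral_hasDerivAt_right (hc.intervalIntegrable _ _)
      (hc.stronglyMeasurableAtFilter _ _) hc.continuousAt
  have hCc : Continuous fun t => ∫ s in (0 : ℝ)..t, c s :=
    continuous_iff_continuousAt.2 fun t => (hC t).continuousAt
  -- The distributional derivative of `b + ∫ c` vanishes: this is the hypothesis after one
  -- integration by parts in each term.
  have hconst := eq_of_integral_deriv_mul_eq_zero (hb.add hCc) (fun θ hθ hθc => by
    have hθ' : ContDiff ℝ ∞ (deriv θ) := (contDiff_infty_iff_deriv.1 hθ).2
    have h1 := integral_deriv_mul_eq_neg hθ' hθc.deriv ha hb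
    have h2 := integral_deriv_mul_eq_neg hθ hθc hC hc
    have h3 := h θ hθ hθc
    rw [integral_add] at h3
    · have h4 : ∫ t, deriv θ t * (b t + ∫ s in (0 : ℝ)..t, c s) =
          (∫ t, deriv θ t * b t) + ∫ t, deriv θ t * ∫ s in (0 : ℝ)..t, c s := by
        simp only [mul_add]
        exact integral_add ((hθ'.continuous.mul hb).integrable_of_hasCompactSupport
          hθc.deriv.mul_right) ((hθ'.continuous.mul hCc).integrable_of_hasCompactSupport
          hθc.deriv.mul_right)
      simp only [Pi.add_apply]
      rw [h4, h2]
      linarith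
    · exact ((hθ'.continuous_deriv (by simp)).mul hac).integrable_of_hasCompactSupport
        hθc.deriv.deriv.mul_right
    · exact (hθ.continuous.mul hc).integrable_of_hasCompactSupport hθc.mul_right)
  have hb' : b = fun t => b 0 - ∫ s in (0 : ℝ)..t, c s := by
    funext t
    have := hconst t 0
    simp only [Pi.add_apply, intervalIntegral.integral_same, add_zero] at this
    linarith
  rw [hb']
  simpa using (hC t).const_sub (b 0)

theorem TestFun.integrable_mul (ψ : TestFun N) {f : Space N → ℝ}
    (hf : LocallyIntegrable f volume) : Integrable (fun x => f x * ψ x) volume := by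
  simpa only [smul_eq_mul, mul_comm] using
    hf.integrable_smul_left_of_hasCompactSupport ψ.continuous ψ.hasCompactSupport

theorem TestFun.laplacian_eq (ψ : TestFun N) (x : Space N) :
    Laplacian.laplacian ψ.toFun x = ∑ i, (ψ.pderiv i).pderiv i x := by
  have h := congrFun (InnerProductSpace.laplacian_eq_iteratedFDeriv_orthonormalBasis ψ.toFun
    (EuclideanSpace.basisFun (Fin N) ℝ)) x
  refine h.trans (Finset.sum_congr rfl fun i _ => ?_)
  have hd : DifferentiableAt ℝ (fderiv ℝ ψ.toFun) x :=
    ((ψ.contDiff.fderiv_right (m := ∞) (by norm_num)).differentiable (by simp)) x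
  rw [iteratedFDeriv_two_apply]
  simp only [TestFun.pderiv, EuclideanSpace.basisFun_apply, Matrix.cons_val_zero,
    Matrix.cons_val_one]
  rw [fderiv_clm_apply hd (differentiableAt_const _)]
  simp

/-- Smooth compactly supported functions on space-time. -/
structure SpaceTimeFun (N : ℕ) where
  toFun : ℝ × Space N → ℝ
  contDiff : ContDiff ℝ ∞ toFun
  hasCompactSupport : HasCompactSupport toFun

namespace SpaceTimeFun

instance : CoeFun (SpaceTimeFun N) fun _ => ℝ × Space N → ℝ := ⟨toFun⟩

/-- A directional derivative of a space-time function. -/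
noncomputable def along (w : ℝ × Space N) (Ψ : SpaceTimeFun N) : SpaceTimeFun N where
  toFun z := fderiv ℝ Ψ z w
  contDiff := (Ψ.contDiff.fderiv_right (m := ∞) (by norm_num)).clm_apply contDiff_const
  hasCompactSupport := Ψ.hasCompactSupport.fderiv_apply ℝ _

/-- The time derivative of a space-time function. -/
noncomputable def dt (Ψ : SpaceTimeFun N) : SpaceTimeFun N := Ψ.along (1, 0)

/-- The restriction of a space-time function to a time slice. -/
noncomputable def slice (Ψ : SpaceTimeFun N) (t : ℝ) : TestFun N where
  toFun x := Ψ (t, x)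
  contDiff := Ψ.contDiff.comp (contDiff_prodMk_right t)
  hasCompactSupport := Ψ.hasCompactSupport.comp_isClosedEmbedding
    (Topology.IsClosedEmbedding.of_continuous_injective_isClosedMap (by fun_prop)
      (fun x y h => congrArg Prod.snd h) (isClosedMap_prodMk_left t))

theorem hasDerivAt_dt (Ψ : SpaceTimeFun N) (t : ℝ) (x : Space N) :
    HasDerivAt (fun s => Ψ (s, x)) (Ψ.dt (t, x)) t := by
  have h1 : HasDerivAt (fun s : ℝ => (s, x)) ((1 : ℝ), (0 : Space N)) t :=
    (hasDerivAt_id t).prodMk (hasDerivAt_const t x)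
  exact ((Ψ.contDiff.differentiable (by simp)) (t, x)).hasFDerivAt.comp_hasDerivAt t h1

theorem iteratedDeriv_two (Ψ : SpaceTimeFun N) (t : ℝ) (x : Space N) :
    iteratedDeriv 2 (fun s => Ψ (s, x)) t = Ψ.dt.dt (t, x) := by
  rw [iteratedDeriv_succ, iteratedDeriv_one, funext fun s => (Ψ.hasDerivAt_dt s x).deriv]
  exact (Ψ.dt.hasDerivAt_dt t x).deriv

theorem slice_pderiv (Ψ : SpaceTimeFun N) (i : Fin N) (t : ℝ) :
    (Ψ.slice t).pderiv i = (Ψ.along (0, EuclideanSpace.single i 1)).slice t := by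
  simp only [TestFun.pderiv, slice, along, TestFun.mk.injEq]
  funext x
  have h1 : HasFDerivAt (fun y : Space N => (t, y)) (ContinuousLinearMap.inr ℝ ℝ (Space N)) x :=
    hasFDerivAt_prodMk_right t x
  have h2 : HasFDerivAt (fun y : Space N => Ψ (t, y)) _ x :=
    ((Ψ.contDiff.differentiable (by simp)) (t, x)).hasFDerivAt.comp x h1
  rw [h2.fderiv]
  simp

theorem exists_bound (Ψ : SpaceTimeFun N) : ∃ C, 0 ≤ C ∧ ∀ z, ‖Ψ z‖ ≤ C := by
  obtain ⟨C, hC⟩ := Ψ.contDiff.continuous.bounded_above_of_compact_support Ψ.hasCompactSupport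
  exact ⟨C, (norm_nonneg _).trans (hC 0), hC⟩

/-- A compact set of space containing the supports of the time slices. -/
def spaceSupport (Ψ : SpaceTimeFun N) : Set (Space N) := Prod.snd '' tsupport Ψ

theorem isCompact_spaceSupport (Ψ : SpaceTimeFun N) : IsCompact Ψ.spaceSupport :=
  IsCompact.image Ψ.hasCompactSupport continuous_snd

theorem eq_zero_of_notMem (Ψ : SpaceTimeFun N) {x : Space N} (hx : x ∉ Ψ.spaceSupport) (t : ℝ) :
    Ψ (t, x) = 0 := by
  by_contra h
  exact hx ⟨(t, x), subset_tsupport _ h, rfl⟩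

/-- The remainder is quadratic uniformly in `x` and carried by one compact set. Such a bound can be
integrated in `L²` as well as against a locally integrable function, which gives the two
differentiation lemmas for time slices. -/
theorem exists_taylor (Ψ : SpaceTimeFun N) : ∃ C, 0 ≤ C ∧ ∀ s t x,
    ‖Ψ (s, x) - Ψ (t, x) - (s - t) * Ψ.dt (t, x)‖ ≤
      C * (s - t) ^ 2 * Ψ.spaceSupport.indicator (fun _ => (1 : ℝ)) x := by
  obtain ⟨C, hC0, hC⟩ := Ψ.dt.dt.exists_bound
  refine ⟨C, hC0, fun s t x => ?_⟩
  by_cases hx : x ∈ Ψ.spaceSupport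
  · rw [Set.indicator_of_mem hx, mul_one]
    have := abs_taylor_le (f := fun s => Ψ (s, x)) (f' := fun s => Ψ.dt (s, x)) (K := C)
      (fun s => Ψ.hasDerivAt_dt s x) (fun a b => by
        have := Convex.norm_image_sub_le_of_norm_hasDerivWithin_le (s := Set.univ)
          (fun y _ => (Ψ.dt.hasDerivAt_dt y x).hasDerivWithinAt) (fun y _ => hC (y, x))
          convex_univ (Set.mem_univ b) (Set.mem_univ a)
        exact this) t (s - t)
    rw [add_sub_cancel, mul_comm (Ψ.dt (t, x))] at this
    exact this
  · have h0 : Ψ.dt (t, x) = 0 := by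
      have h1 := Ψ.hasDerivAt_dt t x
      have h2 : (fun s => Ψ (s, x)) = fun _ => 0 := funext fun s => Ψ.eq_zero_of_notMem hx s
      rw [h2] at h1
      exact h1.unique (hasDerivAt_const t 0)
    rw [Ψ.eq_zero_of_notMem hx, Ψ.eq_zero_of_notMem hx, h0, Set.indicator_of_notMem hx]
    simp

end SpaceTimeFun

theorem hasDerivAt_of_norm_sub_le {E : Type*} [NormedAddCommGroup E] [NormedSpace ℝ E]
    {f : ℝ → E} {f' : E} {C t : ℝ}
    (h : ∀ s, ‖f s - f t - (s - t) • f'‖ ≤ C * (s - t) ^ 2) : HasDerivAt f f' t := by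
  have h1 : HasDerivAt (fun s => f s - f t - (s - t) • f') 0 t := by
    have : HasFDerivAt (fun s => f s - f t - (s - t) • f') (0 : ℝ →L[ℝ] E) t := by
      refine Asymptotics.IsBigO.hasFDerivAt (n := 2) ?_ one_lt_two
      refine Asymptotics.IsBigO.of_bound C (Eventually.of_forall fun s => ?_)
      simpa using h s
    simpa using this.hasDerivAt
  have h2 : HasDerivAt (fun s => f t + (s - t) • f') f' t := by
    simpa using (((hasDerivAt_id t).sub_const t).smul_const f').const_add (f t)
  have h3 := h1.add h2
  rw [zero_add] at h3
  refine h3.congr_of_eventuallyEq (Eventually.of_forall fun s => ?_)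
  simp

theorem SpaceTimeFun.hasDerivAt_toL2_slice (Ψ : SpaceTimeFun N) (t : ℝ) :
    HasDerivAt (fun s => (Ψ.slice s).toL2) (Ψ.dt.slice t).toL2 t := by
  obtain ⟨C, hC0, hC⟩ := Ψ.exists_taylor
  have hK := Ψ.isCompact_spaceSupport
  let χ : L2 N := indicatorConstLp 2 hK.measurableSet hK.measure_lt_top.ne (1 : ℝ)
  refine hasDerivAt_of_norm_sub_le (C := C * ‖χ‖) fun s => ?_
  have : ‖(Ψ.slice s).toL2 - (Ψ.slice t).toL2 - (s - t) • (Ψ.dt.slice t).toL2‖ ≤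
      C * (s - t) ^ 2 * ‖χ‖ := by
    refine Lp.norm_le_mul_norm_of_ae_le_mul ?_
    filter_upwards [coe_sub_L2 ((Ψ.slice s).toL2 - (Ψ.slice t).toL2)
      ((s - t) • (Ψ.dt.slice t).toL2), coe_sub_L2 (Ψ.slice s).toL2 (Ψ.slice t).toL2,
      Lp.coeFn_smul (s - t) (Ψ.dt.slice t).toL2, (Ψ.slice s).coe_toL2, (Ψ.slice t).coe_toL2,
      (Ψ.dt.slice t).coe_toL2, indicatorConstLp_coeFn (p := 2) (hs := hK.measurableSet)
        (hμs := hK.measure_lt_top.ne) (c := (1 : ℝ))] with x h1 h2 h3 h4 h5 h6 h7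
    rw [h1, h2, h3, Pi.smul_apply, h4, h5, h6, h7, smul_eq_mul]
    refine (hC s t x).trans (mul_le_mul_of_nonneg_left (le_abs_self _) (by positivity))
  linarith

theorem SpaceTimeFun.hasDerivAt_integral_slice (Ψ : SpaceTimeFun N) {f : Space N → ℝ}
    (hf : LocallyIntegrable f volume) (t : ℝ) :
    HasDerivAt (fun s => ∫ x, f x * Ψ (s, x)) (∫ x, f x * Ψ.dt (t, x)) t := by
  obtain ⟨C, hC0, hC⟩ := Ψ.exists_taylor
  have hK := Ψ.isCompact_spaceSupport
  have hInt : ∀ (Φ : SpaceTimeFun N) s, Integrable (fun x => f x * Φ (s, x)) volume := by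
    intro Φ s
    exact (Φ.slice s).integrable_mul hf
  have hfK : Integrable (fun x => Ψ.spaceSupport.indicator (fun x => ‖f x‖) x) volume :=
    IntegrableOn.integrable_indicator (hf.integrableOn_isCompact hK).norm hK.measurableSet
  refine hasDerivAt_of_norm_sub_le
    (C := C * ∫ x, Ψ.spaceSupport.indicator (fun x => ‖f x‖) x) fun s => ?_
  have hrw : (∫ x, f x * Ψ (s, x)) - (∫ x, f x * Ψ (t, x)) - (s - t) • ∫ x, f x * Ψ.dt (t, x) =
      ∫ x, f x * (Ψ (s, x) - Ψ (t, x) - (s - t) * Ψ.dt (t, x)) := by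
    have hsub : Integrable (fun x => f x * Ψ (s, x) - f x * Ψ (t, x)) volume :=
      (hInt Ψ s).sub (hInt Ψ t)
    rw [smul_eq_mul, ← integral_const_mul, ← integral_sub (hInt Ψ s) (hInt Ψ t),
      ← integral_sub hsub ((hInt Ψ.dt t).const_mul _)]
    refine integral_congr_ae (ae_of_all _ fun x => ?_)
    ring
  rw [hrw, mul_right_comm, ← integral_const_mul]
  refine norm_integral_le_of_norm_le (hfK.const_mul _) (ae_of_all _ fun x => ?_)
  rw [norm_mul]
  refine (mul_le_mul_of_nonneg_left (hC s t x) (norm_nonneg _)).trans (le_of_eq ?_)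
  by_cases hx : x ∈ Ψ.spaceSupport <;> simp [hx, mul_comm]

theorem hasDerivAt_primitive {E : Type*} [NormedAddCommGroup E] [NormedSpace ℝ E]
    [CompleteSpace E] {f : ℝ → E} (hf : Continuous f) (t : ℝ) :
    HasDerivAt (fun t => ∫ s in (0 : ℝ)..t, f s) (f t) t :=
  intervalIntegral.integral_hasDerivAt_right (hf.intervalIntegrable _ _)
    (hf.stronglyMeasurableAtFilter _ _) hf.continuousAt

theorem eq_of_hasDerivAt_eq {E : Type*} [NormedAddCommGroup E] [NormedSpace ℝ E]
    {f g f' : ℝ → E} (hf : ∀ t, HasDerivAt f (f' t) t) (hg : ∀ t, HasDerivAt g (f' t) t)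
    (h0 : f 0 = g 0) (t : ℝ) : f t = g t := by
  have hd : ∀ s, HasDerivAt (fun s => f s - g s) 0 s := fun s => by
    simpa using (hf s).fun_sub (hg s)
  have := is_const_of_deriv_eq_zero (fun s => (hd s).differentiableAt) (fun s => (hd s).deriv) t 0
  simpa [h0, sub_eq_zero] using this

theorem hasDerivAt_inner_const {v : ℝ → L2 N} {v' : L2 N} {t : ℝ} (h : HasDerivAt v v' t)
    (g : L2 N) : HasDerivAt (fun s => ⟪v s, g⟫_ℝ) ⟪v', g⟫_ℝ t := by
  simpa using h.inner ℝ (hasDerivAt_const t g)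

/-! ### Tested and mollified forms of the wave equation -/

section Wave

variable {v f : ℝ → L2 N} {p : Fin N → ℝ → L2 N}

/-- Integrated in time, the tested equation says that `v t - v 0 - ∫ f` is the weak divergence of `∫
p`. Convolution commutes with the divergence, and the resulting formula is differentiable in `L²`.
-/
theorem hasDerivAt_smear_of_inner (hf : Continuous f) (hp : ∀ i, Continuous (p i))
    (h : ∀ (ψ : TestFun N) t, HasDerivAt (fun s => ⟪v s, ψ.toL2⟫_ℝ)
      (-∑ i, ⟪p i t, (ψ.pderiv i).toL2⟫_ℝ + ⟪f t, ψ.toL2⟫_ℝ) t) (ρ : TestFun N) (t : ℝ) :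
    HasDerivAt (fun s => smear ρ (v s)) (∑ i, smear (ρ.pderiv i) (p i t) + smear ρ (f t)) t := by
  have hInt : ∀ t, smear ρ (v t) = smear ρ (v 0) + (∑ i, smear (ρ.pderiv i)
      (∫ s in (0 : ℝ)..t, p i s) + smear ρ (∫ s in (0 : ℝ)..t, f s)) := by
    intro t
    have := smear_eq_sum_of_inner_eq (r := v t - v 0 - ∫ s in (0 : ℝ)..t, f s)
      (p := fun i => ∫ s in (0 : ℝ)..t, p i s) (fun ψ => by
        have h1 := eq_of_hasDerivAt_eq (h ψ) (g := fun t => ⟪v 0, ψ.toL2⟫_ℝ +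
          (-∑ i, ⟪∫ s in (0 : ℝ)..t, p i s, (ψ.pderiv i).toL2⟫_ℝ +
            ⟪∫ s in (0 : ℝ)..t, f s, ψ.toL2⟫_ℝ)) (fun t => by
              refine HasDerivAt.const_add _ (HasDerivAt.add (HasDerivAt.neg ?_) ?_)
              · exact HasDerivAt.fun_sum fun i _ =>
                  hasDerivAt_inner_const (hasDerivAt_primitive (hp i) t) _
              · exact hasDerivAt_inner_const (hasDerivAt_primitive hf t) _) (by simp) t
        simp only [inner_sub_left, h1]
        ring) ρ
    rw [← this]
    simp only [map_sub]
    abel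
  rw [funext hInt]
  refine HasDerivAt.const_add _ (HasDerivAt.add (HasDerivAt.fun_sum fun i _ => ?_) ?_)
  · exact (smear (ρ.pderiv i)).hasFDerivAt.comp_hasDerivAt t (hasDerivAt_primitive (hp i) t)
  · exact (smear ρ).hasFDerivAt.comp_hasDerivAt t (hasDerivAt_primitive hf t)

theorem hasDerivAt_inner_of_smear (hf : Continuous f) (hp : ∀ i, Continuous (p i))
    (h : ∀ n t, HasDerivAt (fun s => smear (mollifier N n) (v s))
      (∑ i, smear ((mollifier N n).pderiv i) (p i t) + smear (mollifier N n) (f t)) t)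
    (ψ : TestFun N) (t : ℝ) :
    HasDerivAt (fun s => ⟪v s, ψ.toL2⟫_ℝ)
      (-∑ i, ⟪p i t, (ψ.pderiv i).toL2⟫_ℝ + ⟪f t, ψ.toL2⟫_ℝ) t := by
  have hInt : ∀ t, ⟪v t, ψ.toL2⟫_ℝ = ⟪v 0, ψ.toL2⟫_ℝ +
      (-∑ i, ⟪∫ s in (0 : ℝ)..t, p i s, (ψ.pderiv i).toL2⟫_ℝ +
        ⟪∫ s in (0 : ℝ)..t, f s, ψ.toL2⟫_ℝ) := by
    intro t
    have := inner_eq_of_smear_eq_sum (r := v t - v 0 - ∫ s in (0 : ℝ)..t, f s)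
      (p := fun i => ∫ s in (0 : ℝ)..t, p i s) (fun n => by
        have h1 := eq_of_hasDerivAt_eq (h n) (g := fun t => smear (mollifier N n) (v 0) +
          (∑ i, smear ((mollifier N n).pderiv i) (∫ s in (0 : ℝ)..t, p i s) +
            smear (mollifier N n) (∫ s in (0 : ℝ)..t, f s))) (fun t => by
              refine HasDerivAt.const_add _
                (HasDerivAt.add (HasDerivAt.fun_sum fun i _ => ?_) ?_)
              · exact (smear _).hasFDerivAt.comp_hasDerivAt t (hasDerivAt_primitive (hp i) t)
              · exact (smear _).hasFDerivAt.comp_hasDerivAt t (hasDerivAt_primitive hf t))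
          (by simp) t
        simp only [map_sub, h1]
        abel) ψ
    simp only [inner_sub_left] at this
    linarith
  rw [funext hInt]
  refine HasDerivAt.const_add _ (HasDerivAt.add (HasDerivAt.neg ?_) ?_)
  · exact HasDerivAt.fun_sum fun i _ =>
      hasDerivAt_inner_const (hasDerivAt_primitive (hp i) t) _
  · exact hasDerivAt_inner_const (hasDerivAt_primitive hf t) _

end Wave

/-- The inclusion of the first component in the phase space. -/
noncomputable def Phase.source : L2 N →L[ℝ] Phase N :=
  Phase.lift fun o => match o with
    | none => ContinuousLinearMap.id ℝ (L2 N)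
    | some _ => 0

theorem Phase.source_none (f : L2 N) : Phase.source f none = f := rfl

theorem Phase.source_some (f : L2 N) (i : Fin N) : Phase.source f (some i) = 0 := rfl

theorem Phase.norm_source (f : L2 N) : ‖Phase.source f‖ = ‖f‖ := by
  refine (sq_eq_sq₀ (norm_nonneg _) (norm_nonneg _)).1 ?_
  rw [Phase.norm_sq_eq]
  simp [Phase.source_none, Phase.source_some]

theorem Phase.hasDerivAt {U : ℝ → Phase N} {U' : Phase N} {t : ℝ}
    (h : ∀ o, HasDerivAt (fun s => U s o) (U' o) t) : HasDerivAt U U' t :=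
  ((PiLp.continuousLinearEquiv 2 ℝ fun _ : Option (Fin N) => L2 N).symm :
    (Option (Fin N) → L2 N) →L[ℝ] Phase N).hasFDerivAt.comp_hasDerivAt t (hasDerivAt_pi.2 h)

theorem Phase.hasDerivAt_apply {U : ℝ → Phase N} {U' : Phase N} {t : ℝ} (h : HasDerivAt U U' t)
    (o : Option (Fin N)) : HasDerivAt (fun s => U s o) (U' o) t :=
  (Phase.proj o).hasFDerivAt.comp_hasDerivAt t h

theorem Phase.continuous_apply {U : ℝ → Phase N} (h : Continuous U) (o : Option (Fin N)) :
    Continuous fun t => U t o := (Phase.proj o).continuous.comp h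

theorem Phase.continuous {U : ℝ → Phase N} (h : ∀ o, Continuous fun t => U t o) :
    Continuous U :=
  continuous_iff_continuousAt.2 fun t => Phase.tendsto fun o => (h o).tendsto t

theorem solves_iff {U g : ℝ → Phase N} :
    (waveRegularization N).Solves U g ↔
      (∀ n t, HasDerivAt (fun s => smear (mollifier N n) (U s none))
        (∑ i, smear ((mollifier N n).pderiv i) (U t (some i)) +
          smear (mollifier N n) (g t none)) t) ∧
      ∀ i n t, HasDerivAt (fun s => smear (mollifier N n) (U s (some i)))
        (smear ((mollifier N n).pderiv i) (U t none) + smear (mollifier N n) (g t (some i))) t := by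
  constructor
  · intro h
    refine ⟨fun n t => ?_, fun i n t => ?_⟩
    · have := Phase.hasDerivAt_apply (h n t) none
      simpa only [PiLp.add_apply, waveRegularization_M, waveRegularization_A_none] using this
    · have := Phase.hasDerivAt_apply (h n t) (some i)
      simpa only [PiLp.add_apply, waveRegularization_M, waveRegularization_A_some] using this
  · rintro ⟨h0, h1⟩ n t
    refine Phase.hasDerivAt fun o => ?_
    cases o with
    | none =>
      simp only [PiLp.add_apply, waveRegularization_M, waveRegularization_A_none]
      exact h0 n t
    | some i =>
      simp only [PiLp.add_apply, waveRegularization_M, waveRegularization_A_some]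
      exact h1 i n t

/-! ### The first order system and its equivalence with the distributional equation -/

/-- The sine-Gordon equation as a first order system: `φ = φ₀ + u` and `U = (∂ₜφ, ∇φ)`, where
`p₀ = ∇φ₀`. -/
structure IsPhaseSolution (σ : ℝ) (φ₀ : Fun N) (p₀ : Fin N → L2 N) (u : ℝ → L2 N)
    (U : ℝ → Phase N) : Prop where
  continuous : Continuous U
  zero : u 0 = 0
  hasDerivAt : ∀ t, HasDerivAt u (U t none) t
  hasWeakPartial : ∀ t i, HasWeakPartial i (u t : Fun N) (U t (some i) - p₀ i : L2 N)
  solves : (waveRegularization N).Solves U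
    fun t => Phase.source (-(σ / 2) • sinTwoL2 (φ₀ + (u t : Fun N)))

namespace IsPhaseSolution

variable {σ : ℝ} {φ₀ : Fun N} {p₀ : Fin N → L2 N} {u : ℝ → L2 N} {U : ℝ → Phase N}

theorem continuous_u (h : IsPhaseSolution σ φ₀ p₀ u U) : Continuous u :=
  continuous_iff_continuousAt.2 fun t => (h.hasDerivAt t).continuousAt

theorem hasWeakPartial_add (h : IsPhaseSolution σ φ₀ p₀ u U)
    (h₀ : ∀ i, HasWeakPartial i φ₀ (p₀ i : Fun N)) (t : ℝ) (i : Fin N) :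
    HasWeakPartial i (φ₀ + (u t : Fun N)) (U t (some i) : Fun N) := by
  have := (h₀ i).add (h.hasWeakPartial t i)
  rwa [← AddSubgroup.coe_add, add_sub_cancel] at this

theorem continuous_force (h : IsPhaseSolution σ φ₀ p₀ u U) (hs : SinMem φ₀) :
    Continuous fun t => -(σ / 2) • sinTwoL2 (φ₀ + (u t : Fun N)) := by
  have := (continuous_sinTwoL2 hs).comp h.continuous_u
  exact this.const_smul (-(σ / 2))

theorem hasDerivAt_smear_none (h : IsPhaseSolution σ φ₀ p₀ u U) (n : ℕ) (t : ℝ) :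
    HasDerivAt (fun s => smear (mollifier N n) (U s none))
      (∑ i, smear ((mollifier N n).pderiv i) (U t (some i)) +
        smear (mollifier N n) (-(σ / 2) • sinTwoL2 (φ₀ + (u t : Fun N)))) t :=
  (solves_iff.1 h.solves).1 n t

theorem hasDerivAt_inner_none (h : IsPhaseSolution σ φ₀ p₀ u U) (hs : SinMem φ₀)
    (ψ : TestFun N) (t : ℝ) :
    HasDerivAt (fun s => ⟪U s none, ψ.toL2⟫_ℝ) (-∑ i, ⟪U t (some i), (ψ.pderiv i).toL2⟫_ℝ +
      ⟪-(σ / 2) • sinTwoL2 (φ₀ + (u t : Fun N)), ψ.toL2⟫_ℝ) t :=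
  hasDerivAt_inner_of_smear (p := fun i t => U t (some i)) (h.continuous_force hs)
    (fun _ => Phase.continuous_apply h.continuous _) h.hasDerivAt_smear_none ψ t

end IsPhaseSolution

/-- Only the first component is an equation to be tested. The others say that `∂ᵢ` commutes with
time differentiation, which follows from `hw` and `hu` after mollification. -/
theorem isPhaseSolution_of_inner {σ : ℝ} {φ₀ : Fun N} {p₀ : Fin N → L2 N} {u : ℝ → L2 N}
    {U : ℝ → Phase N} (hs : SinMem φ₀) (hU : Continuous U) (h0 : u 0 = 0)
    (hu : ∀ t, HasDerivAt u (U t none) t)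
    (hw : ∀ t i, HasWeakPartial i (u t : Fun N) (U t (some i) - p₀ i : L2 N))
    (h : ∀ (ψ : TestFun N) t, HasDerivAt (fun s => ⟪U s none, ψ.toL2⟫_ℝ)
      (-∑ i, ⟪U t (some i), (ψ.pderiv i).toL2⟫_ℝ +
        ⟪-(σ / 2) • sinTwoL2 (φ₀ + (u t : Fun N)), ψ.toL2⟫_ℝ) t) :
    IsPhaseSolution σ φ₀ p₀ u U := by
  have huc : Continuous u := continuous_iff_continuousAt.2 fun t => (hu t).continuousAt
  refine ⟨hU, h0, hu, hw, solves_iff.2 ⟨fun n t => ?_, fun i n t => ?_⟩⟩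
  · exact hasDerivAt_smear_of_inner (p := fun i t => U t (some i))
      (((continuous_sinTwoL2 hs).comp huc).const_smul _)
      (fun i => Phase.continuous_apply hU _) h (mollifier N n) t
  · have h1 : ∀ s, smear (mollifier N n) (U s (some i)) =
        smear (mollifier N n) (p₀ i) + smear ((mollifier N n).pderiv i) (u s) := by
      intro s
      rw [← (hw s i).smear_eq, map_sub]
      abel
    have h2 := ((smear ((mollifier N n).pderiv i)).hasFDerivAt.comp_hasDerivAt t (hu t)).const_add
      (smear (mollifier N n) (p₀ i))
    refine (h2.congr_of_eventuallyEq (Eventually.of_forall h1)).congr_deriv ?_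
    rw [Phase.source_some, map_zero, add_zero]

theorem exists_isPhaseSolution (σ : ℝ) {φ₀ : Fun N} (hs : SinMem φ₀) (p₀ : Fin N → L2 N)
    (φ₁ : L2 N) : ∃ u U, IsPhaseSolution σ φ₀ p₀ u U ∧ U 0 none = φ₁ := by
  let x : Phase N := WithLp.toLp 2 fun o => match o with
    | none => φ₁
    | some i => p₀ i
  obtain ⟨U, u, hU, hx, h0, hu, hsol⟩ := (waveRegularization N).exists_solves_semilinear
    (Phase.proj none) (F := fun u => Phase.source (-(σ / 2) • sinTwoL2 (φ₀ + (u : Fun N))))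
    -- The factor `|σ| / 2` of the force times the Lipschitz constant `2` of `sin (2 ·)`.
    (K := |σ|) (abs_nonneg σ) (fun u w => by
      rw [← map_sub, Phase.norm_source, ← smul_sub, norm_smul, norm_neg, norm_div,
        Real.norm_eq_abs, Real.norm_of_nonneg zero_le_two]
      have h1 := mul_le_mul_of_nonneg_left (norm_sinTwoL2_add_sub_le hs u w)
        (by positivity : 0 ≤ |σ| / 2)
      linarith) x
  refine ⟨u, U, ⟨hU, h0, hu, fun t i => hasWeakPartial_of_smear_eq fun n => ?_, hsol⟩, ?_⟩
  -- The constraint `U (some i) - p₀ i = ∂ᵢu` propagates: once mollified, both sides vanish at time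
  -- `0` and have the same time derivative.
  · have h1 : ∀ t, HasDerivAt (fun s => smear (mollifier N n) (U s (some i) - p₀ i))
        (smear ((mollifier N n).pderiv i) (U t none)) t := by
      intro t
      have h2 := (solves_iff.1 hsol).2 i n t
      rw [Phase.source_some, map_zero, add_zero] at h2
      simpa only [map_sub] using h2.sub_const (smear (mollifier N n) (p₀ i))
    refine eq_of_hasDerivAt_eq h1 (fun t =>
      (smear ((mollifier N n).pderiv i)).hasFDerivAt.comp_hasDerivAt t (hu t)) ?_ t
    have h3 : U 0 (some i) = p₀ i := by rw [hx]
    simp [h0, h3]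
  · rw [hx]

theorem TestFun.toL2_eq_smul {ξ ψ : TestFun N} {c : ℝ} (h : ∀ x, ξ x = c * ψ x) :
    ξ.toL2 = c • ψ.toL2 := by
  refine Lp.ext ?_
  filter_upwards [ξ.coe_toL2, ψ.coe_toL2, Lp.coeFn_smul c ψ.toL2] with x h1 h2 h3
  rw [h1, h3, Pi.smul_apply, h2, h x, smul_eq_mul]

theorem integral_add_mul {φ₀ : Fun N} (hloc : LocallyIntegrable φ₀ volume) (u : L2 N)
    (ψ : TestFun N) :
    ∫ x, (φ₀ + (u : Fun N) : Fun N) x * ψ x = (∫ x, φ₀ x * ψ x) + ⟪u, ψ.toL2⟫_ℝ := by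
  rw [L2.inner_toL2, ← integral_add (ψ.integrable_mul hloc)
    (ψ.integrable_mul (L2.locallyIntegrable u))]
  refine integral_congr_ae ?_
  filter_upwards [coe_add_L2 φ₀ u] with x hx
  rw [hx, add_mul]

/-- The weak form of the sine-Gordon operator in a time slice. -/
theorem integral_slice_eq {σ : ℝ} {φ : Fun N} {p : Fin N → L2 N}
    (hloc : LocallyIntegrable φ volume) (hs : SinMem φ)
    (hp : ∀ i, HasWeakPartial i φ (p i : Fun N)) (η ξ : TestFun N) :
    ∫ x, (φ x * (η x - Laplacian.laplacian ξ.toFun x) + σ / 2 * Real.sin (2 * φ x) * ξ x) =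
      (∫ x, φ x * η x) + ∑ i, ⟪p i, (ξ.pderiv i).toL2⟫_ℝ +
        ⟪(σ / 2) • sinTwoL2 φ, ξ.toL2⟫_ℝ := by
  have h1 : ∀ i, ⟪p i, (ξ.pderiv i).toL2⟫_ℝ = ∫ x, -(φ x * (ξ.pderiv i).pderiv i x) := by
    intro i
    rw [L2.inner_toL2, integral_neg, (hp i).integral_pderiv, neg_neg]
  have h2 : ⟪(σ / 2) • sinTwoL2 φ, ξ.toL2⟫_ℝ = ∫ x, σ / 2 * (sinTwoL2 φ x * ξ x) := by
    rw [real_inner_smul_left, L2.inner_toL2, integral_const_mul]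
  have hi : ∀ i ∈ Finset.univ, Integrable (fun x => -(φ x * (ξ.pderiv i).pderiv i x)) volume :=
    fun i _ => (((ξ.pderiv i).pderiv i).integrable_mul hloc).neg
  have hη : Integrable (fun x => φ x * η x) volume := η.integrable_mul hloc
  have hf : Integrable (fun x => σ / 2 * (sinTwoL2 φ x * ξ x)) volume :=
    (ξ.integrable_mul (L2.locallyIntegrable _)).const_mul _
  have hsum : Integrable (fun x => φ x * η x + ∑ i, -(φ x * (ξ.pderiv i).pderiv i x)) volume :=
    hη.add (integrable_finsetSum _ hi)
  simp only [h1]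
  rw [h2, ← integral_finsetSum _ hi, ← integral_add hη (integrable_finsetSum _ hi),
    ← integral_add hsum hf]
  refine integral_congr_ae ?_
  filter_upwards [hs.coe_sinTwoL2] with x hx
  rw [hx, ξ.laplacian_eq, Finset.sum_neg_distrib, ← Finset.mul_sum]
  ring

/-- Product test functions `θ(t) ψ(x)` suffice. They turn the equation into `a'' + c = 0` in the
sense of distributions for the pairing `a` of `φ` with `ψ`, which is `C¹`; hence `a'` is
differentiable in the classical sense. -/
theorem IsSolution.exists_isPhaseSolution {σ : ℝ} {φ₀ : Fun N} {φ₁ : L2 N} {φ : ℝ → Fun N}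
    {v : ℝ → L2 N} {p₀ : Fin N → L2 N} (hloc : LocallyIntegrable φ₀ volume) (hs : SinMem φ₀)
    (h₀ : ∀ i, HasWeakPartial i φ₀ (p₀ i : Fun N)) (h : IsSolution σ φ₀ φ₁ φ v) :
    ∃ u U, IsPhaseSolution σ φ₀ p₀ u U ∧ (∀ t, φ t = φ₀ + (u t : Fun N)) ∧
      ∀ t, U t none = v t := by
  obtain ⟨u, hφ, huc, hg⟩ := h.continuous
  obtain ⟨w, hφw, hw⟩ := h.hasTimeDeriv
  -- The increments that carry the time derivative and those that carry the Sobolev continuity are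
  -- the same, since `φ 0 = φ₀`.
  have hwu : w = u := by
    funext t
    have := hφ t
    rw [hφw t, h.init] at this
    exact Subtype.ext (add_left_cancel this)
  subst hwu
  choose g hgw hgc using hg
  have hw0 : w 0 = 0 := by
    have := hφ 0
    rw [h.init] at this
    exact Subtype.ext (left_eq_add.1 this)
  let U : ℝ → Phase N := fun t => WithLp.toLp 2 fun o => match o with
    | none => v t
    | some i => p₀ i + g i t
  have hUn : ∀ t, U t none = v t := fun t => rfl
  have hUs : ∀ t i, U t (some i) = p₀ i + g i t := fun t i => rfl
  have hUc : Continuous U := Phase.continuous fun o => by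
    cases o with
    | none => exact h.continuous_deriv
    | some i => exact continuous_const.add (hgc i)
  have hweak : ∀ t i, HasWeakPartial i (w t : Fun N) (U t (some i) - p₀ i : L2 N) := by
    intro t i
    rw [hUs, add_sub_cancel_left]
    exact hgw i t
  have hweak' : ∀ t i, HasWeakPartial i (φ t) (U t (some i) : Fun N) := by
    intro t i
    have := (h₀ i).add (hgw i t)
    rw [← AddSubgroup.coe_add, ← hUs, ← hφ] at this
    exact this
  have hsm : ∀ t, SinMem (φ t) := fun t => by rw [hφ]; exact hs.add _
  have hlocφ : ∀ t, LocallyIntegrable (φ t) volume := fun t => by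
    rw [hφ]
    exact (hloc.add (L2.locallyIntegrable (w t))).congr (coe_add_L2 φ₀ (w t)).symm
  have hfc : Continuous fun t => sinTwoL2 (φ t) := by
    have := (continuous_sinTwoL2 hs).comp huc
    refine this.congr fun t => ?_
    rw [hφ]; rfl
  refine ⟨w, U, isPhaseSolution_of_inner hs hUc hw0 (fun t => hw t) hweak fun ψ t => ?_, hφ, hUn⟩
  have key := hasDerivAt_of_integral_deriv_deriv
    (a := fun t => (∫ x, φ₀ x * ψ x) + ⟪w t, ψ.toL2⟫_ℝ)
    (b := fun t => ⟪v t, ψ.toL2⟫_ℝ)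
    (c := fun t => ∑ i, ⟪U t (some i), (ψ.pderiv i).toL2⟫_ℝ +
      ⟪(σ / 2) • sinTwoL2 (φ t), ψ.toL2⟫_ℝ)
    (fun t => (hasDerivAt_inner_const (hw t) ψ.toL2).const_add _)
    (h.continuous_deriv.inner continuous_const)
    (by
      refine Continuous.add (continuous_finsetSum _ fun i _ =>
        (Phase.continuous_apply hUc _).inner continuous_const) ?_
      exact (hfc.const_smul (σ / 2)).inner continuous_const)
    (fun θ hθ hθc => by
      let Ψ : SpaceTimeFun N :=
        { toFun := fun z => θ z.1 * ψ z.2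
          contDiff := (hθ.comp contDiff_fst).mul (ψ.contDiff.comp contDiff_snd)
          hasCompactSupport := by
            refine HasCompactSupport.of_support_subset_isCompact
              (hθc.isCompact.prod ψ.hasCompactSupport.isCompact) fun z hz => ?_
            exact ⟨subset_tsupport _ (left_ne_zero_of_mul hz),
              subset_tsupport _ (right_ne_zero_of_mul hz)⟩ }
      have hΨ : ∀ t x, Ψ (t, x) = θ t * ψ x := fun t x => rfl
      have hθd : Differentiable ℝ θ := hθ.differentiable (by simp)
      have hθ' : ContDiff ℝ ∞ (deriv θ) := (contDiff_infty_iff_deriv.1 hθ).2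
      have hdt : ∀ t x, Ψ.dt (t, x) = deriv θ t * ψ x := fun t x =>
        (Ψ.hasDerivAt_dt t x).unique ((hθd t).hasDerivAt.mul_const (ψ x))
      have hdtt : ∀ t x, Ψ.dt.dt (t, x) = deriv (deriv θ) t * ψ x := by
        intro t x
        have h1 := Ψ.dt.hasDerivAt_dt t x
        simp only [hdt] at h1
        exact h1.unique ((hθ'.differentiable (by simp) t).hasDerivAt.mul_const (ψ x))
      refine Eq.trans (integral_congr_ae (ae_of_all _ fun t => ?_))
        (h.solves Ψ Ψ.contDiff Ψ.hasCompactSupport)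
      have h2 := integral_slice_eq (σ := σ) (hlocφ t) (hsm t) (hweak' t) (Ψ.dt.dt.slice t)
        (Ψ.slice t)
      have h3 : ∫ x, φ t x * Ψ.dt.dt.slice t x =
          deriv (deriv θ) t * ((∫ x, φ₀ x * ψ x) + ⟪w t, ψ.toL2⟫_ℝ) := by
        rw [← integral_add_mul hloc, ← hφ, ← integral_const_mul]
        refine integral_congr_ae (ae_of_all _ fun x => ?_)
        change φ t x * Ψ.dt.dt (t, x) = _
        rw [hdtt]; ring
      have h4 : (Ψ.slice t).toL2 = θ t • ψ.toL2 := TestFun.toL2_eq_smul fun x => rfl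
      have h5 : ∀ i, ((Ψ.slice t).pderiv i).toL2 = θ t • (ψ.pderiv i).toL2 := fun i =>
        TestFun.toL2_eq_smul fun x => by
          have : (Ψ.slice t).toFun = fun y => θ t * ψ y := rfl
          simp only [TestFun.pderiv, this]
          rw [fderiv_const_mul (ψ.contDiff.differentiable (by simp) x)]
          simp
      simp only [h3, h4, h5, inner_smul_right, ← Finset.mul_sum] at h2
      simp only [Ψ.iteratedDeriv_two]
      rw [mul_add (θ t), ← add_assoc]
      exact h2.symm) t
  refine key.congr_deriv ?_
  rw [← hφ, neg_add, neg_smul, inner_neg_left]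

/-- The space integral `I t` is the derivative of `J t`, the pairing of `φ` with `∂ₜΨ` minus that of
`∂ₜφ` with `Ψ`. As `J` has compact support in time, `I` integrates to zero. -/
theorem IsPhaseSolution.solvesSineGordon {σ : ℝ} {φ₀ : Fun N} {p₀ : Fin N → L2 N}
    {u : ℝ → L2 N} {U : ℝ → Phase N} (h : IsPhaseSolution σ φ₀ p₀ u U)
    (hloc : LocallyIntegrable φ₀ volume) (hs : SinMem φ₀)
    (h₀ : ∀ i, HasWeakPartial i φ₀ (p₀ i : Fun N)) :
    SolvesSineGordon σ fun t => φ₀ + (u t : Fun N) := by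
  intro Ψ' hΨ hc
  set Ψ : SpaceTimeFun N := ⟨Ψ', hΨ, hc⟩ with hΨdef
  have hlocφ : ∀ t, LocallyIntegrable (φ₀ + (u t : Fun N) : Fun N) volume := fun t =>
    (hloc.add (L2.locallyIntegrable (u t))).congr (coe_add_L2 φ₀ (u t)).symm
  have hsl : ∀ Φ : SpaceTimeFun N, Continuous fun t => (Φ.slice t).toL2 := fun Φ =>
    continuous_iff_continuousAt.2 fun t => (Φ.hasDerivAt_toL2_slice t).continuousAt
  have hsi : ∀ Φ : SpaceTimeFun N, Continuous fun t => ∫ x, φ₀ x * Φ (t, x) := fun Φ =>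
    continuous_iff_continuousAt.2 fun t => (Φ.hasDerivAt_integral_slice hloc t).continuousAt
  set I : ℝ → ℝ := fun t => ((∫ x, φ₀ x * Ψ.dt.dt (t, x)) + ⟪u t, (Ψ.dt.dt.slice t).toL2⟫_ℝ) +
    ∑ i, ⟪U t (some i), ((Ψ.along (0, EuclideanSpace.single i 1)).slice t).toL2⟫_ℝ +
    ⟪(σ / 2) • sinTwoL2 (φ₀ + (u t : Fun N)), (Ψ.slice t).toL2⟫_ℝ with hI
  have hInt : ∀ t, ∫ x, ((φ₀ + (u t : Fun N) : Fun N) x * (iteratedDeriv 2 (fun s => Ψ' (s, x)) t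
      - Laplacian.laplacian (fun y => Ψ' (t, y)) x)
      + σ / 2 * Real.sin (2 * (φ₀ + (u t : Fun N) : Fun N) x) * Ψ' (t, x)) = I t := by
    intro t
    have h1 := integral_slice_eq (σ := σ) (hlocφ t) (hs.add (u t)) (h.hasWeakPartial_add h₀ t)
      (Ψ.dt.dt.slice t) (Ψ.slice t)
    have h2 := integral_add_mul hloc (u t) (Ψ.dt.dt.slice t)
    rw [h2] at h1
    simp only [Ψ.slice_pderiv] at h1
    have h3 : ∀ x, iteratedDeriv 2 (fun s => Ψ' (s, x)) t = Ψ.dt.dt (t, x) := fun x =>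
      Ψ.iteratedDeriv_two t x
    simp only [h3]
    exact h1
  have hIc : Continuous I := by
    refine ((Continuous.add (hsi _) (h.continuous_u.inner (hsl _))).add
      (continuous_finsetSum _ fun i _ =>
        (Phase.continuous_apply h.continuous _).inner (hsl _))).add ?_
    have := (continuous_sinTwoL2 hs).comp h.continuous_u
    exact (this.const_smul (σ / 2)).inner (hsl Ψ)
  set J : ℝ → ℝ := fun t => (∫ x, φ₀ x * Ψ.dt (t, x)) + ⟪u t, (Ψ.dt.slice t).toL2⟫_ℝ -
    ⟪U t none, (Ψ.slice t).toL2⟫_ℝ with hJ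
  have hJd : ∀ t, HasDerivAt J (I t) t := by
    intro t
    have h1 := (Ψ.dt.hasDerivAt_integral_slice hloc t).add
      ((h.hasDerivAt t).inner ℝ (Ψ.dt.hasDerivAt_toL2_slice t))
    -- `∂ₜφ` is differentiable only against a fixed test function. The product rule therefore
    -- freezes `Ψ` at time `t`, and the increment of `Ψ` needs only continuity of `∂ₜφ`.
    have h2 : HasDerivAt (fun s => ⟪U s none, (Ψ.slice s).toL2 - (Ψ.slice t).toL2⟫_ℝ)
        ⟪U t none, (Ψ.dt.slice t).toL2⟫_ℝ t := by
      rw [hasDerivAt_iff_tendsto_slope]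
      have h3 : Tendsto (fun s => ⟪U s none, slope (fun s => (Ψ.slice s).toL2) t s⟫_ℝ) (𝓝[≠] t)
          (𝓝 ⟪U t none, (Ψ.dt.slice t).toL2⟫_ℝ) :=
        (((Phase.continuous_apply h.continuous none).tendsto t).mono_left
          nhdsWithin_le_nhds).inner (hasDerivAt_iff_tendsto_slope.1 (Ψ.hasDerivAt_toL2_slice t))
      refine h3.congr fun s => ?_
      rw [slope_def_module, slope_def_module, inner_smul_right, sub_self, inner_zero_right,
        sub_zero, smul_eq_mul]
    have h4 := h2.add (h.hasDerivAt_inner_none hs (Ψ.slice t) t)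
    have h5 := h1.sub h4
    refine (h5.congr_deriv ?_).congr_of_eventuallyEq (Eventually.of_forall fun s => ?_)
    · simp only [hI, Ψ.slice_pderiv, neg_smul, inner_neg_left]
      ring
    · simp only [hJ, Pi.add_apply, Pi.sub_apply, inner_sub_right]
      ring
  have hK : IsCompact (Prod.fst '' tsupport Ψ.toFun) :=
    IsCompact.image Ψ.hasCompactSupport continuous_fst
  have hzero : ∀ t, t ∉ Prod.fst '' tsupport Ψ.toFun → J t = 0 := by
    intro t ht
    have h1 : ∀ x, (t, x) ∉ tsupport Ψ.toFun := fun x hx => ht ⟨(t, x), hx, rfl⟩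
    have h2 : ∀ x, Ψ (t, x) = 0 := fun x => image_eq_zero_of_notMem_tsupport (h1 x)
    have h3 : ∀ x, Ψ.dt (t, x) = 0 := fun x => by
      have : fderiv ℝ Ψ.toFun (t, x) = 0 :=
        image_eq_zero_of_notMem_tsupport fun hx => h1 x (tsupport_fderiv_subset ℝ hx)
      simp [SpaceTimeFun.dt, SpaceTimeFun.along, this]
    have h4 : (Ψ.slice t).toL2 = 0 := by
      rw [TestFun.toL2_eq_smul (ψ := Ψ.slice t) (c := 0) fun x => by rw [zero_mul]; exact h2 x,
        zero_smul]
    have h5 : (Ψ.dt.slice t).toL2 = 0 := by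
      rw [TestFun.toL2_eq_smul (ψ := Ψ.dt.slice t) (c := 0) fun x => by
        rw [zero_mul]; exact h3 x, zero_smul]
    simp [hJ, h3, h4, h5]
  have hJs : HasCompactSupport J := HasCompactSupport.intro hK hzero
  have hJc : Continuous J := continuous_iff_continuousAt.2 fun t => (hJd t).continuousAt
  have hId : deriv J = I := funext fun t => (hJd t).deriv
  simp only [hInt]
  exact integral_eq_zero_of_hasDerivAt_of_integrable hJd
    (hIc.integrable_of_hasCompactSupport (hId ▸ hJs.deriv))
    (hJc.integrable_of_hasCompactSupport hJs)

theorem IsPhaseSolution.isSolution {σ : ℝ} {φ₀ : Fun N} {p₀ : Fin N → L2 N}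
    {u : ℝ → L2 N} {U : ℝ → Phase N} (h : IsPhaseSolution σ φ₀ p₀ u U)
    (hloc : LocallyIntegrable φ₀ volume) (hs : SinMem φ₀)
    (h₀ : ∀ i, HasWeakPartial i φ₀ (p₀ i : Fun N)) :
    IsSolution σ φ₀ (U 0 none) (fun t => φ₀ + (u t : Fun N)) (fun t => U t none) where
  continuous := ⟨u, fun _ => rfl, h.continuous_u, fun i => ⟨fun t => U t (some i) - p₀ i,
    fun t => h.hasWeakPartial t i, (Phase.continuous_apply h.continuous _).sub continuous_const⟩⟩
  hasTimeDeriv := ⟨u, fun t => by simp [h.zero], h.hasDerivAt⟩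
  continuous_deriv := Phase.continuous_apply h.continuous _
  solves := h.solvesSineGordon hloc hs h₀
  init := by simp [h.zero]
  init_deriv := rfl

/-! ### Energy estimates, uniqueness and conservation -/

theorem le_mul_exp_of_abs_deriv_le {E E' : ℝ → ℝ} {C : ℝ} (hE : ∀ t, HasDerivAt E (E' t) t)
    (hC : ∀ t, |E' t| ≤ C * E t) (t : ℝ) : E t ≤ E 0 * Real.exp (C * |t|) := by
  have hexp : ∀ c s : ℝ, HasDerivAt (fun s => E s * Real.exp (c * s))
      ((E' s + c * E s) * Real.exp (c * s)) s := by
    intro c s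
    have h1 : HasDerivAt (fun s : ℝ => c * s) c s := by simpa using (hasDerivAt_id s).const_mul c
    refine ((hE s).mul h1.exp).congr_deriv ?_
    ring
  rcases le_total 0 t with ht | ht
  · have hmono : Antitone fun s => E s * Real.exp (-C * s) :=
      antitone_of_hasDerivAt_nonpos (hexp (-C)) fun s => by
        have := (abs_le.1 (hC s)).2
        exact mul_nonpos_of_nonpos_of_nonneg (by linarith) (Real.exp_pos _).le
    have h1 := hmono ht
    simp only [mul_zero, Real.exp_zero, mul_one] at h1
    rw [abs_of_nonneg ht]
    have h2 := mul_le_mul_of_nonneg_right h1 (Real.exp_pos (C * t)).le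
    rwa [mul_assoc, ← Real.exp_add, neg_mul, neg_add_cancel, Real.exp_zero, mul_one] at h2
  · have hmono : Monotone fun s => E s * Real.exp (C * s) :=
      monotone_of_hasDerivAt_nonneg (hexp C) fun s => by
        have := (abs_le.1 (hC s)).1
        exact mul_nonneg (by linarith) (Real.exp_pos _).le
    have h1 := hmono ht
    simp only [mul_zero, Real.exp_zero, mul_one] at h1
    rw [abs_of_nonpos ht]
    have h2 := mul_le_mul_of_nonneg_right h1 (Real.exp_pos (-(C * t))).le
    rwa [mul_assoc, ← Real.exp_add, add_neg_cancel, Real.exp_zero, mul_one, ← mul_neg] at h2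

theorem Phase.inner_source (U : Phase N) (f : L2 N) : ⟪U, Phase.source f⟫_ℝ = ⟪U none, f⟫_ℝ := by
  rw [Phase.inner_eq]
  simp [Phase.source_none, Phase.source_some]

section Energy

variable {σ : ℝ} {φ : Fun N} {p : Fin N → L2 N}

theorem integrable_energyDensity (hs : SinMem φ) (hp : ∀ i, HasWeakPartial i φ (p i : Fun N))
    (v : L2 N) : Integrable (energyDensity σ φ v) volume ∧
      ∫ x, energyDensity σ φ v x = ‖v‖ ^ 2 + ∑ i, ‖p i‖ ^ 2 + σ * ‖sinL2 φ‖ ^ 2 := by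
  have hae : energyDensity σ φ v =ᵐ[volume]
      fun x => v x * v x + ∑ i, p i x * p i x + σ * (sinL2 φ x * sinL2 φ x) := by
    filter_upwards [hs.coe_sinL2] with x hx
    simp only [energyDensity, (hp _).weakPartial_eq, hx, sq]
  have hi : ∀ i ∈ Finset.univ, Integrable (fun x => p i x * p i x) volume := fun i _ =>
    L2.integrable_mul _ _
  have hsum : Integrable (fun x => v x * v x + ∑ i, p i x * p i x) volume :=
    (L2.integrable_mul v v).add (integrable_finsetSum _ hi)
  have hsin : Integrable (fun x => σ * (sinL2 φ x * sinL2 φ x)) volume :=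
    (L2.integrable_mul _ _).const_mul σ
  refine ⟨(integrable_congr hae).2 (hsum.add hsin), ?_⟩
  rw [integral_congr_ae hae, integral_add hsum hsin,
    integral_add (L2.integrable_mul v v) (integrable_finsetSum _ hi), integral_finsetSum _ hi,
    integral_const_mul]
  simp only [← real_inner_self_eq_norm_sq, L2.inner_def]

theorem dsin_eq {φ' : Fun N} {p' : Fin N → L2 N} (hs : SinMem φ) (hs' : SinMem φ')
    (hp : ∀ i, HasWeakPartial i φ (p i : Fun N)) (hp' : ∀ i, HasWeakPartial i φ' (p' i : Fun N)) :
    dsin φ φ' = Real.sqrt (‖sinL2 (φ - φ')‖ ^ 2 + ∑ i, ‖p i - p' i‖ ^ 2) := by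
  have h1 : eLpNorm (fun x => Real.sin (φ x - φ' x)) 2 volume =
      eLpNorm (sinL2 (φ - φ')) 2 volume := by
    refine eLpNorm_congr_ae ?_
    filter_upwards [(hs.sub hs').coe_sinL2, AEEqFun.coeFn_sub φ φ'] with x h1 h2
    rw [h1, h2, Pi.sub_apply]
  have h2 : ∀ i, eLpNorm (fun x => weakPartial i φ x - weakPartial i φ' x) 2 volume =
      eLpNorm (p i - p' i : L2 N) 2 volume := by
    intro i
    refine eLpNorm_congr_ae ?_
    filter_upwards [coe_sub_L2 (p i) (p' i)] with x hx
    rw [hx, (hp i).weakPartial_eq, (hp' i).weakPartial_eq]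
  simp only [dsin, h1, h2, Lp.norm_def]

end Energy

/-- The work of the force, `2 ⟪∂ₜφ, -(σ/2) sin 2φ⟫`, is exactly compensated by the derivative `σ
⟪sin 2φ, ∂ₜφ⟫` of the potential term. -/
theorem IsPhaseSolution.hasDerivAt_energy {σ : ℝ} {φ₀ : Fun N} {p₀ : Fin N → L2 N}
    {u : ℝ → L2 N} {U : ℝ → Phase N} (h : IsPhaseSolution σ φ₀ p₀ u U) (hs : SinMem φ₀) (t : ℝ) :
    HasDerivAt (fun t => ‖U t‖ ^ 2 + σ * ‖sinL2 (φ₀ + (u t : Fun N))‖ ^ 2) 0 t := by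
  have h1 := h.solves.hasDerivAt_norm_sq h.continuous
    (Phase.source.continuous.comp (h.continuous_force hs)) t
  have h2 := ((hasFDerivAt_norm_sinL2_sq hs (u t)).comp_hasDerivAt t (h.hasDerivAt t)).const_mul σ
  refine (h1.add h2).congr_deriv ?_
  rw [Phase.inner_source, inner_smul_right, innerSL_apply_apply, real_inner_comm]
  ring

theorem sinL2_sub_add (φ φ' : Fun N) (u u' : L2 N) :
    sinL2 ((φ + (u : Fun N)) - (φ' + (u' : Fun N))) =
      sinL2 ((φ - φ') + ((u - u' : L2 N) : Fun N)) := by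
  rw [AddSubgroup.coe_sub, add_sub_add_comm]

/-- The energy of the difference of two solutions. -/
theorem IsPhaseSolution.norm_sub_sq_le {σ : ℝ} {φ₀ φ₀' : Fun N} {p₀ p₀' : Fin N → L2 N}
    {u u' : ℝ → L2 N} {U U' : ℝ → Phase N} (h : IsPhaseSolution σ φ₀ p₀ u U)
    (h' : IsPhaseSolution σ φ₀' p₀' u' U') (hs : SinMem φ₀) (hs' : SinMem φ₀') (t : ℝ) :
    ‖U t - U' t‖ ^ 2 + ‖sinL2 ((φ₀ + (u t : Fun N)) - (φ₀' + (u' t : Fun N)))‖ ^ 2 ≤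
      (‖U 0 - U' 0‖ ^ 2 + ‖sinL2 ((φ₀ + (u 0 : Fun N)) - (φ₀' + (u' 0 : Fun N)))‖ ^ 2) *
        Real.exp ((|σ| + 1) * |t|) := by
  simp only [sinL2_sub_add]
  have hd : ∀ t, HasDerivAt
      (fun t => ‖U t - U' t‖ ^ 2 + ‖sinL2 ((φ₀ - φ₀') + ((u t - u' t : L2 N) : Fun N))‖ ^ 2)
      (2 * ⟪U t none - U' t none, -(σ / 2) • (sinTwoL2 (φ₀ + (u t : Fun N)) -
        sinTwoL2 (φ₀' + (u' t : Fun N)))⟫_ℝ +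
        ⟪sinTwoL2 ((φ₀ - φ₀') + ((u t - u' t : L2 N) : Fun N)), U t none - U' t none⟫_ℝ) t := by
    intro t
    have h1 := (h.solves.sub h'.solves).hasDerivAt_norm_sq (h.continuous.sub h'.continuous)
      ((Phase.source.continuous.comp (h.continuous_force hs)).sub
        (Phase.source.continuous.comp (h'.continuous_force hs'))) t
    have h2 := (hasFDerivAt_norm_sinL2_sq (hs.sub hs') (u t - u' t)).comp_hasDerivAt t
      ((h.hasDerivAt t).sub (h'.hasDerivAt t))
    refine (h1.add h2).congr_deriv ?_
    rw [← map_sub, Phase.inner_source, ← smul_sub, innerSL_apply_apply]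
    rfl
  refine le_mul_exp_of_abs_deriv_le hd (fun t => ?_) t
  set a := ‖U t none - U' t none‖
  set b := ‖sinL2 ((φ₀ - φ₀') + ((u t - u' t : L2 N) : Fun N))‖ with hb
  have ha0 : 0 ≤ a := norm_nonneg _
  have hb0 : 0 ≤ b := norm_nonneg _
  have h1 : |⟪U t none - U' t none, -(σ / 2) • (sinTwoL2 (φ₀ + (u t : Fun N)) -
      sinTwoL2 (φ₀' + (u' t : Fun N)))⟫_ℝ| ≤ a * (|σ| * b) := by
    refine (abs_real_inner_le_norm _ _).trans (mul_le_mul_of_nonneg_left ?_ ha0)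
    rw [norm_smul, norm_neg, norm_div, Real.norm_eq_abs, Real.norm_of_nonneg zero_le_two]
    have := mul_le_mul_of_nonneg_left (norm_sinTwoL2_sub_le (hs.add (u t)) (hs'.add (u' t)))
      (by positivity : 0 ≤ |σ| / 2)
    rw [sinL2_sub_add] at this
    linarith
  have h2 : |⟪sinTwoL2 ((φ₀ - φ₀') + ((u t - u' t : L2 N) : Fun N)), U t none - U' t none⟫_ℝ| ≤
      2 * b * a :=
    (abs_real_inner_le_norm _ _).trans
      (mul_le_mul_of_nonneg_right (norm_sinTwoL2_le ((hs.sub hs').add _)) ha0)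
  have h3 : a ^ 2 ≤ ‖U t - U' t‖ ^ 2 := by
    rw [Phase.norm_sq_eq]
    exact le_add_of_nonneg_right (Finset.sum_nonneg fun i _ => by positivity)
  refine (abs_add_le _ _).trans ?_
  rw [abs_mul, abs_two]
  -- The force term contributes `2 a b |σ|` and the potential term `2 a b`, whence the rate `|σ| +
  -- 1`.
  have h4 : 2 * (a * b) ≤ a ^ 2 + b ^ 2 := by nlinarith [sq_nonneg (a - b)]
  have h5 : 2 * (a * b) * (|σ| + 1) ≤ (a ^ 2 + b ^ 2) * (|σ| + 1) :=
    mul_le_mul_of_nonneg_right h4 (by positivity)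
  have h6 : a ^ 2 * (|σ| + 1) ≤ ‖U t - U' t‖ ^ 2 * (|σ| + 1) :=
    mul_le_mul_of_nonneg_right h3 (by positivity)
  linarith

theorem dsin_add_norm_le {σ T : ℝ} (hT : 0 ≤ T) {φ₀ φ₀' : Fun N} {φ₁ φ₁' : L2 N}
    (hφ₀ : MemHsin 1 φ₀) (hφ₀' : MemHsin 1 φ₀') {φ φ' : ℝ → Fun N} {v v' : ℝ → L2 N}
    (h : IsSolution σ φ₀ φ₁ φ v) (h' : IsSolution σ φ₀' φ₁' φ' v') {t : ℝ}
    (ht : t ∈ Set.Icc (-T) T) :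
    dsin (φ t) (φ' t) + ‖v t - v' t‖ ≤
      2 * Real.exp ((|σ| + 1) * T) * (dsin φ₀ φ₀' + ‖φ₁ - φ₁'‖) := by
  choose p₀ hp₀ _ using hφ₀.grad_mem
  choose p₀' hp₀' _ using hφ₀'.grad_mem
  have hs : SinMem φ₀ := hφ₀.sin_mem
  have hs' : SinMem φ₀' := hφ₀'.sin_mem
  obtain ⟨u, U, hU, hφ, hv⟩ := h.exists_isPhaseSolution hφ₀.locallyIntegrable hs hp₀
  obtain ⟨u', U', hU', hφ', hv'⟩ := h'.exists_isPhaseSolution hφ₀'.locallyIntegrable hs' hp₀'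
  have hE : ∀ t, dsin (φ t) (φ' t) ^ 2 + ‖v t - v' t‖ ^ 2 = ‖U t - U' t‖ ^ 2 +
      ‖sinL2 ((φ₀ + (u t : Fun N)) - (φ₀' + (u' t : Fun N)))‖ ^ 2 := by
    intro t
    rw [hφ, hφ', dsin_eq (hs.add _) (hs'.add _) (hU.hasWeakPartial_add hp₀ t)
      (hU'.hasWeakPartial_add hp₀' t), Real.sq_sqrt (by positivity), Phase.norm_sq_eq, ← hv, ← hv']
    simp only [PiLp.sub_apply]
    ring
  have hle := hU.norm_sub_sq_le hU' hs hs' t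
  rw [← hE, ← hE, h.init, h'.init, h.init_deriv, h'.init_deriv] at hle
  have hexp : Real.exp ((|σ| + 1) * |t|) ≤ Real.exp ((|σ| + 1) * T) :=
    Real.exp_le_exp.2 (mul_le_mul_of_nonneg_left (abs_le.2 ht) (by positivity))
  have hexp1 : 1 ≤ Real.exp ((|σ| + 1) * T) := Real.one_le_exp (by positivity)
  set e := Real.exp ((|σ| + 1) * T)
  have hd : ∀ a b : Fun N, 0 ≤ dsin a b := fun a b => Real.sqrt_nonneg _
  set a := dsin (φ t) (φ' t)
  set b := ‖v t - v' t‖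
  set c := dsin φ₀ φ₀'
  set d := ‖φ₁ - φ₁'‖
  have hc : 0 ≤ c := hd _ _
  have hd0 : 0 ≤ d := norm_nonneg _
  -- On squares, `(a + b)² ≤ 2 (a² + b²) ≤ 2 (c + d)² e`. As `1 ≤ e`, this is at most the square of
  -- `2 e (c + d)`, a crude constant that avoids square roots.
  refine abs_le_of_sq_le_sq' ?_ (by positivity) |>.2
  have h1 : (a + b) ^ 2 ≤ 2 * (a ^ 2 + b ^ 2) := by nlinarith [sq_nonneg (a - b)]
  have h2 : c ^ 2 + d ^ 2 ≤ (c + d) ^ 2 := by nlinarith [mul_nonneg hc hd0]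
  have h3 : (c ^ 2 + d ^ 2) * Real.exp ((|σ| + 1) * |t|) ≤ (c + d) ^ 2 * e :=
    mul_le_mul h2 hexp (Real.exp_pos _).le (by positivity)
  have h4 : (c + d) ^ 2 * e ≤ (c + d) ^ 2 * (e * e) := by
    refine mul_le_mul_of_nonneg_left ?_ (by positivity)
    nlinarith
  nlinarith [sq_nonneg ((c + d) * e)]

/-- `dsin` does not separate functions differing by a multiple of `π`, so uniqueness is read from
the velocities: by `dsin_add_norm_le` they agree, and integrating them from the common initial value
identifies the solutions. -/
theorem existsUnique_solution (σ : ℝ) {φ₀ : Fun N} (φ₁ : L2 N) (hφ₀ : MemHsin 1 φ₀) :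
    ∃! φ : ℝ → Fun N, ∃ v : ℝ → L2 N, IsSolution σ φ₀ φ₁ φ v := by
  choose p₀ hp₀ _ using hφ₀.grad_mem
  obtain ⟨u, U, hU, hU0⟩ := SineGordon.exists_isPhaseSolution σ hφ₀.sin_mem p₀ φ₁
  have hsol := hU.isSolution hφ₀.locallyIntegrable hφ₀.sin_mem hp₀
  rw [hU0] at hsol
  refine ⟨_, ⟨_, hsol⟩, ?_⟩
  rintro φ ⟨v, h⟩
  have hv : ∀ t, v t = U t none := by
    intro t
    have h1 := dsin_add_norm_le (abs_nonneg t) hφ₀ hφ₀ h hsol (t := t)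
      ⟨neg_abs_le t, le_abs_self t⟩
    have h2 : dsin φ₀ φ₀ = 0 := by simp [dsin]
    rw [h2, sub_self, norm_zero, add_zero, mul_zero] at h1
    have h3 : 0 ≤ dsin (φ t) (φ₀ + (u t : Fun N)) := Real.sqrt_nonneg _
    have h4 : ‖v t - U t none‖ = 0 := le_antisymm (by linarith) (norm_nonneg _)
    exact sub_eq_zero.1 (norm_eq_zero.1 h4)
  obtain ⟨w, hφw, hw⟩ := h.hasTimeDeriv
  have hw0 : w 0 = 0 := Subtype.ext (left_eq_add.1 (hφw 0))
  funext t
  have := eq_of_hasDerivAt_eq (fun t => hv t ▸ hw t) hU.hasDerivAt (hw0.trans hU.zero.symm) t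
  rw [hφw, h.init, this]

theorem energy_eq {σ : ℝ} {φ₀ : Fun N} {φ₁ : L2 N} (hφ₀ : MemHsin 1 φ₀) {φ : ℝ → Fun N}
    {v : ℝ → L2 N} (h : IsSolution σ φ₀ φ₁ φ v) (t : ℝ) :
    Integrable (energyDensity σ (φ t) (v t)) volume ∧
      energy σ (φ t) (v t) = energy σ φ₀ φ₁ := by
  choose p₀ hp₀ _ using hφ₀.grad_mem
  have hs : SinMem φ₀ := hφ₀.sin_mem
  obtain ⟨u, U, hU, hφ, hv⟩ := h.exists_isPhaseSolution hφ₀.locallyIntegrable hs hp₀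
  have hE : ∀ t, Integrable (energyDensity σ (φ t) (v t)) volume ∧
      ∫ x, energyDensity σ (φ t) (v t) x =
        ‖U t‖ ^ 2 + σ * ‖sinL2 (φ₀ + (u t : Fun N))‖ ^ 2 := by
    intro t
    rw [hφ, Phase.norm_sq_eq, hv]
    exact integrable_energyDensity (hs.add _) (hU.hasWeakPartial_add hp₀ t) (v t)
  refine ⟨(hE t).1, ?_⟩
  have hc := is_const_of_deriv_eq_zero (fun s => (hU.hasDerivAt_energy hs s).differentiableAt)
    (fun s => (hU.hasDerivAt_energy hs s).deriv) t 0
  have h0 : energy σ φ₀ φ₁ = energy σ (φ 0) (v 0) := by rw [h.init, h.init_deriv]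
  rw [h0, energy, energy, (hE t).2, (hE 0).2]
  exact congrArg (1 / 2 * ·) hc

/-! ### Propagation of regularity -/

theorem eq_of_smear_mollifier_eq {f g : L2 N}
    (h : ∀ n, smear (mollifier N n) f = smear (mollifier N n) g) : f = g :=
  tendsto_nhds_unique (tendsto_smear_mollifier f)
    ((tendsto_smear_mollifier g).congr fun n => (h n).symm)

theorem HasWeakPartial.sub_L2 {i : Fin N} {v g w h : L2 N}
    (hv : HasWeakPartial i (v : Fun N) (g : Fun N)) (hw : HasWeakPartial i (w : Fun N) (h : Fun N)) :
    HasWeakPartial i ((v - w : L2 N) : Fun N) ((g - h : L2 N) : Fun N) :=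
  hasWeakPartial_of_smear_eq fun n => by rw [map_sub, map_sub, hv.smear_eq, hw.smear_eq]

theorem Phase.diag_smear_M (η : TestFun N) (n : ℕ) (U : Phase N) :
    Phase.diag (smear η) ((waveRegularization N).M n U) =
      (waveRegularization N).M n (Phase.diag (smear η) U) :=
  PiLp.ext fun o => by
    rw [waveRegularization_M, Phase.diag_apply, Phase.diag_apply, waveRegularization_M, smear_comm]

theorem Phase.diag_smear_A (η : TestFun N) (n : ℕ) (U : Phase N) :
    Phase.diag (smear η) ((waveRegularization N).A n U) =
      (waveRegularization N).A n (Phase.diag (smear η) U) := by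
  refine Phase.ext ?_ fun i => ?_
  · simp only [waveRegularization_A_none, Phase.diag_apply, map_sum]
    exact Finset.sum_congr rfl fun i _ => smear_comm _ _ _
  · simp only [waveRegularization_A_some, Phase.diag_apply]
    exact smear_comm _ _ _

theorem Phase.diag_source (B : L2 N →L[ℝ] L2 N) (f : L2 N) :
    Phase.diag B (Phase.source f) = Phase.source (B f) :=
  Phase.ext rfl fun i => by
    rw [Phase.diag_apply, Phase.source_some, Phase.source_some, map_zero]

namespace IsPhaseSolution

variable {σ : ℝ} {φ₀ : Fun N} {p₀ : Fin N → L2 N} {u : ℝ → L2 N} {U : ℝ → Phase N}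

theorem init_some (h : IsPhaseSolution σ φ₀ p₀ u U) (i : Fin N) : U 0 (some i) = p₀ i :=
  eq_of_smear_mollifier_eq fun n => by
    have := (h.hasWeakPartial 0 i).smear_eq (mollifier N n)
    rwa [h.zero, map_zero, map_sub, sub_eq_zero] at this

/-- Propagation of regularity: the space derivatives of `U` solve the differentiated system. -/
theorem exists_hasWeakPartial (h : IsPhaseSolution σ φ₀ p₀ u U) (hs : SinMem φ₀)
    (h₀ : ∀ i, HasWeakPartial i φ₀ (p₀ i : Fun N)) (j : Fin N) {q : Fin N → L2 N} {r : L2 N}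
    (hq : ∀ i, HasWeakPartial j (p₀ i : Fun N) (q i : Fun N))
    (hr : HasWeakPartial j (U 0 none : Fun N) (r : Fun N)) :
    ∃ V : ℝ → Phase N, Continuous V ∧
      ∀ t o, HasWeakPartial j (U t o : Fun N) (V t o : Fun N) := by
  -- The derivative of the force along `x_j`, by the chain rule. It only involves `∂_jφ`, already
  -- known as a component of `U`, so the problem for `V` is linear with a given source.
  let g : ℝ → L2 N := fun t =>
    -(σ / 2) • ((2 : ℝ) • cosMul (φ₀ + (u t : Fun N)) (U t (some j)))
  have hgc : Continuous g := by
    have h1 := (continuous_cosMul φ₀).comp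
      (h.continuous_u.prodMk (Phase.continuous_apply h.continuous (some j)))
    exact (h1.const_smul (2 : ℝ)).const_smul (-(σ / 2))
  let x : Phase N := WithLp.toLp 2 fun o => match o with
    | none => r
    | some i => q i
  obtain ⟨V, hV, hVx, hVs⟩ := (waveRegularization N).exists_solves
    (Phase.source.continuous.comp hgc) x
  have hV0 : V 0 none = r := by rw [hVx]
  have hV1 : ∀ i, V 0 (some i) = q i := fun i => by rw [hVx]
  refine ⟨V, hV, fun t o => hasWeakPartial_of_smear_eq fun n => ?_⟩
  -- `V` is identified without knowing that `U` is differentiable: `U` convolved with `∂_jρ` and `V`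
  -- convolved with `ρ` solve the same equation with the same data, and uniqueness applies.
  set ρ := mollifier N n
  have h1 := h.solves.map (Phase.diag (smear (ρ.pderiv j))) (Phase.diag_smear_M _)
    (Phase.diag_smear_A _)
  have h2 := hVs.map (Phase.diag (smear ρ)) (Phase.diag_smear_M _) (Phase.diag_smear_A _)
  have hforce : (fun t => Phase.diag (smear (ρ.pderiv j))
      (Phase.source (-(σ / 2) • sinTwoL2 (φ₀ + (u t : Fun N))))) =
      fun t => Phase.diag (smear ρ) ((Phase.source ∘ g) t) := by
    funext t
    have h3 := ((h.hasWeakPartial_add h₀ t j).sinTwoL2 (hs.add (u t))).smear_eq ρ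
    simp only [Function.comp_apply, Phase.diag_source, g]
    rw [(smear (ρ.pderiv j)).map_smul, (smear ρ).map_smul, h3]
  rw [hforce] at h1
  have h4 := h1.unique h2 ((Phase.diag _).continuous.comp h.continuous)
    ((Phase.diag _).continuous.comp hV) (Phase.ext
      (by rw [Phase.diag_apply, Phase.diag_apply, hV0, hr.smear_eq])
      fun i => by rw [Phase.diag_apply, Phase.diag_apply, hV1, h.init_some, (hq i).smear_eq])
  have h5 := congrArg (fun W : Phase N => W o) (congrFun h4 t)
  simp only [Phase.diag_apply] at h5
  exact h5.symm

end IsPhaseSolution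

theorem propagation_of_regularity {σ : ℝ} {φ₀ : Fun N} {φ₁ : L2 N} (hφ₀ : MemHsin 2 φ₀)
    (hφ₁ : MemH 1 φ₁) {φ : ℝ → Fun N} {v : ℝ → L2 N} (h : IsSolution σ φ₀ φ₁ φ v) :
    ContinuousInAffineH 2 φ₀ φ ∧ ContinuousInH 1 v ∧
      ∃ a : ℝ → L2 N, (∀ t, HasDerivAt v (a t) t) ∧ Continuous a := by
  choose p₀ hp₀ hp₀' using hφ₀.grad_mem
  choose q hq _ using hp₀'
  choose r hr _ using hφ₁
  have hs : SinMem φ₀ := hφ₀.sin_mem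
  obtain ⟨u, U, hU, hφ, hv⟩ := h.exists_isPhaseSolution hφ₀.locallyIntegrable hs hp₀
  have hV : ∀ j, ∃ V : ℝ → Phase N, Continuous V ∧
      ∀ t o, HasWeakPartial j (U t o : Fun N) (V t o : Fun N) := fun j =>
    hU.exists_hasWeakPartial hs hp₀ j (fun i => hq i j)
      (r := r j) (by rw [hv, h.init_deriv]; exact hr j)
  choose V hVc hVw using hV
  have hvU : v = fun t => U t none := funext fun t => (hv t).symm
  refine ⟨⟨u, hφ, hU.continuous_u, fun i => ⟨fun t => U t (some i) - p₀ i,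
    fun t => hU.hasWeakPartial t i, (Phase.continuous_apply hU.continuous _).sub continuous_const,
    fun j => ⟨fun t => V j t (some i) - q i j, fun t => (hVw j t (some i)).sub_L2 (hq i j),
      (Phase.continuous_apply (hVc j) _).sub continuous_const⟩⟩⟩,
    ⟨h.continuous_deriv, fun j => ⟨fun t => V j t none, fun t => hv t ▸ hVw j t none,
      Phase.continuous_apply (hVc j) _⟩⟩, ?_⟩
  -- The expected `∂ₜₜφ`: the diagonal second derivatives `∂ᵢ∂ᵢφ` now exist in `L²`, so the
  -- divergence of the gradient is an actual function.
  let a : ℝ → L2 N := fun t =>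
    ∑ i, V i t (some i) + -(σ / 2) • sinTwoL2 (φ₀ + (u t : Fun N))
  have hac : Continuous a := (continuous_finsetSum _ fun i _ =>
    Phase.continuous_apply (hVc i) (some i)).add (hU.continuous_force hs)
  refine ⟨a, fun t => ?_, hac⟩
  -- The derivative of `v` is known only after mollification; in integrated form the mollifier can
  -- be removed.
  have hInt : ∀ t, v t = v 0 + ∫ s in (0 : ℝ)..t, a s := by
    intro t
    refine eq_of_smear_mollifier_eq fun n => ?_
    refine eq_of_hasDerivAt_eq (f := fun t => smear (mollifier N n) (v t))
      (f' := fun t => smear (mollifier N n) (a t))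
      (g := fun t => smear (mollifier N n) (v 0 + ∫ s in (0 : ℝ)..t, a s))
      (fun t => ?_) (fun t => ?_) (by simp) t
    · rw [hvU]
      refine (hU.hasDerivAt_smear_none n t).congr_deriv ?_
      simp only [a, map_add, map_sum, (hVw _ t _).smear_eq]
    · exact (smear (mollifier N n)).hasFDerivAt.comp_hasDerivAt t
        ((hasDerivAt_primitive hac t).const_add (v 0))
  rw [funext hInt]
  exact (hasDerivAt_primitive hac t).const_add (v 0)

end SineGordon


open SineGordon

theorem mainTheorem5 (σ : ℝ) (hσ : σ ≠ 0) :
    -- existence and uniqueness of a global solution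
    (∀ N : ℕ, 1 ≤ N → ∀ (φ₀ : Fun N) (φ₁ : L2 N), MemHsin 1 φ₀ →
      ∃! φ : ℝ → Fun N, ∃ v : ℝ → L2 N, IsSolution σ φ₀ φ₁ φ v) ∧
    -- (i) Lipschitz continuity of the flow, with a constant depending only on `σ` and `T`
    (∀ T : ℝ, 0 < T → ∃ A : ℝ, 0 < A ∧
      ∀ N : ℕ, 1 ≤ N → ∀ (φ₀ φ₀' : Fun N) (φ₁ φ₁' : L2 N), MemHsin 1 φ₀ → MemHsin 1 φ₀' →
        ∀ (φ φ' : ℝ → Fun N) (v v' : ℝ → L2 N),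
          IsSolution σ φ₀ φ₁ φ v → IsSolution σ φ₀' φ₁' φ' v' →
          ∀ t ∈ Set.Icc (-T) T,
            dsin (φ t) (φ' t) + ‖v t - v' t‖ ≤ A * (dsin φ₀ φ₀' + ‖φ₁ - φ₁'‖)) ∧
    -- (ii) propagation of regularity
    (∀ N : ℕ, 1 ≤ N → ∀ (φ₀ : Fun N) (φ₁ : L2 N), MemHsin 2 φ₀ → MemH 1 φ₁ →
      ∀ (φ : ℝ → Fun N) (v : ℝ → L2 N), IsSolution σ φ₀ φ₁ φ v →
        ContinuousInAffineH 2 φ₀ φ ∧ ContinuousInH 1 v ∧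
          ∃ a : ℝ → L2 N, (∀ t, HasDerivAt v (a t) t) ∧ Continuous a) ∧
    -- (iii) finiteness and conservation of the energy
    (∀ N : ℕ, 1 ≤ N → ∀ (φ₀ : Fun N) (φ₁ : L2 N), MemHsin 1 φ₀ →
      ∀ (φ : ℝ → Fun N) (v : ℝ → L2 N), IsSolution σ φ₀ φ₁ φ v →
        ∀ t, Integrable (energyDensity σ (φ t) (v t)) volume ∧
          energy σ (φ t) (v t) = energy σ φ₀ φ₁) :=
  ⟨fun _ _ _ φ₁ hφ₀ => existsUnique_solution σ φ₁ hφ₀,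
    fun T hT => ⟨2 * Real.exp ((|σ| + 1) * T), by positivity,
      fun _ _ _ _ _ _ hφ₀ hφ₀' _ _ _ _ h h' _ ht => dsin_add_norm_le hT.le hφ₀ hφ₀' h h' ht⟩,
    fun _ _ _ _ hφ₀ hφ₁ _ _ h => propagation_of_regularity hφ₀ hφ₁ h,
    fun _ _ _ _ hφ₀ _ _ h t => energy_eq hφ₀ h t⟩
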